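/- **Three-Sided Boundary Labeling (fixed ports).** An instance of size $n$ consists of a rectangle $R=[0,W]\times[0,H]$ with $W,H>0$, of $n$ points of $R$ (the *sites*), and of $n$ labels; each label lies on the left, the top or the right side of $R$ and is represented by its *port*, a given point on that side. Different labels have different ports, no two sites lie on a common horizontal or vertical line, and no site lies on a horizontal or vertical line through a port. The *po-leader* from a site $p=(p_x,p_y)$ to a port $t=(t_x,t_y)$ consists of the segment from $p$ to a bend $b$, parallel to the side of $t$, and the segment from $b$ to $t$, orthogonal to that side; so $b=(p_x,t_y)$ for the left and the right side and $b=(t_x,p_y)$ for the top side. A bijection between sites and labels is a *planar solution* if the po-leaders of any two different sites are disjoint. To *solve* an instance means to decide whether it has a planar solution and, if it has one, to output one. **Theorem.** Three-Sided Boundary Labeling can be solved in $O(n^4)$ time using $O(n)$ space. More precisely, there is one program, for all $n$, that solves every instance of size $n$ in at most $T(n)$ steps using at most $S(n)$ memory cells, where $T(n)=O(n^4)$ and $S(n)=O(n)$. The machine model is a random access machine with unit-cost operations (reading and writing cells with indirect addressing, $+$, truncated $-$, $\times$, integer division, comparisons, branching). Its work cells hold natural numbers below $(n+2)^c$ for a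 constant $c$, that is, $O(\log n)$ bits each. The real coordinates of the input are read-only and can only be compared with each other. The cells that hold the input are counted in $S(n)$. -/

import Mathlib

namespace BoundaryLabeling

/-! ### Three-sided boundary labeling with fixed ports and po-leaders -/

/-- The three sides of the enclosing rectangle that may carry labels. -/
inductive Side where
  | left
  | top
  | right

/-- The points of the given side of the rectangle `[0,W] × [0,H]`. -/
def Side.edge (W H : ℝ) : Side → Set (ℝ × ℝ)
  | Side.left => {q | q.1 = 0 ∧ 0 ≤ q.2 ∧ q.2 ≤ H}
  | Side.top => {q | 0 ≤ q.1 ∧ q.1 ≤ W ∧ q.2 = H}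
  | Side.right => {q | q.1 = W ∧ 0 ≤ q.2 ∧ q.2 ≤ H}

/-- An instance with `n` sites and `n` labels. Ports are fixed, so a label is represented by its
port together with the side of the rectangle on which the label lies. -/
structure Instance (n : ℕ) where
  /-- width of the enclosing rectangle -/
  W : ℝ
  /-- height of the enclosing rectangle -/
  H : ℝ
  /-- the sites -/
  site : Fin n → ℝ × ℝ
  /-- the type of each label -/
  side : Fin n → Side
  /-- the port of each label -/
  port : Fin n → ℝ × ℝ
  W_pos : 0 < W
  H_pos : 0 < H
  /-- the sites lie in the rectangle -/
  site_mem : ∀ i, 0 ≤ (site i).1 ∧ (site i).1 ≤ W ∧ 0 ≤ (site i).2 ∧ (site i).2 ≤ H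
  /-- every port lies on the side to which its label belongs -/
  port_mem : ∀ j, port j ∈ (side j).edge W H
  /-- different labels have different ports -/
  port_injective : Function.Injective port
  /-- no two sites on a common horizontal or vertical line -/
  site_general : ∀ i i', i ≠ i' → (site i).1 ≠ (site i').1 ∧ (site i).2 ≠ (site i').2
  /-- no site on a horizontal or vertical line through a port -/
  port_general : ∀ i j, (site i).1 ≠ (port j).1 ∧ (site i).2 ≠ (port j).2

/-- The bend of the po-leader from the site `p` to the port `t` of a label of type `s`: the
segment that starts at `p` is parallel to the side `s`, the one that ends at `t` is orthogonal. -/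
def bend (s : Side) (p t : ℝ × ℝ) : ℝ × ℝ :=
  match s with
  | Side.left => (p.1, t.2)
  | Side.top => (t.1, p.2)
  | Side.right => (p.1, t.2)

/-- The po-leader from the site `p` to the port `t` of a label of type `s`. -/
def leader (s : Side) (p t : ℝ × ℝ) : Set (ℝ × ℝ) :=
  segment ℝ p (bend s p t) ∪ segment ℝ (bend s p t) t

namespace Instance

variable {n : ℕ}

/-- The leader that connects site `i` to label `j`. -/
def leaderOf (I : Instance n) (i j : Fin n) : Set (ℝ × ℝ) :=
  leader (I.side j) (I.site i) (I.port j)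

/-- The solution that matches every site `i` to the label `m i` is planar: no two of its leaders
intersect. -/
def IsPlanarSolution (I : Instance n) (m : Fin n ≃ Fin n) : Prop :=
  ∀ i i', i ≠ i' → Disjoint (I.leaderOf i (m i)) (I.leaderOf i' (m i'))

/-- A planar solution exists. -/
def Solvable (I : Instance n) : Prop :=
  ∃ m : Fin n ≃ Fin n, I.IsPlanarSolution m

end Instance

/-! ### A word RAM with read-only input

A machine has a constant number of registers and a constant number of zero-initialised arrays of
equal length; each cell holds one word, that is, a natural number below a given bound. The input
consists of words and of real numbers. It is read-only, and the only operation on real numbers is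
the comparison of two input numbers. -/

/-- An input: a list of words and a list of real numbers. -/
structure Input where
  words : List ℕ
  reals : List ℝ

/-- The data of a machine that do not change during a run. -/
structure Machine where
  /-- the input -/
  input : Input
  /-- words are the natural numbers below this bound -/
  bound : ℕ
  /-- the length of each array -/
  len : ℕ

/-- Operations on two words. -/
inductive Op where
  | add
  | sub
  | mul
  | div
  | lt
  | eq

/-- Subtraction is truncated at `0`, division rounds down with `x / 0 = 0`, and the truth values
of comparisons are `1` and `0`. -/
def Op.eval : Op → ℕ → ℕ → ℕ
  | Op.add, x, y => x + y
  | Op.sub, x, y => x - y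
  | Op.mul, x, y => x * y
  | Op.div, x, y => x / y
  | Op.lt, x, y => if x < y then 1 else 0
  | Op.eq, x, y => if x = y then 1 else 0

/-- Expressions over `V` registers and `K` arrays. -/
inductive Expr (V K : ℕ) where
  /-- a constant -/
  | const (k : ℕ)
  /-- the content of a register -/
  | reg (r : Fin V)
  /-- the array cell with the index given by `e` -/
  | arr (a : Fin K) (e : Expr V K)
  /-- the input word with the index given by `e` -/
  | word (e : Expr V K)
  /-- an operation on two words -/
  | op (o : Op) (e f : Expr V K)
  /-- `1` if the input real with index `e` is smaller than the one with index `f`, else `0` -/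
  | ltReal (e f : Expr V K)

/-- Commands over `V` registers and `K` arrays. -/
inductive Cmd (V K : ℕ) where
  /-- do nothing -/
  | skip
  /-- assign `e` to the register `r` -/
  | setReg (r : Fin V) (e : Expr V K)
  /-- assign `f` to the cell of the array `a` with the index given by `e` -/
  | setArr (a : Fin K) (e f : Expr V K)
  /-- execute two commands one after the other -/
  | seq (c d : Cmd V K)
  /-- execute `c` if `e` is not `0`, and `d` otherwise -/
  | ite (e : Expr V K) (c d : Cmd V K)
  /-- execute `c` as long as `e` is not `0` -/
  | loop (e : Expr V K) (c : Cmd V K)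

/-- The contents of the registers and arrays. -/
structure Store (V K : ℕ) where
  reg : Fin V → ℕ
  arr : Fin K → ℕ → ℕ

/-- The store in which all cells are `0`. -/
def Store.zero (V K : ℕ) : Store V K := ⟨fun _ => 0, fun _ _ => 0⟩

/-- Write `x` to the register `r`. -/
def Store.setReg {V K : ℕ} (σ : Store V K) (r : Fin V) (x : ℕ) : Store V K :=
  ⟨Function.update σ.reg r x, σ.arr⟩

/-- Write `x` to cell `i` of the array `a`. -/
def Store.setArr {V K : ℕ} (σ : Store V K) (a : Fin K) (i x : ℕ) : Store V K :=
  ⟨σ.reg, Function.update σ.arr a (Function.update (σ.arr a) i x)⟩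

namespace Expr

variable {V K : ℕ}

open Classical in
/-- The value of an expression. -/
noncomputable def val (M : Machine) (σ : Store V K) : Expr V K → ℕ
  | const k => k
  | reg r => σ.reg r
  | arr a e => σ.arr a (e.val M σ)
  | word e => M.input.words.getD (e.val M σ) 0
  | op o e f => o.eval (e.val M σ) (f.val M σ)
  | ltReal e f =>
      if M.input.reals.getD (e.val M σ) 0 < M.input.reals.getD (f.val M σ) 0 then 1 else 0

/-- The evaluation of the expression succeeds: no index is out of range, and every intermediate
result is a word of the machine. -/
def Safe (M : Machine) (σ : Store V K) : Expr V K → Prop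
  | const k => k < M.bound
  | reg _ => True
  | arr _ e => e.Safe M σ ∧ e.val M σ < M.len
  | word e => e.Safe M σ ∧ e.val M σ < M.input.words.length ∧
      M.input.words.getD (e.val M σ) 0 < M.bound
  | op o e f => e.Safe M σ ∧ f.Safe M σ ∧ o.eval (e.val M σ) (f.val M σ) < M.bound
  | ltReal e f => e.Safe M σ ∧ f.Safe M σ ∧
      e.val M σ < M.input.reals.length ∧ f.val M σ < M.input.reals.length

/-- The number of steps needed to evaluate the expression: one for each node. -/
def cost : Expr V K → ℕ
  | const _ => 1
  | reg _ => 1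
  | arr _ e => e.cost + 1
  | word e => e.cost + 1
  | op _ e f => e.cost + f.cost + 1
  | ltReal e f => e.cost + f.cost + 1

end Expr

/-- `Exec M c σ t τ`: started in the store `σ`, the command `c` halts after `t` steps in the store
`τ`, and no expression that is evaluated on the way is unsafe. -/
inductive Exec {V K : ℕ} (M : Machine) : Cmd V K → Store V K → ℕ → Store V K → Prop
  | skip (σ : Store V K) : Exec M Cmd.skip σ 1 σ
  | setReg (σ : Store V K) (r : Fin V) (e : Expr V K) (he : e.Safe M σ) :
      Exec M (Cmd.setReg r e) σ (e.cost + 1) (σ.setReg r (e.val M σ))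
  | setArr (σ : Store V K) (a : Fin K) (e f : Expr V K) (he : e.Safe M σ) (hf : f.Safe M σ)
      (hlen : e.val M σ < M.len) :
      Exec M (Cmd.setArr a e f) σ (e.cost + f.cost + 1) (σ.setArr a (e.val M σ) (f.val M σ))
  | seq (σ τ υ : Store V K) (c d : Cmd V K) (s t : ℕ) (hc : Exec M c σ s τ)
      (hd : Exec M d τ t υ) :
      Exec M (Cmd.seq c d) σ (s + t) υ
  | ite_true (σ τ : Store V K) (e : Expr V K) (c d : Cmd V K) (t : ℕ) (he : e.Safe M σ)
      (hval : e.val M σ ≠ 0) (hc : Exec M c σ t τ) :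
      Exec M (Cmd.ite e c d) σ (e.cost + 1 + t) τ
  | ite_false (σ τ : Store V K) (e : Expr V K) (c d : Cmd V K) (t : ℕ) (he : e.Safe M σ)
      (hval : e.val M σ = 0) (hd : Exec M d σ t τ) :
      Exec M (Cmd.ite e c d) σ (e.cost + 1 + t) τ
  | loop_true (σ τ υ : Store V K) (e : Expr V K) (c : Cmd V K) (s t : ℕ) (he : e.Safe M σ)
      (hval : e.val M σ ≠ 0) (hc : Exec M c σ s τ) (hloop : Exec M (Cmd.loop e c) τ t υ) :
      Exec M (Cmd.loop e c) σ (e.cost + 1 + s + t) υ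
  | loop_false (σ : Store V K) (e : Expr V K) (c : Cmd V K) (he : e.Safe M σ)
      (hval : e.val M σ = 0) :
      Exec M (Cmd.loop e c) σ (e.cost + 1) σ

/-- A program: the number of registers and arrays it uses, its code, and the register and the
array in which it leaves its result. -/
structure Program where
  regs : ℕ
  arrs : ℕ
  code : Cmd regs arrs
  ansReg : Fin regs
  ansArr : Fin arrs

/-- The program halts on the machine `M` after `t` steps in the store `τ`. -/
def Program.HaltsIn (p : Program) (M : Machine) (t : ℕ) (τ : Store p.regs p.arrs) : Prop :=
  Exec M p.code (Store.zero p.regs p.arrs) t τ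

/-- The number of cells that are available to the program on the machine `M`, including the
cells that hold the input. -/
def Program.space (p : Program) (M : Machine) : ℕ :=
  p.regs + p.arrs * M.len + M.input.words.length + M.input.reals.length

/-! ### Solving the labeling problem on the machine -/

/-- The word that encodes a side in the input. -/
def Side.code : Side → ℕ
  | Side.left => 0
  | Side.top => 1
  | Side.right => 2

namespace Instance

variable {n : ℕ}

/-- The instance as an input. The words are `n` and the types of the labels; the reals are the
coordinates of the sites and of the ports, and the width and height of the rectangle. -/
def input (I : Instance n) : Input where
  words := n :: List.ofFn (fun j => (I.side j).code)
  reals := List.ofFn (fun i => (I.site i).1) ++ List.ofFn (fun i => (I.site i).2) ++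
    List.ofFn (fun j => (I.port j).1) ++ List.ofFn (fun j => (I.port j).2) ++ [I.W, I.H]

/-- The output `ans`, `out` is correct: for a solvable instance the answer is `1`, and the array
lists for every site the label to which it is connected in some planar solution; otherwise the
answer is `0`. -/
def CorrectOutput (I : Instance n) (ans : ℕ) (out : ℕ → ℕ) : Prop :=
  (I.Solvable → ans = 1 ∧
    ∃ m : Fin n ≃ Fin n, I.IsPlanarSolution m ∧ ∀ i : Fin n, out i = (m i : ℕ)) ∧
  (¬ I.Solvable → ans = 0)

end Instance

/-- The program decides every instance and outputs a planar solution if there is one. Instances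
with `n` sites are solved in at most `T n` steps with at most `S n` cells, each of which holds
a word below `(n + 2) ^ c` (or an input number). -/
def Program.SolvesThreeSided (p : Program) (c : ℕ) (T S : ℕ → ℕ) : Prop :=
  ∀ (n : ℕ) (I : Instance n), ∃ (len t : ℕ) (τ : Store p.regs p.arrs),
    n ≤ len ∧
    p.HaltsIn ⟨I.input, (n + 2) ^ c, len⟩ t τ ∧
    t ≤ T n ∧
    p.space ⟨I.input, (n + 2) ^ c, len⟩ ≤ S n ∧
    I.CorrectOutput (τ.reg p.ansReg) (τ.arr p.ansArr)

end BoundaryLabeling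

/-! Only the order of the coordinates matters, so they are replaced by ranks, with rows counted from
the top. In a planar solution, the leader of the lowest site with a top port yields a cut point
`(xt, y₀)`: all sites with top ports lie above row `y₀`, each of them on the same side of column
`xt` as its port; left ports above `y₀` belong to sites left of `xt`, and right ports above `y₀` to
sites that are not. The two halves are mirror images, so it suffices to understand the left one.

In the left half the sites for the top ports are separated from the other sites by a monotone
staircase `e` that ends in the cut point. A staircase is admissible (`Disc.Full`) if the number of
sites above it is the number of top ports left of `xt` and if two counting conditions hold along it.
`TG` says that enough sites above the staircase are available to use up the top ports left of some
column; `LG` says that enough sites left of the staircase are available to use up the left ports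
above some row. Both depend only on the current point and on the number `b` of sites left of the
staircase so far.

Necessity (`Frame.feasible_of_good`, `Disc.exists_full`): a box in the top left corner grows by one
column or row at a time, together with an up-closed region that contains as many sites of the box as
there are sites in the given set. When the number is off by one, one site is added or removed
(`Frame.exists_enlarge` and its transpose). The region need not contain the same sites as the given
set; only the numbers agree.

Sufficiency (`Disc.planar_of_greedy`): given admissible staircases in both halves, the sites above a
staircase are treated from top to bottom, and each takes the nearest free top port on its outer
side, or else the nearest one on the other side. Of the remaining sites the leftmost ones go to the
left side, treated from left to right, each taking the nearest free port above it, or else below it;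
the right side is symmetric. `TG` keeps the top leaders on their side of the staircase, and `LG`
makes sure that the left ports above are used up before the greedy procedure arrives at the
staircase. Hence the two families of leaders do not meet.

For fixed `xt` the staircases are found by dynamic programming over the rows: for each `b` only the
leftmost reachable column is needed (`Disc.Reach`). With the extremal values of the counting
conditions tabulated, a row takes quadratic time; all end rows are treated in one cubic pass, and
all `xt` in time of order `n ^ 4`. Only the current row of the table is stored. A staircase is
recovered backwards by repeating the dynamic program once per row, which `Disc.Full.exchange`
justifies; this again takes time of order `n ^ 4` and linear space.

The program is written in a small language in which every expression can be evaluated and every loop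
has `2 * n + 2` rounds. Its running time can therefore be read off from the nesting depth of its
loops, which is 4. -/

namespace BoundaryLabeling

/-! ### Regions that separate the sites of top ports from the others -/

/-- `v` lies in the closed interval with end points `a` and `b`. -/
def Btw (a v b : ℕ) : Prop := (a ≤ v ∧ v ≤ b) ∨ (b ≤ v ∧ v ≤ a)

open Classical in
/-- The sites that lie left of column `x` and above row `y` and satisfy `p`. -/
noncomputable def boxSites {ι : Type} [Fintype ι] (X Y : ι → ℕ) (x y : ℕ) (p : ι → Prop) :
    Finset ι :=
  Finset.univ.filter fun s => X s < x ∧ Y s < y ∧ p s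

/-- A partial labeling with left ports (of the sites in `L`) and top ports (of the sites in `T`)
such that the leaders are disjoint; rows are counted from the top. `A` is a set of sites which
cannot lie below the leader of a site in `L`, and whose complement cannot lie right of the
leader of a site in `T`. The notion is symmetric under transposition. -/
structure Frame (ι : Type) where
  X : ι → ℕ
  Y : ι → ℕ
  A : ι → Prop
  L : Finset ι
  T : Finset ι
  lh : ι → ℕ
  th : ι → ℕ
  bx : ℕ
  by' : ℕ
  injX : Function.Injective X
  injY : Function.Injective Y
  L_sub : ∀ q ∈ L, ¬ A q
  T_sub : ∀ p ∈ T, A p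
  L_bound : ∀ q ∈ L, Y q < by'
  T_bound : ∀ p ∈ T, X p < bx
  lh_ne : ∀ q ∈ L, ∀ s, lh q ≠ Y s
  th_ne : ∀ p ∈ T, ∀ s, th p ≠ X s
  LL : ∀ q ∈ L, ∀ q' ∈ L, X q < X q' → ¬ Btw (Y q) (lh q') (lh q)
  TT : ∀ p ∈ T, ∀ p' ∈ T, Y p < Y p' → ¬ Btw (X p) (th p') (th p)
  TL : ∀ p ∈ T, ∀ q ∈ L, ¬ (th p < X q ∧ lh q < Y p)
  trapL : ∀ q ∈ L, ∀ p, A p → X p < X q → lh q < Y p → ¬ Y p < Y q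
  trapT : ∀ p ∈ T, ∀ q, ¬ A q → Y q < Y p → th p < X q → ¬ X q < X p

namespace Frame

variable {ι : Type}

/-- Transposition. -/
def swap (F : Frame ι) : Frame ι where
  X := F.Y
  Y := F.X
  A := fun s => ¬ F.A s
  L := F.T
  T := F.L
  lh := F.th
  th := F.lh
  bx := F.by'
  by' := F.bx
  injX := F.injY
  injY := F.injX
  L_sub := fun q hq => not_not.2 (F.T_sub q hq)
  T_sub := F.L_sub
  L_bound := F.T_bound
  T_bound := F.L_bound
  lh_ne := F.th_ne
  th_ne := F.lh_ne
  LL := F.TT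
  TT := F.LL
  TL := fun p hp q hq h => F.TL q hq p hp ⟨h.2, h.1⟩
  trapL := F.trapT
  trapT := fun q hq p hp => F.trapL q hq p (not_not.1 hp)

variable [Fintype ι] (F : Frame ι)

/-- The region of the cells `U c r` is closed under moving up and right. -/
def UpClosed (U : ℕ → ℕ → Prop) : Prop :=
  ∀ c c' r r', U c r → c ≤ c' → r' ≤ r → U c' r'

/-- The transposed complement of a region. -/
def flip (U : ℕ → ℕ → Prop) (c r : ℕ) : Prop := ¬ U r c

omit [Fintype ι] in
theorem UpClosed.flip {U : ℕ → ℕ → Prop} (h : UpClosed U) : UpClosed (Frame.flip U) :=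
  fun c c' r r' h1 hc hr h2 => h1 (h r' r c' c h2 hr hc)

theorem flip_flip (U : ℕ → ℕ → Prop) : Frame.flip (Frame.flip U) = U := by
  funext c r; simp [Frame.flip]

/-- The left ports of a cell in `U` that lie above it can be used up by the sites left of the
cell and outside of `U`. -/
def LG (U : ℕ → ℕ → Prop) (x y : ℕ) : Prop :=
  ∀ c r, c < x → r < y → U c r → ∃ y', r < y' ∧ y' ≤ F.by' ∧
    (F.L.filter fun q => F.lh q < y').card ≤
      (boxSites F.X F.Y c y' fun s => y ≤ F.Y s ∨ ¬ U (F.X s) (F.Y s)).card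

/-- The bends of the leaders in `L` that enter the box from below lie outside of `U`. -/
def QL (U : ℕ → ℕ → Prop) (x y : ℕ) : Prop :=
  ∀ q ∈ F.L, F.lh q < y → F.X q < x → y ≤ F.Y q → ¬ U (F.X q) (F.lh q)

/-- No left port above `y` belongs to a site right of `x`. -/
def GoodL (x y : ℕ) : Prop := ∀ q ∈ F.L, F.lh q < y → F.X q < x

/-- A region is admissible for the box `x`, `y`. -/
structure Valid (U : ℕ → ℕ → Prop) (x y : ℕ) : Prop where
  up : UpClosed U
  lg : F.LG U x y
  tg : F.swap.LG (Frame.flip U) y x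
  ql : F.QL U x y
  qt : F.swap.QL (Frame.flip U) y x

/-- Every condition in `Valid` comes with its transpose on the complement, and `flip` is an
involution. Hence only one of two symmetric arguments has to be given below. -/
theorem Valid.swap {F : Frame ι} {U : ℕ → ℕ → Prop} {x y : ℕ} (h : F.Valid U x y) :
    F.swap.Valid (Frame.flip U) y x where
  up := h.up.flip
  lg := h.tg
  tg := by rw [flip_flip]; exact h.lg
  ql := h.qt
  qt := by rw [flip_flip]; exact h.ql

/-- The row `y'` is that of the first left port, from row `y` on, whose site is not left of `c`. A
site left of `c` with a port above `y'` must lie above `y'` itself, since otherwise its vertical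
segment would meet the leader in row `y'`. If there is no such port, `by'` lies below everything in
`L`. -/
theorem exists_row {x y c : ℕ} (hcx : c ≤ x) (hy : y ≤ F.by') (hg : F.GoodL x y)
    (hp : ∀ q ∈ F.L, F.lh q < y → F.X q < x → y ≤ F.Y q → F.X q < c) :
    ∃ y', y ≤ y' ∧ y' ≤ F.by' ∧ (F.L.filter fun q => F.lh q < y').card ≤
      (boxSites F.X F.Y x y fun s => s ∈ F.L).card +
      (boxSites F.X F.Y c y' fun s => y ≤ F.Y s).card := by
  classical
  have key : ∀ y', y ≤ y' → (∀ q ∈ F.L, F.lh q < y' → y ≤ F.lh q → F.X q < c) →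
      (∀ q ∈ F.L, F.X q < c → F.lh q < y' → F.Y q < y') →
      (F.L.filter fun q => F.lh q < y').card ≤
      (boxSites F.X F.Y x y fun s => s ∈ F.L).card +
      (boxSites F.X F.Y c y' fun s => y ≤ F.Y s).card := by
    intro y' hyy h1 h2
    refine le_trans (Finset.card_le_card ?_) (Finset.card_union_le _ _)
    intro q hq
    simp only [Finset.mem_filter, Finset.mem_union, boxSites, Finset.mem_univ, true_and] at hq ⊢
    obtain ⟨hq, hql⟩ := hq
    by_cases hly : F.lh q < y
    · have := hg q hq hly
      by_cases hYq : F.Y q < y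
      · exact Or.inl ⟨this, hYq, hq⟩
      · have := hp q hq hly this (not_lt.1 hYq)
        exact Or.inr ⟨this, h2 q hq this hql, not_lt.1 hYq⟩
    · have hc := h1 q hq hql (not_lt.1 hly)
      have hYq := h2 q hq hc hql
      by_cases hYy : y ≤ F.Y q
      · exact Or.inr ⟨hc, hYq, hYy⟩
      · exact Or.inl ⟨hc.trans_le hcx, not_le.1 hYy, hq⟩
  by_cases hex : ∃ y', y ≤ y' ∧ y' < F.by' ∧ ∃ q ∈ F.L, F.lh q = y' ∧ c ≤ F.X q
  · obtain ⟨h1, h2, q0, hq0, hlq, hcq⟩ := Nat.find_spec hex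
    refine ⟨Nat.find hex, h1, h2.le, key _ h1 ?_ ?_⟩
    · intro q hq hl hyl
      by_contra hc
      exact Nat.find_min hex hl ⟨hyl, hl.trans h2, q, hq, rfl, not_lt.1 hc⟩
    · intro q hq hc hl
      by_contra hY
      have h3 := F.LL q hq q0 hq0 (hc.trans_le hcq)
      exact h3 (Or.inr ⟨by omega, by omega⟩)
  · refine ⟨F.by', hy, le_rfl, key _ hy ?_ fun q hq _ _ => F.L_bound q hq⟩
    intro q hq hl hyl
    by_contra hc
    exact hex ⟨_, hyl, hl, q, hq, rfl, not_lt.1 hc⟩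


theorem card_boxSites_add_not (x y : ℕ) (X Y : ι → ℕ) (p : ι → Prop) :
    (boxSites X Y x y p).card + (boxSites X Y x y fun s => ¬ p s).card =
      (boxSites X Y x y fun _ => True).card := by
  classical
  rw [← Finset.card_union_of_disjoint]
  · congr 1
    ext s
    simp only [boxSites, Finset.mem_union, Finset.mem_filter, Finset.mem_univ, true_and]
    tauto
  · rw [Finset.disjoint_left]
    intro s
    simp only [boxSites, Finset.mem_filter, Finset.mem_univ, true_and]
    tauto

theorem card_L_le (x y : ℕ) :
    (boxSites F.X F.Y x y fun s => s ∈ F.L).card ≤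
      (boxSites F.X F.Y x y fun s => ¬ F.A s).card := by
  apply Finset.card_le_card
  intro s
  simp only [boxSites, Finset.mem_filter, Finset.mem_univ, true_and]
  exact fun h => ⟨h.1, h.2.1, F.L_sub s h.2.2⟩

/-- The sites of the box outside `U` and the sites left of `c` in the rows from `y` on are disjoint,
and together they are sites that condition `LG` may count. -/
theorem card_boxSites_split {x y y' c : ℕ} (U : ℕ → ℕ → Prop) (hy : y ≤ y')
    (hc : ∀ s, F.X s < x → F.Y s < y → ¬ U (F.X s) (F.Y s) → F.X s < c) :
    (boxSites F.X F.Y x y fun s => ¬ U (F.X s) (F.Y s)).card +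
      (boxSites F.X F.Y c y' fun s => y ≤ F.Y s).card ≤
      (boxSites F.X F.Y c y' fun s => y ≤ F.Y s ∨ ¬ U (F.X s) (F.Y s)).card := by
  classical
  rw [← Finset.card_union_of_disjoint]
  · apply Finset.card_le_card
    intro s
    simp only [boxSites, Finset.mem_union, Finset.mem_filter, Finset.mem_univ, true_and]
    rintro (⟨h1, h2, h3⟩ | ⟨h1, h2, h3⟩)
    · exact ⟨hc s h1 h2 h3, by omega, Or.inr h3⟩
    · exact ⟨h1, h2, Or.inl h3⟩
  · rw [Finset.disjoint_left]
    intro s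
    simp only [boxSites, Finset.mem_filter, Finset.mem_univ, true_and]
    omega

set_option maxHeartbeats 1600000 in
/-- Enlarging the region by one site. -/
theorem exists_enlarge {U : ℕ → ℕ → Prop} {x y : ℕ} (hy : y ≤ F.by') (hg : F.GoodL x y)
    (hU : F.Valid U x y)
    (hlt : (boxSites F.X F.Y x y fun s => U (F.X s) (F.Y s)).card <
      (boxSites F.X F.Y x y F.A).card) :
    ∃ U', F.Valid U' x y ∧ (boxSites F.X F.Y x y fun s => U' (F.X s) (F.Y s)).card =
      (boxSites F.X F.Y x y fun s => U (F.X s) (F.Y s)).card + 1 := by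
  classical
  -- the promises, and the sites that may be added
  let prom : ι → Prop := fun q => q ∈ F.L ∧ F.lh q < y ∧ F.X q < x ∧ y ≤ F.Y q
  let cand : Finset ι := boxSites F.X F.Y x y fun s => ¬ U (F.X s) (F.Y s) ∧
    ∀ q, prom q → F.X q < F.X s ∨ F.Y s < F.lh q
  -- A site of `A` in the box outside `U` is a candidate: `trapL` forbids that it lies below the
  -- leader of a promise.
  have hne : cand.Nonempty := by
    have h1 : ∃ s ∈ boxSites F.X F.Y x y F.A,
        s ∉ boxSites F.X F.Y x y fun s => U (F.X s) (F.Y s) := by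
      by_contra h
      push Not at h
      exact absurd (Finset.card_le_card h) (by omega)
    obtain ⟨s, hs, hs'⟩ := h1
    simp only [boxSites, Finset.mem_filter, Finset.mem_univ, true_and] at hs hs'
    refine ⟨s, ?_⟩
    simp only [cand, boxSites, Finset.mem_filter, Finset.mem_univ, true_and]
    refine ⟨hs.1, hs.2.1, fun h => hs' ⟨hs.1, hs.2.1, h⟩, ?_⟩
    rintro q ⟨hq, hq1, hq2, hq3⟩
    by_contra hcon
    push Not at hcon
    have hne1 : F.X s ≠ F.X q := fun h => F.L_sub q hq (F.injX h ▸ hs.2.2)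
    have hne2 := F.lh_ne q hq s
    exact F.trapL q hq s hs.2.2 (by omega) (by omega) (by omega)
  obtain ⟨v, hv, hvmax⟩ := Finset.exists_max_image cand F.X hne
  have hv' := hv
  simp only [cand, boxSites, Finset.mem_filter, Finset.mem_univ, true_and] at hv hvmax
  obtain ⟨hvx, hvy, hvU, hvp⟩ := hv
  let U' : ℕ → ℕ → Prop := fun c r => U c r ∨ (F.X v ≤ c ∧ r ≤ F.Y v)
  have hsub : ∀ c r, U c r → U' c r := fun c r h => Or.inl h
  have hup : UpClosed U' := by
    rintro c c' r r' (h | h) hc hr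
    · exact Or.inl (hU.up _ _ _ _ h hc hr)
    · exact Or.inr ⟨h.1.trans hc, hr.trans h.2⟩
  -- Another site of the new quadrant outside `U` would inherit from `v` the condition on promises,
  -- and would be a candidate right of `v`. So exactly one site is added.
  have hnew : ∀ s, F.X s < x → F.Y s < y → ¬ U (F.X s) (F.Y s) → s ≠ v →
      ¬ U' (F.X s) (F.Y s) := by
    rintro s h1 h2 h3 hsv (h | ⟨h4, h5⟩)
    · exact h3 h
    · have : F.X s ≤ F.X v := by
        refine hvmax s ⟨h1, h2, h3, fun q hq => ?_⟩
        rcases hvp q hq with h | h <;> [left; right] <;> omega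
      exact hsv (F.injX (le_antisymm this h4))
  have hvU' : U' (F.X v) (F.Y v) := Or.inr ⟨le_rfl, le_rfl⟩
  have hcardU' : (boxSites F.X F.Y x y fun s => U' (F.X s) (F.Y s)).card =
      (boxSites F.X F.Y x y fun s => U (F.X s) (F.Y s)).card + 1 := by
    rw [← Finset.card_insert_of_notMem (a := v)]
    · congr 1
      ext s
      simp only [boxSites, Finset.mem_insert, Finset.mem_filter, Finset.mem_univ, true_and]
      constructor
      · rintro ⟨h1, h2, h3⟩
        by_cases hsv : s = v
        · exact Or.inl hsv
        · right
          refine ⟨h1, h2, ?_⟩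
          by_contra h4
          exact hnew s h1 h2 h4 hsv h3
      · rintro (rfl | ⟨h1, h2, h3⟩)
        · exact ⟨hvx, hvy, hvU'⟩
        · exact ⟨h1, h2, hsub _ _ h3⟩
    · simp only [boxSites, Finset.mem_filter, Finset.mem_univ, true_and]
      tauto
  have htot := card_boxSites_add_not x y F.X F.Y (fun s => U (F.X s) (F.Y s))
  have htot' := card_boxSites_add_not x y F.X F.Y (fun s => U' (F.X s) (F.Y s))
  have htotA := card_boxSites_add_not x y F.X F.Y F.A
  have hLle := F.card_L_le x y
  refine ⟨U', ⟨hup, ?_, ?_, ?_, ?_⟩, hcardU'⟩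
  · intro c r hcx hry hcr
    by_cases hcv : c < F.X v
    · -- the new site is not counted
      have hcU : U c r := by
        rcases hcr with h | h
        · exact h
        · omega
      obtain ⟨y', h1, h2, h3⟩ := hU.lg c r hcx hry hcU
      refine ⟨y', h1, h2, h3.trans (Finset.card_le_card ?_)⟩
      intro s
      simp only [boxSites, Finset.mem_filter, Finset.mem_univ, true_and]
      rintro ⟨h4, h5, h6⟩
      refine ⟨h4, h5, ?_⟩
      by_cases hYs : y ≤ F.Y s
      · exact Or.inl hYs
      · right
        exact hnew s (by omega) (by omega) (by tauto) (by rintro rfl; omega)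
    push Not at hcv
    by_cases hcp : ∀ q, prom q → F.X q < c
    · -- all remaining sites of the box lie left of `c`
      obtain ⟨y', h1, h2, h3⟩ := F.exists_row hcx.le hy hg
        (fun q h1 h2 h3 h4 => hcp q ⟨h1, h2, h3, h4⟩)
      refine ⟨y', by omega, h2, h3.trans ?_⟩
      refine le_trans ?_ (F.card_boxSites_split (x := x) U' h1 ?_)
      · omega
      · intro s h4 h5 h6
        by_contra hcs
        have hsU : ¬ U (F.X s) (F.Y s) := fun h => h6 (hsub _ _ h)
        have hsv : s ≠ v := fun h => h6 (h ▸ hvU')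
        have : F.X s ≤ F.X v := hvmax s ⟨h4, h5, hsU, fun q hq => Or.inl (by
          have := hcp q hq; omega)⟩
        exact hsv (F.injX (by omega))
    · -- use the highest promise
      push Not at hcp
      obtain ⟨q1, hq1, hcq1⟩ := hcp
      obtain ⟨q, hq, hqmax⟩ := Finset.exists_max_image (Finset.univ.filter prom) F.X
        ⟨q1, by simpa using hq1⟩
      simp only [Finset.mem_filter, Finset.mem_univ, true_and] at hq hqmax
      have hcq : c ≤ F.X q := hcq1.trans (hqmax q1 hq1)
      obtain ⟨hqL, hq2, hq3, hq4⟩ := hq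
      -- The rightmost promise also has the highest port: a promise further left with a higher port
      -- would have its vertical segment crossed in row `lh q`.
      have hqmin : ∀ q', prom q' → F.lh q ≤ F.lh q' := by
        rintro q' hq'
        rcases (hqmax q' hq').lt_or_eq with h | h
        · by_contra hlt
          have := F.LL q' hq'.1 q hqL h
          obtain ⟨h1, h2, h3, h4⟩ := hq'
          exact this (Or.inr ⟨by omega, by omega⟩)
        · rw [F.injX h]
      have hbend : ¬ U (F.X q) (F.lh q) := hU.ql q hqL hq2 hq3 hq4
      have hvq : F.X q < F.X v ∨ F.Y v < F.lh q := hvp q ⟨hqL, hq2, hq3, hq4⟩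
      have hvq' : F.Y v < F.lh q := by omega
      have hrq : r < F.lh q := by
        rcases hcr with h | h
        · by_contra hr
          exact hbend (hU.up _ _ _ _ h hcq (not_lt.1 hr))
        · omega
      -- A remaining site right of all promises would be a candidate right of `v`, although `v`
      -- itself lies left of `q`.
      have hXle : ∀ s, F.X s < x → F.Y s < y → ¬ U (F.X s) (F.Y s) → F.X s < F.X q := by
        intro s h1 h2 h3
        by_contra h4
        have hsq : F.X s ≠ F.X q := fun h => by
          have := F.injX h
          subst this; omega
        have : F.X s ≤ F.X v := hvmax s ⟨h1, h2, h3, fun q' hq' => Or.inl (by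
          have := hqmax q' hq'; omega)⟩
        omega
      refine ⟨F.lh q, hrq, by omega, ?_⟩
      -- The sites left outside the region are split by the row of the port of `q`. Those in `Z` and
      -- the owners of the ports above that row are disjoint sets of sites outside `A`, so the bound
      -- on the size of the region leaves enough sites in `B` for these ports.
      let B : Finset ι := boxSites F.X F.Y x y fun s => ¬ U' (F.X s) (F.Y s) ∧ F.Y s < F.lh q
      let Z : Finset ι := boxSites F.X F.Y x y fun s => ¬ U' (F.X s) (F.Y s) ∧ ¬ F.Y s < F.lh q
      have hBZ : (boxSites F.X F.Y x y fun s => ¬ U' (F.X s) (F.Y s)).card = B.card + Z.card := by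
        rw [← Finset.card_union_of_disjoint]
        · congr 1
          ext s
          simp only [B, Z, boxSites, Finset.mem_union, Finset.mem_filter, Finset.mem_univ,
            true_and]
          tauto
        · rw [Finset.disjoint_left]
          intro s
          simp only [B, Z, boxSites, Finset.mem_filter, Finset.mem_univ, true_and]
          tauto
      have hlZ : (F.L.filter fun q' => F.lh q' < F.lh q).card + Z.card ≤
          (boxSites F.X F.Y x y fun s => ¬ F.A s).card := by
        rw [← Finset.card_union_of_disjoint]
        · apply Finset.card_le_card
          intro s
          simp only [Z, boxSites, Finset.mem_union, Finset.mem_filter, Finset.mem_univ, true_and]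
          rintro (⟨h1, h2⟩ | ⟨h1, h2, h3, h4⟩)
          · have hx := hg s h1 (by omega)
            refine ⟨hx, ?_, F.L_sub s h1⟩
            by_contra hys
            have := hqmin s ⟨h1, by omega, hx, by omega⟩
            omega
          · refine ⟨h1, h2, fun hA => ?_⟩
            have h5 := hXle s h1 h2 (fun h => h3 (hsub _ _ h))
            have h6 := F.lh_ne q hqL s
            exact F.trapL q hqL s hA h5 (by omega) (by omega)
        · rw [Finset.disjoint_left]
          intro s
          simp only [Z, boxSites, Finset.mem_filter, Finset.mem_univ, true_and]
          rintro ⟨h1, h2⟩ ⟨h3, h4, h5, h6⟩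
          have h7 := hXle s h3 h4 (fun h => h5 (hsub _ _ h))
          exact F.LL s h1 q hqL h7 (Or.inr ⟨by omega, by omega⟩)
      have hBle : B.card ≤ (boxSites F.X F.Y c (F.lh q)
          fun s => y ≤ F.Y s ∨ ¬ U' (F.X s) (F.Y s)).card := by
        apply Finset.card_le_card
        intro s
        simp only [B, boxSites, Finset.mem_filter, Finset.mem_univ, true_and]
        rintro ⟨h1, h2, h3, h4⟩
        refine ⟨?_, h4, Or.inr h3⟩
        have : F.X s ≤ F.X v := hvmax s ⟨h1, h2, fun h => h3 (hsub _ _ h), fun q' hq' => Or.inr (by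
          have := hqmin q' hq'; omega)⟩
        have hsv : F.X s ≠ F.X v := fun h => h3 (by rw [F.injX h]; exact hvU')
        omega
      omega
  · -- the transposed condition becomes weaker
    intro c r hcy hrx hcr
    have h0 : Frame.flip U c r := fun h => hcr (hsub _ _ h)
    obtain ⟨y', h1, h2, h3⟩ := hU.tg c r hcy hrx h0
    refine ⟨y', h1, h2, h3.trans (Finset.card_le_card ?_)⟩
    intro s
    simp only [boxSites, Finset.mem_filter, Finset.mem_univ, true_and, swap, Frame.flip, not_not]
    rintro ⟨h4, h5, h6⟩
    exact ⟨h4, h5, h6.imp_right (hsub _ _)⟩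
  · intro q hq h1 h2 h3 h4
    rcases h4 with h4 | h4
    · exact hU.ql q hq h1 h2 h3 h4
    · rcases hvp q ⟨hq, h1, h2, h3⟩ with h | h <;> omega
  · intro q hq h1 h2 h3 h4
    exact hU.qt q hq h1 h2 h3 (fun h => h4 (hsub _ _ h))

end Frame
end BoundaryLabeling

/-! ### Growing the box by single columns and rows -/

namespace BoundaryLabeling
namespace Frame
variable {ι : Type} [Fintype ι] (F : Frame ι)

/-- There is an admissible region that contains as many sites of the box as there are sites
in `A`. -/
def Feasible (x y : ℕ) : Prop :=
  ∃ U, F.Valid U x y ∧ (boxSites F.X F.Y x y fun s => U (F.X s) (F.Y s)).card =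
    (boxSites F.X F.Y x y F.A).card

theorem card_boxSites_swap (X Y : ι → ℕ) (x y : ℕ) (p : ι → Prop) :
    (boxSites Y X y x p).card = (boxSites X Y x y p).card := by
  congr 1
  ext s
  simp only [boxSites, Finset.mem_filter, Finset.mem_univ, true_and]
  tauto

-- Having as many sites of the box as `A` inside the region is the same as having as many as the
-- complement of `A` outside.
variable {F} in
theorem Feasible.swap {x y : ℕ} (h : F.Feasible x y) : F.swap.Feasible y x := by
  obtain ⟨U, hU, hc⟩ := h
  refine ⟨flip U, hU.swap, ?_⟩
  have h1 := card_boxSites_add_not x y F.X F.Y (fun s => U (F.X s) (F.Y s))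
  have h2 := card_boxSites_add_not x y F.X F.Y F.A
  have h3 := card_boxSites_swap F.X F.Y x y (fun s => ¬ U (F.X s) (F.Y s))
  have h4 := card_boxSites_swap F.X F.Y x y (fun s => ¬ F.A s)
  change (boxSites F.Y F.X y x fun s => ¬ U (F.X s) (F.Y s)).card =
    (boxSites F.Y F.X y x fun s => ¬ F.A s).card
  omega

theorem swap_swap_feasible {x y : ℕ} (h : F.swap.swap.Feasible x y) : F.Feasible x y := by
  obtain ⟨U, ⟨h1, h2, h3, h4, h5⟩, hc⟩ := h
  refine ⟨U, ⟨h1, h2, h3, h4, h5⟩, ?_⟩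
  rw [show F.A = F.swap.swap.A from by funext s; simp [Frame.swap]]
  exact hc

theorem card_boxSites_succ {x y : ℕ} (s₀ : ι) (h1 : F.X s₀ = x) (p : ι → Prop) :
    (boxSites F.X F.Y (x + 1) y p).card = (boxSites F.X F.Y x y p).card +
      (boxSites F.X F.Y (x + 1) y fun s => s = s₀ ∧ p s).card := by
  classical
  rw [← Finset.card_union_of_disjoint]
  · congr 1
    ext s
    simp only [boxSites, Finset.mem_union, Finset.mem_filter, Finset.mem_univ, true_and]
    constructor
    · rintro ⟨h2, h3, h4⟩
      by_cases hs : s = s₀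
      · exact Or.inr ⟨h2, h3, hs, h4⟩
      · have : F.X s ≠ x := fun h => hs (F.injX (h.trans h1.symm))
        exact Or.inl ⟨by omega, h3, h4⟩
    · rintro (⟨h2, h3, h4⟩ | ⟨h2, h3, h4, h5⟩)
      · exact ⟨by omega, h3, h4⟩
      · exact ⟨h2, h3, h5⟩
  · rw [Finset.disjoint_left]
    intro s
    simp only [boxSites, Finset.mem_filter, Finset.mem_univ, true_and]
    rintro ⟨h2, h3, h4⟩ ⟨h5, h6, rfl, h7⟩
    omega

theorem card_boxSites_congr {X Y : ι → ℕ} {x y : ℕ} {p q : ι → Prop}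
    (h : ∀ s, X s < x → Y s < y → (p s ↔ q s)) :
    (boxSites X Y x y p).card = (boxSites X Y x y q).card := by
  congr 1
  ext s
  simp only [boxSites, Finset.mem_filter, Finset.mem_univ, true_and]
  constructor
  · rintro ⟨h1, h2, h3⟩
    exact ⟨h1, h2, (h s h1 h2).1 h3⟩
  · rintro ⟨h1, h2, h3⟩
    exact ⟨h1, h2, (h s h1 h2).2 h3⟩

/-- The part of the new column above row `y` is put into the region. The number of sites is then too
large by one only if the column has a site in the box that is not in `A`; in this case one site has
to leave the region, which is `exists_enlarge` for the transposed complement. -/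
theorem Feasible.right {F : Frame ι} {x y : ℕ} (hx : x + 1 ≤ F.bx) (hy : y ≤ F.by')
    (hg : F.GoodL x y) (hg' : F.swap.GoodL y (x + 1)) (h : F.Feasible x y) :
    F.Feasible (x + 1) y := by
  classical
  obtain ⟨U, hU, hcard⟩ := h
  let U' : ℕ → ℕ → Prop := fun c r => U c r ∨ (x ≤ c ∧ r < y)
  have hup : UpClosed U' := by
    rintro c c' r r' (h | h) hc hr
    · exact Or.inl (hU.up _ _ _ _ h hc hr)
    · exact Or.inr ⟨h.1.trans hc, hr.trans_lt h.2⟩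
  have hold : ∀ c r, c < x → (U' c r ↔ U c r) := by
    intro c r hc
    constructor
    · rintro (h | h)
      · exact h
      · omega
    · exact Or.inl
  have hvalid : F.Valid U' (x + 1) y := by
    refine ⟨hup, ?_, ?_, ?_, ?_⟩
    · intro c r hc hr hcr
      have hcongr : ∀ y', (boxSites F.X F.Y c y' fun s => y ≤ F.Y s ∨ ¬ U' (F.X s) (F.Y s)).card =
          (boxSites F.X F.Y c y' fun s => y ≤ F.Y s ∨ ¬ U (F.X s) (F.Y s)).card := fun y' =>
        card_boxSites_congr fun s h1 h2 => by rw [hold _ _ (by omega)]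
      rcases Nat.lt_succ_iff_lt_or_eq.1 hc with hc | rfl
      · obtain ⟨y', h1, h2, h3⟩ := hU.lg c r hc hr ((hold _ _ hc).1 hcr)
        exact ⟨y', h1, h2, (hcongr y').symm ▸ h3⟩
      -- The new column has no condition to inherit; the row is obtained directly from the leaders,
      -- since all promises lie left of this column.
      · obtain ⟨y', h1, h2, h3⟩ := F.exists_row le_rfl hy hg (fun q _ _ h _ => h)
        refine ⟨y', by omega, h2, ?_⟩
        rw [hcongr]
        refine h3.trans (le_trans ?_ (F.card_boxSites_split (x := c) U h1 fun s h _ _ => h))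
        have h1 := card_boxSites_add_not c y F.X F.Y (fun s => U (F.X s) (F.Y s))
        have h2 := card_boxSites_add_not c y F.X F.Y F.A
        have h3 := F.card_L_le c y
        omega
    · intro c r hc hr hcr
      have hr' : r < x := by
        by_contra h
        exact hcr (Or.inr ⟨not_lt.1 h, hc⟩)
      obtain ⟨y', h1, h2, h3⟩ := hU.tg c r hc hr' (fun h => hcr (Or.inl h))
      refine ⟨y', h1, h2, h3.trans (Finset.card_le_card ?_)⟩
      intro s
      simp only [boxSites, Finset.mem_filter, Finset.mem_univ, true_and, Frame.swap, Frame.flip,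
        not_not]
      rintro ⟨h4, h5, h6⟩
      refine ⟨h4, h5, ?_⟩
      rcases h6 with h6 | h6
      · exact Or.inr (Or.inr ⟨h6, by omega⟩)
      · exact Or.inr (Or.inl h6)
    · intro q hq h1 h2 h3 h4
      have h5 := hg q hq h1
      exact hU.ql q hq h1 h5 h3 ((hold _ _ h5).1 h4)
    · intro p hp h1 h2 h3 h4
      change F.th p < x + 1 at h1
      change F.Y p < y at h2
      change x + 1 ≤ F.X p at h3
      refine h4 ?_
      by_cases h5 : F.th p < x
      · have := hU.qt p hp h5 h2 (show x ≤ F.X p by omega)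
        exact Or.inl (not_not.1 this)
      · exact Or.inr ⟨not_lt.1 h5, h2⟩
  have hcongr : (boxSites F.X F.Y x y fun s => U' (F.X s) (F.Y s)).card =
      (boxSites F.X F.Y x y fun s => U (F.X s) (F.Y s)).card :=
    card_boxSites_congr fun s h1 h2 => hold _ _ h1
  by_cases hs : ∃ s, F.X s = x ∧ F.Y s < y
  · obtain ⟨s₀, hs₀, hs₁⟩ := hs
    have e1 := F.card_boxSites_succ (y := y) s₀ hs₀ (fun s => U' (F.X s) (F.Y s))
    have e2 := F.card_boxSites_succ (y := y) s₀ hs₀ F.A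
    have e3 : boxSites F.X F.Y (x + 1) y (fun s => s = s₀ ∧ U' (F.X s) (F.Y s)) = {s₀} := by
      ext s
      simp only [boxSites, Finset.mem_filter, Finset.mem_univ, true_and, Finset.mem_singleton]
      constructor
      · exact fun h => h.2.2.1
      · rintro rfl
        exact ⟨by omega, hs₁, rfl, Or.inr ⟨hs₀.ge, hs₁⟩⟩
    rw [e3, Finset.card_singleton] at e1
    by_cases hA : F.A s₀
    · have e4 : boxSites F.X F.Y (x + 1) y (fun s => s = s₀ ∧ F.A s) = {s₀} := by
        ext s
        simp only [boxSites, Finset.mem_filter, Finset.mem_univ, true_and, Finset.mem_singleton]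
        constructor
        · exact fun h => h.2.2.1
        · rintro rfl
          exact ⟨by omega, hs₁, rfl, hA⟩
      rw [e4, Finset.card_singleton] at e2
      exact ⟨U', hvalid, by omega⟩
    · have e4 : boxSites F.X F.Y (x + 1) y (fun s => s = s₀ ∧ F.A s) = ∅ := by
        ext s
        simp only [boxSites, Finset.mem_filter, Finset.mem_univ, true_and, Finset.notMem_empty,
          iff_false]
        rintro ⟨_, _, rfl, h⟩
        exact hA h
      rw [e4, Finset.card_empty] at e2
      have t1 := card_boxSites_add_not (x + 1) y F.X F.Y (fun s => U' (F.X s) (F.Y s))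
      have t2 := card_boxSites_add_not (x + 1) y F.X F.Y F.A
      have t3 := card_boxSites_swap F.X F.Y (x + 1) y (fun s => ¬ U' (F.X s) (F.Y s))
      have t4 := card_boxSites_swap F.X F.Y (x + 1) y (fun s => ¬ F.A s)
      obtain ⟨V, hV, hVc⟩ := F.swap.exists_enlarge (y := x + 1) (x := y) hx hg' hvalid.swap (by
        change (boxSites F.Y F.X y (x + 1) fun s => ¬ U' (F.X s) (F.Y s)).card <
          (boxSites F.Y F.X y (x + 1) fun s => ¬ F.A s).card
        omega)
      have hfe : F.swap.Feasible y (x + 1) := by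
        refine ⟨V, hV, hVc.trans ?_⟩
        change (boxSites F.Y F.X y (x + 1) fun s => ¬ U' (F.X s) (F.Y s)).card + 1 =
          (boxSites F.Y F.X y (x + 1) fun s => ¬ F.A s).card
        omega
      exact F.swap_swap_feasible hfe.swap
  · push Not at hs
    have e1 : ∀ p : ι → Prop, boxSites F.X F.Y (x + 1) y p = boxSites F.X F.Y x y p := by
      intro p
      ext s
      simp only [boxSites, Finset.mem_filter, Finset.mem_univ, true_and]
      constructor
      · rintro ⟨h1, h2, h3⟩
        exact ⟨by have := hs s; omega, h2, h3⟩
      · rintro ⟨h1, h2, h3⟩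
        exact ⟨by omega, h2, h3⟩
    exact ⟨U', hvalid, by rw [e1, e1, hcongr, hcard]⟩

/-- A box that satisfies both conditions `GoodL` can be reduced by a column or by a row so that they
persist; the region for the smaller box is then extended. -/
theorem feasible_of_good : ∀ (k x y : ℕ), x + y = k → x ≤ F.bx → y ≤ F.by' → F.GoodL x y →
    F.swap.GoodL y x → F.Feasible x y := by
  intro k
  induction k with
  | zero =>
    intro x y hk hx hy _ _
    obtain ⟨rfl, rfl⟩ : x = 0 ∧ y = 0 := by omega
    refine ⟨fun _ _ => True, ⟨fun _ _ _ _ _ _ _ => trivial, ?_, ?_, ?_, ?_⟩, ?_⟩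
    · intro c r h; omega
    · intro c r h; omega
    · intro q _ _ h; omega
    · intro q _ _ h; omega
    · simp [boxSites]
  | succ k ih =>
    intro x y hk hx hy h1 h2
    by_cases hxg : ∃ x', x = x' + 1 ∧ F.GoodL x' y
    · obtain ⟨x', rfl, h3⟩ := hxg
      refine Feasible.right hx hy h3 h2 (ih x' y (by omega) (by omega) hy h3 ?_)
      intro p hp hlt
      exact h2 p hp (Nat.lt_succ_of_lt hlt)
    by_cases hyg : ∃ y', y = y' + 1 ∧ F.swap.GoodL y' x
    · obtain ⟨y', rfl, h3⟩ := hyg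
      refine F.swap_swap_feasible (Feasible.swap (F := F.swap) ?_)
      have h4 : F.GoodL x y' := fun q hq hlt => h1 q hq (Nat.lt_succ_of_lt hlt)
      exact Feasible.right (F := F.swap) hy hx h3 h1
        (ih x y' (by omega) hx (by omega) h4 h3).swap
    -- If neither reduction is possible, the last column contains a site whose left port lies above
    -- `y`, and the last row a site whose top port lies left of `x`. The final segments of their
    -- leaders cross.
    exfalso
    rcases Nat.eq_zero_or_pos x with rfl | hx0
    · refine hyg ⟨y - 1, by omega, fun p hp h => ?_⟩
      exact absurd h (Nat.not_lt_zero _)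
    rcases Nat.eq_zero_or_pos y with rfl | hy0
    · refine hxg ⟨x - 1, by omega, fun p hp h => ?_⟩
      exact absurd h (Nat.not_lt_zero _)
    have a1 : ¬ F.GoodL (x - 1) y := fun h => hxg ⟨x - 1, by omega, h⟩
    have a2 : ¬ F.swap.GoodL (y - 1) x := fun h => hyg ⟨y - 1, by omega, h⟩
    simp only [GoodL, not_forall] at a1 a2
    obtain ⟨q, hq, hq1, hq2⟩ := a1
    obtain ⟨p, hp, hp1, hp2⟩ := a2
    have hq3 := h1 q hq hq1
    have hp3 := h2 p hp hp1
    change F.th p < x at hp1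
    change ¬ F.Y p < y - 1 at hp2
    change F.Y p < y at hp3
    have n1 := F.th_ne p hp q
    have n2 := F.lh_ne q hq p
    exact F.TL p hp q hq ⟨by omega, by omega⟩

end Frame
end BoundaryLabeling

/-! ### Instances with integer coordinates and their reflection -/

namespace BoundaryLabeling

/-- The opposite side. -/
def Side.mirror : Side → Side
  | Side.left => Side.right
  | Side.top => Side.top
  | Side.right => Side.left

/-- An instance in which all coordinates are natural numbers below `2 * n`; rows are counted from
the top. Only the relevant coordinate of a port is kept. -/
structure Disc (n : ℕ) where
  X : Fin n → ℕ
  Y : Fin n → ℕ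
  P : Fin n → ℕ
  side : Fin n → Side
  X_lt : ∀ s, X s < 2 * n
  Y_lt : ∀ s, Y s < 2 * n
  P_lt : ∀ j, P j < 2 * n
  injX : Function.Injective X
  injY : Function.Injective Y
  P_inj : ∀ j j', side j = side j' → P j = P j' → j = j'
  P_ne_X : ∀ j, side j = Side.top → ∀ s, P j ≠ X s
  P_ne_Y : ∀ j, side j ≠ Side.top → ∀ s, P j ≠ Y s

namespace Disc

variable {n : ℕ} (D : Disc n)

/-- Reflection at a vertical line. -/
def mirror : Disc n where
  X := fun s => 2 * n - 1 - D.X s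
  Y := D.Y
  P := fun j => match D.side j with
    | Side.top => 2 * n - 1 - D.P j
    | _ => D.P j
  side := fun j => (D.side j).mirror
  X_lt := fun s => by have := D.X_lt s; omega
  Y_lt := D.Y_lt
  P_lt := fun j => by have := D.P_lt j; split <;> omega
  injX := fun s s' h => D.injX (by
    have h1 := D.X_lt s; have h2 := D.X_lt s'; simp only at h; omega)
  injY := D.injY
  P_inj := fun j j' h1 h2 => by
    have h3 := D.P_lt j; have h4 := D.P_lt j'
    have h5 : D.side j = D.side j' := by
      revert h1; cases D.side j <;> cases D.side j' <;> simp [Side.mirror]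
    refine D.P_inj j j' h5 ?_
    revert h2
    simp only [← h5]
    cases D.side j <;> simp only <;> omega
  P_ne_X := fun j h s => by
    have h1 : D.side j = Side.top := by revert h; cases D.side j <;> simp [Side.mirror]
    have := D.P_ne_X j h1 s
    have h2 := D.X_lt s; have h3 := D.P_lt j
    simp only [h1]; omega
  P_ne_Y := fun j h s => by
    have h1 : D.side j ≠ Side.top := by
      intro h2; exact h (by simp [h2, Side.mirror])
    have := D.P_ne_Y j h1 s
    revert h1; cases D.side j <;> simp [this]

/-- The leader from site `i` to port `j` does not intersect the one from `i'` to `j'`. -/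
structure NC (i j i' j' : Fin n) : Prop where
  ll : D.side j = Side.left → D.side j' = Side.left → D.X i < D.X i' →
    ¬ Btw (D.Y i) (D.P j') (D.P j)
  rr : D.side j = Side.right → D.side j' = Side.right → D.X i' < D.X i →
    ¬ Btw (D.Y i) (D.P j') (D.P j)
  tt : D.side j = Side.top → D.side j' = Side.top → D.Y i < D.Y i' →
    ¬ Btw (D.X i) (D.P j') (D.P j)
  tl : D.side j = Side.top → D.side j' = Side.left →
    ¬ (Btw (D.X i) (D.X i') (D.P j) ∧ Btw (D.Y i') (D.Y i) (D.P j')) ∧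
    ¬ (D.P j < D.X i' ∧ D.P j' < D.Y i)
  tr : D.side j = Side.top → D.side j' = Side.right →
    ¬ (Btw (D.X i) (D.X i') (D.P j) ∧ Btw (D.Y i') (D.Y i) (D.P j')) ∧
    ¬ (D.X i' < D.P j ∧ D.P j' < D.Y i)
  lr : D.side j = Side.left → D.side j' = Side.right → D.X i' < D.X i →
    ¬ Btw (D.Y i) (D.P j') (D.P j) ∧ ¬ Btw (D.Y i') (D.P j) (D.P j')

/-- All leaders are disjoint. -/
def Planar (m : Fin n ≃ Fin n) : Prop := ∀ i i', i ≠ i' → D.NC i (m i) i' (m i')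

theorem side_mirror (j : Fin n) : D.mirror.side j = (D.side j).mirror := rfl

theorem X_mirror (s : Fin n) : D.mirror.X s = 2 * n - 1 - D.X s := rfl

theorem Y_mirror (s : Fin n) : D.mirror.Y s = D.Y s := rfl

theorem P_mirror_top {j : Fin n} (h : D.side j = Side.top) :
    D.mirror.P j = 2 * n - 1 - D.P j := by simp [mirror, h]

theorem P_mirror_left {j : Fin n} (h : D.side j = Side.left) : D.mirror.P j = D.P j := by
  simp [mirror, h]

theorem P_mirror_right {j : Fin n} (h : D.side j = Side.right) : D.mirror.P j = D.P j := by
  simp [mirror, h]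

theorem mirror_eq_left {j : Fin n} : D.mirror.side j = Side.left ↔ D.side j = Side.right := by
  rw [side_mirror]; cases D.side j <;> simp [Side.mirror]

theorem mirror_eq_right {j : Fin n} : D.mirror.side j = Side.right ↔ D.side j = Side.left := by
  rw [side_mirror]; cases D.side j <;> simp [Side.mirror]

theorem mirror_eq_top {j : Fin n} : D.mirror.side j = Side.top ↔ D.side j = Side.top := by
  rw [side_mirror]; cases D.side j <;> simp [Side.mirror]

theorem btw_mirror {N a v b : ℕ} (ha : a < N) (hv : v < N) (hb : b < N) :
    Btw (N - 1 - a) (N - 1 - v) (N - 1 - b) ↔ Btw a v b := by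
  unfold Btw; omega

/-- Both orders of the pair are needed, because reflection exchanges left and right while the field
`lr` names the leader to the left side first. -/
theorem NC.mirror {D : Disc n} {i j i' j' : Fin n} (h : D.NC i j i' j') (h' : D.NC i' j' i j) :
    D.mirror.NC i j i' j' := by
  have x1 := D.X_lt i
  have x2 := D.X_lt i'
  have p1 := D.P_lt j
  have p2 := D.P_lt j'
  constructor
  · intro h1 h2
    rw [mirror_eq_left] at h1 h2
    rw [P_mirror_right _ h1, P_mirror_right _ h2, X_mirror, X_mirror, Y_mirror]
    exact fun h3 => h.rr h1 h2 (by omega)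
  · intro h1 h2
    rw [mirror_eq_right] at h1 h2
    rw [P_mirror_left _ h1, P_mirror_left _ h2, X_mirror, X_mirror, Y_mirror]
    exact fun h3 => h.ll h1 h2 (by omega)
  · intro h1 h2
    rw [mirror_eq_top] at h1 h2
    rw [P_mirror_top _ h1, P_mirror_top _ h2, X_mirror, Y_mirror, Y_mirror,
      btw_mirror x1 p2 p1]
    exact h.tt h1 h2
  · intro h1 h2
    rw [mirror_eq_top] at h1
    rw [mirror_eq_left] at h2
    rw [P_mirror_top _ h1, P_mirror_right _ h2, X_mirror, X_mirror, Y_mirror, Y_mirror,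
      btw_mirror x1 x2 p1]
    have h3 := h.tr h1 h2
    exact ⟨h3.1, fun h4 => h3.2 ⟨by omega, h4.2⟩⟩
  · intro h1 h2
    rw [mirror_eq_top] at h1
    rw [mirror_eq_right] at h2
    rw [P_mirror_top _ h1, P_mirror_left _ h2, X_mirror, X_mirror, Y_mirror, Y_mirror,
      btw_mirror x1 x2 p1]
    have h3 := h.tl h1 h2
    exact ⟨h3.1, fun h4 => h3.2 ⟨by omega, h4.2⟩⟩
  · intro h1 h2
    rw [mirror_eq_left] at h1
    rw [mirror_eq_right] at h2
    rw [P_mirror_right _ h1, P_mirror_left _ h2, X_mirror, X_mirror, Y_mirror, Y_mirror]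
    intro h3
    exact (h'.lr h2 h1 (by omega)).symm

theorem Planar.mirror {D : Disc n} {m : Fin n ≃ Fin n} (h : D.Planar m) : D.mirror.Planar m :=
  fun i i' hne => (h i i' hne).mirror (h i' i hne.symm)

/-! ### Admissible paths and their existence -/

open Classical in
/-- The number of sites left of `x` and above `y`. -/
noncomputable def nw (x y : ℕ) : ℕ := (boxSites D.X D.Y x y fun _ => True).card

/-- The number of top ports left of `x`. -/
noncomputable def tp (x : ℕ) : ℕ := by
  classical exact (Finset.univ.filter fun j => D.side j = Side.top ∧ D.P j < x).card

/-- The number of left ports above `y`. -/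
noncomputable def lp (y : ℕ) : ℕ := by
  classical exact (Finset.univ.filter fun j => D.side j = Side.left ∧ D.P j < y).card

/-- The number of sites above `y` and left of the path `e`. -/
noncomputable def bb (e : ℕ → ℕ) (y : ℕ) : ℕ := by
  classical exact (Finset.univ.filter fun s => D.Y s < y ∧ D.X s < e (D.Y s)).card

/-- The condition for passing row `y` in column `x` with `b` sites on the left. -/
def TG (xt x y b : ℕ) : Prop := ∃ x', x ≤ x' ∧ x' ≤ xt ∧ D.tp x' + b ≤ D.nw x' y

/-- The condition for reaching the point `x`, `y` with `b` sites on the left. -/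
def LG (x y b : ℕ) : Prop :=
  ∃ y', y ≤ y' ∧ y' ≤ 2 * n + 1 ∧ D.lp y' + D.nw x y ≤ D.nw x y' + b

/-- `e` describes an admissible path through the rows above `y`. -/
structure Chain (xt y : ℕ) (e : ℕ → ℕ) : Prop where
  mono : ∀ r r', r ≤ r' → r' < y → e r ≤ e r'
  le : ∀ r, r < y → e r ≤ xt
  tg : ∀ r, r < y → D.TG xt (e r) r (D.bb e r)
  lg : ∀ r, r < y → D.LG (e r) (r + 1) (D.bb e (r + 1))

/-- `e` describes an admissible path to the point `xt`, `y` with the right number of sites above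
it. -/
structure Full (xt y : ℕ) (e : ℕ → ℕ) : Prop extends D.Chain xt y e where
  count : D.tp xt + D.bb e y = D.nw xt y
  lg_end : D.LG xt y (D.bb e y)

/-- The bound on `D.lp y'` never counts the sites of `U` above row `y`, and the other sites left of
`c` above row `y` lie left of the path. Subtracting the former from all sites left of `c` and above
`y'` turns the condition on a region into one on `bb`. -/
theorem lg_of_region {xt y₀ : ℕ} {U : ℕ → ℕ → Prop} {e : ℕ → ℕ}
    (he : ∀ s, D.Y s < y₀ → (D.X s < e (D.Y s) ↔ D.X s < xt ∧ ¬ U (D.X s) (D.Y s)))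
    {c y y' : ℕ} (hc : c ≤ xt) (hy : y ≤ y₀) (hy' : y ≤ y')
    (h : D.lp y' ≤ (boxSites D.X D.Y c y' fun s => y₀ ≤ D.Y s ∨ ¬ U (D.X s) (D.Y s)).card) :
    D.lp y' + D.nw c y ≤ D.nw c y' + D.bb e y := by
  classical
  have h1 := Frame.card_boxSites_add_not c y' D.X D.Y
    (fun s => y₀ ≤ D.Y s ∨ ¬ U (D.X s) (D.Y s))
  have h2 := Frame.card_boxSites_add_not c y D.X D.Y (fun s => U (D.X s) (D.Y s))
  have h3 : (boxSites D.X D.Y c y fun s => U (D.X s) (D.Y s)).card ≤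
      (boxSites D.X D.Y c y' fun s => ¬ (y₀ ≤ D.Y s ∨ ¬ U (D.X s) (D.Y s))).card := by
    apply Finset.card_le_card
    intro s
    simp only [boxSites, Finset.mem_filter, Finset.mem_univ, true_and]
    rintro ⟨h4, h5, h6⟩
    refine ⟨h4, by omega, ?_⟩
    rintro (h | h)
    · omega
    · exact h h6
  have h4 : (boxSites D.X D.Y c y fun s => ¬ U (D.X s) (D.Y s)).card ≤ D.bb e y := by
    unfold bb
    apply Finset.card_le_card
    intro s
    simp only [boxSites, Finset.mem_filter, Finset.mem_univ, true_and]
    rintro ⟨h4, h5, h6⟩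
    exact ⟨h5, (he s (by omega)).2 ⟨by omega, h6⟩⟩
  unfold nw
  omega

/-- A planar labeling gives rise to a path. -/
theorem exists_full {m : Fin n ≃ Fin n} (hm : D.Planar m) {xt y₀ : ℕ} (hy₀ : y₀ ≤ 2 * n)
    (h1 : ∀ i, D.side (m i) = Side.top → (D.P (m i) < xt ↔ D.X i < xt))
    (h2 : ∀ i, D.side (m i) = Side.top → D.Y i < y₀)
    (h3 : ∀ i, D.side (m i) = Side.left → D.P (m i) < y₀ → D.X i < xt)
    (h4 : ∀ i, D.side (m i) = Side.right → D.X i < xt → y₀ ≤ D.P (m i)) :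
    ∃ e, D.Full xt y₀ e := by
  classical
  have hLT : ∀ q, D.side (m q) = Side.left → D.side (m q) ≠ Side.top := fun q h => by simp [h]
  -- Sites with right ports and the top sites of the other half lie outside `A` without being in
  -- `L`; this is why a frame does not require `L` to be the complement of `A`.
  let F : Frame (Fin n) :=
  { X := D.X
    Y := D.Y
    A := fun i => D.side (m i) = Side.top ∧ D.X i < xt
    L := Finset.univ.filter fun i => D.side (m i) = Side.left
    T := Finset.univ.filter fun i => D.side (m i) = Side.top ∧ D.X i < xt
    lh := fun i => D.P (m i)
    th := fun i => D.P (m i)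
    bx := xt
    by' := 2 * n
    injX := D.injX
    injY := D.injY
    L_sub := fun q hq h => hLT q (by simpa using hq) h.1
    T_sub := fun p hp => by simpa using hp
    L_bound := fun q _ => D.Y_lt q
    T_bound := fun p hp => (by simpa using hp : _ ∧ _).2
    lh_ne := fun q hq => D.P_ne_Y _ (hLT q (by simpa using hq))
    th_ne := fun p hp => D.P_ne_X _ (by simpa using hp : _ ∧ _).1
    LL := fun q hq q' hq' h => (hm q q' (fun h' => by simp [h'] at h)).ll (by simpa using hq)
      (by simpa using hq') h
    TT := fun p hp p' hp' h => (hm p p' (fun h' => by simp [h'] at h)).tt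
      (by simpa using hp : _ ∧ _).1 (by simpa using hp' : _ ∧ _).1 h
    TL := fun p hp q hq => ((hm p q (fun h' => hLT q (by simpa using hq) (by
      subst h'; exact (by simpa using hp : _ ∧ _).1))).tl (by simpa using hp : _ ∧ _).1
      (by simpa using hq)).2
    trapL := fun q hq p hp hX hl hY => by
      have hq : D.side (m q) = Side.left := by simpa using hq
      have hh := (hm p q (fun h' => by simp [h'] at hX)).tl hp.1 hq
      have n1 := D.P_ne_X _ hp.1 q
      have : ¬ D.P (m p) < D.X q := fun h => hh.2 ⟨h, hl⟩
      exact hh.1 ⟨Or.inl ⟨hX.le, by omega⟩, Or.inr ⟨hl.le, hY.le⟩⟩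
    trapT := fun p hp q hq hY ht hX => by
      have hp : D.side (m p) = Side.top ∧ D.X p < xt := by simpa using hp
      have hne : p ≠ q := fun h' => by simp [h'] at hX
      have hYp := h2 p hp.1
      rcases hs : D.side (m q) with _ | _ | _
      · have hh := (hm p q hne).tl hp.1 hs
        have n1 := D.P_ne_Y _ (hLT q hs) p
        have : ¬ D.P (m q) < D.Y p := fun h => hh.2 ⟨ht, h⟩
        exact hh.1 ⟨Or.inr ⟨ht.le, hX.le⟩, Or.inl ⟨hY.le, by omega⟩⟩
      · exact hq ⟨hs, hX.trans hp.2⟩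
      -- A site with a right port that lies left of `xt` has its port at or below `y₀`, hence below
      -- `p`, so its vertical segment would cross the row of `p`.
      · have hh := (hm p q hne).tr hp.1 hs
        have := h4 q hs (hX.trans hp.2)
        exact hh.1 ⟨Or.inr ⟨ht.le, hX.le⟩, Or.inl ⟨hY.le, by omega⟩⟩ }
  have hgL : F.GoodL xt y₀ := fun q hq h => h3 q (by simpa [F] using hq) h
  have hgT : F.swap.GoodL y₀ xt := fun p hp _ => by
    have hp : D.side (m p) = Side.top ∧ D.X p < xt := by simpa [F, Frame.swap] using hp
    exact h2 p hp.1
  obtain ⟨U, hU, hcount⟩ := F.feasible_of_good _ xt y₀ rfl le_rfl hy₀ hgL hgT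
  -- the path
  let e : ℕ → ℕ := fun r => sInf {c | c = xt ∨ U c r}
  have e_le : ∀ r, e r ≤ xt := fun r => Nat.sInf_le (Or.inl rfl)
  have e_mem : ∀ r, e r = xt ∨ U (e r) r := fun r =>
    Nat.sInf_mem (s := {c | c = xt ∨ U c r}) ⟨xt, Or.inl rfl⟩
  have e_min : ∀ r c, U c r → e r ≤ c := fun r c h => Nat.sInf_le (Or.inr h)
  have e_mono : ∀ r r', r ≤ r' → e r ≤ e r' := by
    intro r r' h
    rcases e_mem r' with h' | h'
    · rw [h']; exact e_le r
    · exact e_min _ _ (hU.up _ _ _ _ h' le_rfl h)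
  have he : ∀ s, D.Y s < y₀ → (D.X s < e (D.Y s) ↔ D.X s < xt ∧ ¬ U (D.X s) (D.Y s)) := by
    intro s _
    constructor
    · intro h
      exact ⟨h.trans_le (e_le _), fun hu => absurd (e_min _ _ hu) (by omega)⟩
    · rintro ⟨h5, h6⟩
      by_contra h7
      rcases e_mem (D.Y s) with h' | h'
      · omega
      · exact h6 (hU.up _ _ _ _ h' (not_lt.1 h7) le_rfl)
  have hlp : ∀ y', (F.L.filter fun q => F.lh q < y').card = D.lp y' := by
    intro y'
    unfold lp
    refine Finset.card_bij (fun i _ => m i) ?_ (fun a _ b _ h => m.injective h) ?_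
    · intro i
      simp [F]
    · intro j hj
      refine ⟨m.symm j, ?_, by simp⟩
      simpa [F] using hj
  have htp : ∀ x', x' ≤ xt → (F.T.filter fun q => F.th q < x').card = D.tp x' := by
    intro x' hx'
    unfold tp
    refine Finset.card_bij (fun i _ => m i) ?_ (fun a _ b _ h => m.injective h) ?_
    · intro i
      simp only [F, Finset.mem_filter, Finset.mem_univ, true_and]
      exact fun h => ⟨h.1.1, h.2⟩
    · intro j hj
      refine ⟨m.symm j, ?_, by simp⟩
      simp only [F, Finset.mem_filter, Finset.mem_univ, true_and, Equiv.apply_symm_apply] at hj ⊢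
      refine ⟨⟨hj.1, (h1 _ (by simpa using hj.1)).1 (by simpa using hj.2.trans_le hx')⟩, hj.2⟩
  have hrow : ∃ y', y₀ ≤ y' ∧ y' ≤ 2 * n ∧ D.lp y' ≤
      (boxSites D.X D.Y xt y' fun s => y₀ ≤ D.Y s ∨ ¬ U (D.X s) (D.Y s)).card := by
    obtain ⟨y', r1, r2, r3⟩ := F.exists_row le_rfl hy₀ hgL (fun q _ _ h _ => h)
    refine ⟨y', r1, r2, ?_⟩
    rw [← hlp]
    refine r3.trans (le_trans ?_ (F.card_boxSites_split (x := xt) U r1 fun s h _ _ => h))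
    have t1 := Frame.card_boxSites_add_not xt y₀ F.X F.Y (fun s => U (F.X s) (F.Y s))
    have t2 := Frame.card_boxSites_add_not xt y₀ F.X F.Y F.A
    have t3 := F.card_L_le xt y₀
    omega
  refine ⟨e, ⟨fun r r' h _ => e_mono r r' h, fun r _ => e_le r, ?_, ?_⟩, ?_, ?_⟩
  · intro r hr
    -- In column 0 there is no cell left of the path; by monotonicity no site above row `r` lies
    -- left of the path, and `x' = 0` is a trivial witness.
    rcases Nat.eq_zero_or_pos (e r) with h0 | hpos
    · refine ⟨0, by omega, by omega, ?_⟩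
      have a1 : D.bb e r = 0 := by
        unfold bb
        rw [Finset.card_eq_zero, Finset.filter_eq_empty_iff]
        rintro s - ⟨h5, h6⟩
        have := e_mono _ _ h5.le
        omega
      have a2 : D.tp 0 = 0 := by simp [tp]
      omega
    · have hc : ¬ U (e r - 1) r := fun h => absurd (e_min _ _ h) (by omega)
      have := e_le r
      -- The transposed condition is applied to the last cell of row `r` outside the region, so its
      -- witness is at least `e r`.
      obtain ⟨x', r1, r2, r3⟩ := hU.tg r (e r - 1) hr (by omega) hc
      change x' ≤ xt at r2
      refine ⟨x', by omega, r2, ?_⟩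
      have r4 : (F.T.filter fun q => F.th q < x').card ≤
        (boxSites F.Y F.X r x' fun s => xt ≤ F.X s ∨ ¬ ¬ U (F.X s) (F.Y s)).card := r3
      rw [htp x' r2, ← Frame.card_boxSites_swap] at r4
      have t1 := Frame.card_boxSites_add_not x' r F.X F.Y
        (fun s => xt ≤ F.X s ∨ ¬ ¬ U (F.X s) (F.Y s))
      have t2 : D.bb e r ≤ (boxSites F.X F.Y x' r
          fun s => ¬ (xt ≤ F.X s ∨ ¬ ¬ U (F.X s) (F.Y s))).card := by
        unfold bb
        apply Finset.card_le_card
        intro s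
        simp only [boxSites, Finset.mem_filter, Finset.mem_univ, true_and]
        rintro ⟨h5, h6⟩
        have h7 := (he s (by omega)).1 h6
        have h8 := e_mono _ _ h5.le
        refine ⟨by change D.X s < x'; omega, h5, ?_⟩
        rintro (h | h)
        · exact absurd h7.1 (not_lt.2 h)
        · exact h h7.2
      have t3 : D.nw x' r = (boxSites F.X F.Y x' r fun _ => True).card := rfl
      omega
  · intro r hr
    -- In column `xt`, which is no longer in the box, the condition comes from `hrow`.
    rcases e_mem r with h5 | h5
    · obtain ⟨y', r1, r2, r3⟩ := hrow
      exact ⟨y', by omega, by omega, D.lg_of_region he (e_le r) hr (by omega) (h5 ▸ r3)⟩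
    · by_cases h6 : e r = xt
      · obtain ⟨y', r1, r2, r3⟩ := hrow
        exact ⟨y', by omega, by omega, D.lg_of_region he (e_le r) hr (by omega) (h6 ▸ r3)⟩
      · have := e_le r
        obtain ⟨y', r1, r2, r3⟩ := hU.lg (e r) r (by omega) hr h5
        rw [hlp] at r3
        exact ⟨y', r1, Nat.le_succ_of_le r2, D.lg_of_region he (e_le r) hr r1 r3⟩
  · have t1 := Frame.card_boxSites_add_not xt y₀ D.X D.Y (fun s => U (D.X s) (D.Y s))
    have t2 : (boxSites D.X D.Y xt y₀ fun s => ¬ U (D.X s) (D.Y s)).card = D.bb e y₀ := by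
      unfold bb
      congr 1
      ext s
      simp only [boxSites, Finset.mem_filter, Finset.mem_univ, true_and]
      constructor
      · rintro ⟨h5, h6, h7⟩
        exact ⟨h6, (he s h6).2 ⟨h5, h7⟩⟩
      · rintro ⟨h5, h6⟩
        have := (he s h5).1 h6
        exact ⟨this.1, h5, this.2⟩
    have t3 : (boxSites F.X F.Y xt y₀ F.A).card = D.tp xt := by
      rw [← htp xt le_rfl]
      congr 1
      ext s
      simp only [F, boxSites, Finset.mem_filter, Finset.mem_univ, true_and]
      constructor
      · rintro ⟨h5, h6, h7⟩
        exact ⟨h7, (h1 s h7.1).2 h5⟩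
      · rintro ⟨h5, h6⟩
        exact ⟨h5.2, h2 s h5.1, h5⟩
    have t4 : (boxSites D.X D.Y xt y₀ fun s => U (D.X s) (D.Y s)).card = D.tp xt :=
      hcount.trans t3
    unfold nw
    omega
  · obtain ⟨y', r1, r2, r3⟩ := hrow
    exact ⟨y', r1, by omega, D.lg_of_region he le_rfl le_rfl r1 r3⟩

/-- The leader of the lowest site `c` with a top port separates the two halves: no other leader may
cross its vertical segment, and top ports of higher sites are not served across it. The cut `xt` is
a gap between columns, so reflection takes it to `2 * n - xt`, whereas a column `x` goes to `2 * n -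
1 - x`. -/
theorem Planar.exists_full {D : Disc n} {m : Fin n ≃ Fin n} (hm : D.Planar m) :
    ∃ xt y₀, xt ≤ 2 * n ∧ y₀ ≤ 2 * n ∧ (∃ e, D.Full xt y₀ e) ∧
      ∃ e, D.mirror.Full (2 * n - xt) y₀ e := by
  classical
  suffices h : ∃ xt y₀, xt ≤ 2 * n ∧ y₀ ≤ 2 * n ∧
      (∀ i, D.side (m i) = Side.top → (D.P (m i) < xt ↔ D.X i < xt)) ∧
      (∀ i, D.side (m i) = Side.top → D.Y i < y₀) ∧
      (∀ i, D.side (m i) = Side.left → D.P (m i) < y₀ → D.X i < xt) ∧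
      (∀ i, D.side (m i) = Side.right → D.X i < xt → y₀ ≤ D.P (m i)) by
    obtain ⟨xt, y₀, hx, hy, h1, h2, h3, h4⟩ := h
    refine ⟨xt, y₀, hx, hy, D.exists_full hm hy h1 h2 h3 h4,
      D.mirror.exists_full hm.mirror hy ?_ ?_ ?_ ?_⟩
    · intro i hi
      rw [mirror_eq_top] at hi
      rw [P_mirror_top _ hi, X_mirror]
      have := h1 i hi
      have := D.X_lt i
      have := D.P_lt (m i)
      omega
    · intro i hi
      rw [mirror_eq_top] at hi
      exact h2 i hi
    · intro i hi
      rw [mirror_eq_left] at hi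
      rw [P_mirror_right _ hi, X_mirror]
      have := h4 i hi
      have := D.X_lt i
      omega
    · intro i hi
      rw [mirror_eq_right] at hi
      rw [P_mirror_left _ hi, X_mirror]
      have := h3 i hi
      have := D.X_lt i
      omega
  by_cases hT : ∃ i, D.side (m i) = Side.top
  · obtain ⟨c, hc, hcmax⟩ := Finset.exists_max_image
      (Finset.univ.filter fun i => D.side (m i) = Side.top) D.Y (by simpa [Finset.Nonempty] using hT)
    simp only [Finset.mem_filter, Finset.mem_univ, true_and] at hc hcmax
    have b1 := D.P_lt (m c)
    have b2 := D.Y_lt c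
    have nX := D.P_ne_X _ hc
    -- The cut leaves the site `c` and its port on the same side: it is just right of the port if
    -- the leader runs to the right, and just left of it otherwise.
    let xt := if D.X c < D.P (m c) then D.P (m c) + 1 else D.P (m c)
    have hxt : xt = if D.X c < D.P (m c) then D.P (m c) + 1 else D.P (m c) := rfl
    refine ⟨xt, D.Y c + 1, by split_ifs at hxt <;> omega, by omega, ?_, ?_, ?_, ?_⟩
    · intro i hi
      rcases eq_or_ne i c with rfl | hne
      · split_ifs at hxt <;> omega
      · have g1 := hcmax i hi
        have g2 : D.Y i ≠ D.Y c := fun h => hne (D.injY h)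
        have g3 := (hm i c hne).tt hi hc (by omega)
        have g4 := nX i
        have g5 : D.P (m i) ≠ D.P (m c) := fun h =>
          hne (m.injective (D.P_inj _ _ (hi.trans hc.symm) h))
        unfold Btw at g3
        split_ifs at hxt <;> omega
    · intro i hi
      have := hcmax i hi
      omega
    · intro i hi hP
      have hne : c ≠ i := by rintro rfl; simp [hi] at hc
      have g1 := ((hm c i hne).tl hc hi).2
      have g2 := D.P_ne_Y (m i) (by simp [hi]) c
      have g3 := nX i
      split_ifs at hxt <;> omega
    · intro i hi hX
      have hne : c ≠ i := by rintro rfl; simp [hi] at hc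
      have g1 := ((hm c i hne).tr hc hi).2
      have g2 := D.P_ne_Y (m i) (by simp [hi]) c
      have g3 := nX i
      split_ifs at hxt <;> omega
  · push Not at hT
    exact ⟨0, 0, by omega, by omega, fun i h => absurd h (hT i), fun i h => absurd h (hT i),
      fun i _ h => absurd h (by omega), fun i _ h => absurd h (by omega)⟩

end Disc
end BoundaryLabeling

/-! ### Greedy labelings along admissible paths are planar -/

namespace BoundaryLabeling

/-- Of the ports at the positions `p` and `p'`, a site at position `k` prefers the one at `p`:
it takes the nearest smaller position if there is one, and else the nearest larger one. -/
def Prefers (k p p' : ℕ) : Prop := (p < k ∧ ¬ (p < p' ∧ p' < k)) ∨ (k < p ∧ p < p')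

namespace Disc

variable {n : ℕ}

/-- The site `s` lies above the path `e` to the point `xt`, `y₀`. -/
def Above (D : Disc n) (xt y₀ : ℕ) (e : ℕ → ℕ) (s : Fin n) : Prop :=
  D.Y s < y₀ ∧ e (D.Y s) ≤ D.X s ∧ D.X s < xt

/-- In the part left of `xt`, the labeling `m` follows the path `e` and is chosen greedily. -/
structure GreedyLeft (D : Disc n) (xt y₀ : ℕ) (e : ℕ → ℕ) (m : Fin n ≃ Fin n) : Prop where
  top : ∀ s, D.side (m s) = Side.top → (D.P (m s) < xt ∧ D.Above xt y₀ e s) ∨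
    (xt ≤ D.P (m s) ∧ xt ≤ D.X s)
  above : ∀ s, D.Above xt y₀ e s → D.side (m s) = Side.top
  greedyT : ∀ s s', D.Above xt y₀ e s → D.Above xt y₀ e s' → D.Y s < D.Y s' →
    Prefers (D.X s) (D.P (m s)) (D.P (m s'))
  greedyL : ∀ s s', D.side (m s) = Side.left → D.side (m s') = Side.left → D.X s < D.X s' →
    Prefers (D.Y s) (D.P (m s)) (D.P (m s'))
  lr : ∀ s s', D.side (m s) = Side.left → D.side (m s') = Side.right → D.X s < D.X s'

namespace GreedyLeft

variable {D : Disc n} {xt y₀ : ℕ} {e : ℕ → ℕ} {m : Fin n ≃ Fin n}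

theorem card_le_tp {A : Finset (Fin n)} {x : ℕ}
    (h : ∀ s ∈ A, D.side (m s) = Side.top ∧ D.P (m s) < x) : A.card ≤ D.tp x := by
  classical
  unfold tp
  rw [← Finset.card_map m.toEmbedding]
  apply Finset.card_le_card
  intro j
  simp only [Finset.mem_map, Finset.mem_filter, Finset.mem_univ, true_and]
  rintro ⟨s, hs, rfl⟩
  exact h s hs

theorem card_le_lp {A : Finset (Fin n)} {y : ℕ}
    (h : ∀ s ∈ A, D.side (m s) = Side.left ∧ D.P (m s) < y) : A.card ≤ D.lp y := by
  classical
  unfold lp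
  rw [← Finset.card_map m.toEmbedding]
  apply Finset.card_le_card
  intro j
  simp only [Finset.mem_map, Finset.mem_filter, Finset.mem_univ, true_and]
  rintro ⟨s, hs, rfl⟩
  exact h s hs

/-- Suppose that `p` gets a port left of the path, and let `x'` be the column provided by `TG`.
Every site above the path in an earlier row and left of `x'` prefers its own port to that of `p`, so
its port also lies left of `x'`. Together with `p` these are more sites than there are top ports
left of `x'`. -/
theorem P_ge (h : D.GreedyLeft xt y₀ e m) (he : D.Chain xt y₀ e) {p : Fin n}
    (hp : D.Above xt y₀ e p) : e (D.Y p) ≤ D.P (m p) := by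
  classical
  by_contra hlt
  obtain ⟨x', h1, h2, h3⟩ := he.tg _ hp.1
  let A : Finset (Fin n) := Finset.univ.filter fun s =>
    D.Above xt y₀ e s ∧ D.Y s < D.Y p ∧ D.X s < x'
  have h4 : D.nw x' (D.Y p) ≤ A.card + D.bb e (D.Y p) := by
    unfold nw bb
    refine le_trans (Finset.card_le_card ?_) (Finset.card_union_le _ _)
    intro s
    simp only [A, boxSites, Finset.mem_union, Finset.mem_filter, Finset.mem_univ, true_and,
      and_true]
    rintro ⟨h5, h6⟩
    have := hp.1
    by_cases h7 : e (D.Y s) ≤ D.X s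
    · exact Or.inl ⟨⟨by omega, h7, by omega⟩, h6, h5⟩
    · exact Or.inr ⟨h6, not_le.1 h7⟩
  have h5 : p ∉ A := by simp [A]
  have h6 : (insert p A).card ≤ D.tp x' := by
    apply card_le_tp (m := m)
    intro s hs
    rcases Finset.mem_insert.1 hs with rfl | hs
    · exact ⟨h.above s hp, by omega⟩
    · simp only [A, Finset.mem_filter, Finset.mem_univ, true_and] at hs
      refine ⟨h.above s hs.1, ?_⟩
      have := h.greedyT s p hs.1 hp hs.2.1
      unfold Prefers at this
      omega
  rw [Finset.card_insert_of_notMem h5] at h6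
  omega

/-- Suppose that the port of `j` is above row `y`, and let `y'` be the row provided by `LG`. The
sites left of `c`, above `y'` and not above the path have left ports, because right ports belong
only to sites right of `j`. They prefer their own ports to that of `j`, so these ports are above
`y'`. Together with `j` there are too many sites for the left ports above `y'`. -/
theorem left_not_consumed (h : D.GreedyLeft xt y₀ e m) {c y : ℕ}
    (hc : c ≤ xt) (hcy : ∀ r, r < y → e r ≤ c)
    (hcy' : ∀ r, y ≤ r → r < y₀ → c ≤ e r) (hlg : D.LG c y (D.bb e y)) {j : Fin n}
    (hj : D.side (m j) = Side.left) (hX : c ≤ D.X j) : y ≤ D.P (m j) := by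
  classical
  by_contra hlt
  obtain ⟨y', h1, -, h3⟩ := hlg
  let N : Finset (Fin n) := boxSites D.X D.Y c y' fun s => ¬ D.Above xt y₀ e s
  have t1 := Frame.card_boxSites_add_not c y' D.X D.Y (D.Above xt y₀ e)
  have t2 : (boxSites D.X D.Y c y' (D.Above xt y₀ e)).card + D.bb e y ≤ D.nw c y := by
    unfold bb nw
    rw [← Finset.card_union_of_disjoint]
    · apply Finset.card_le_card
      intro s
      simp only [boxSites, Finset.mem_union, Finset.mem_filter, Finset.mem_univ, true_and,
        and_true]
      rintro (⟨h5, h6, h7, h8, h9⟩ | ⟨h5, h6⟩)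
      · refine ⟨h5, ?_⟩
        by_contra h10
        have := hcy' _ (not_lt.1 h10) h7
        omega
      · exact ⟨h6.trans_le (hcy _ h5), h5⟩
    · rw [Finset.disjoint_left]
      intro s
      simp only [boxSites, Finset.mem_filter, Finset.mem_univ, true_and]
      rintro ⟨h5, h6, h7, h8, h9⟩
      omega
  have t3 : D.nw c y' = (boxSites D.X D.Y c y' fun _ => True).card := rfl
  have hN : D.lp y' ≤ N.card := by
    simp only [N]; omega
  have h5 : j ∉ N := by simp [N, boxSites, hX]
  have h6 : (insert j N).card ≤ D.lp y' := by
    apply card_le_lp (m := m)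
    intro s hs
    rcases Finset.mem_insert.1 hs with rfl | hs
    · exact ⟨hj, by omega⟩
    · simp only [N, boxSites, Finset.mem_filter, Finset.mem_univ, true_and] at hs
      obtain ⟨g1, g2, g3⟩ := hs
      have g4 : D.side (m s) = Side.left := by
        rcases hs : D.side (m s) with _ | _ | _
        · rfl
        · rcases h.top s hs with h7 | h7
          · exact absurd h7.2 g3
          · omega
        · have := h.lr j s hj hs
          omega
      refine ⟨g4, ?_⟩
      have := h.greedyL s j g4 hj (by omega)
      unfold Prefers at this
      omega
  rw [Finset.card_insert_of_notMem h5] at h6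
  omega

theorem left_right (h : D.GreedyLeft xt y₀ e m) (he : D.Full xt y₀ e) {q : Fin n}
    (hq : D.side (m q) = Side.left) (hX : xt ≤ D.X q) : y₀ ≤ D.P (m q) :=
  h.left_not_consumed le_rfl (fun r hr => he.le r hr)
    (fun r h1 h2 => absurd h2 (by omega)) he.lg_end hq hX

/-- `left_not_consumed` at the point where the path passes the row of the port: the horizontal part
of a left leader ends before the path. -/
theorem left_below (h : D.GreedyLeft xt y₀ e m) (he : D.Full xt y₀ e) {q : Fin n}
    (hq : D.side (m q) = Side.left) (hP : D.P (m q) < y₀) : D.X q < e (D.P (m q)) := by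
  by_contra hX
  have := h.left_not_consumed (he.le _ hP)
    (fun r hr => he.mono _ _ (by omega) hP) (fun r h1 h2 => he.mono _ _ (by omega) h2)
    (he.lg _ hP) hq (not_lt.1 hX)
  omega

theorem not_above (h : D.GreedyLeft xt y₀ e m) {q : Fin n} (hq : D.side (m q) ≠ Side.top)
    (hX : D.X q < xt) (hY : D.Y q < y₀) : D.X q < e (D.Y q) := by
  by_contra h1
  exact hq (h.above q ⟨hY, not_lt.1 h1, hX⟩)

/-- In row `D.Y p` the leader of `p` stays between the path and `xt`, and its vertical part runs
upwards on the upper side of the monotone path. The left leader has its horizontal part, and its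
site if that is in the relevant part, on the other side. -/
theorem nc_tl (h : D.GreedyLeft xt y₀ e m) (he : D.Full xt y₀ e) {p q : Fin n}
    (hp : D.Above xt y₀ e p) (hq : D.side (m q) = Side.left) :
    ¬ (Btw (D.X p) (D.X q) (D.P (m p)) ∧ Btw (D.Y q) (D.Y p) (D.P (m q))) ∧
    ¬ (D.P (m p) < D.X q ∧ D.P (m q) < D.Y p) := by
  have h1 := h.P_ge he.toChain hp
  have h0 : D.P (m p) < xt := by
    rcases h.top p (h.above p hp) with h' | h'
    · exact h'.1
    · have := hp.2.2; omega
  obtain ⟨a1, a2, a3⟩ := hp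
  have hb : D.P (m q) ≤ D.Y p → D.X q < e (D.Y p) := fun h2 =>
    (h.left_below he hq (by omega)).trans_le (he.mono _ _ h2 a1)
  constructor
  · rintro ⟨h2, h3⟩
    unfold Btw at h2 h3
    have hX : D.X q < xt := by omega
    rcases h3 with h3 | h3
    · have h4 := h.not_above (by simp [hq]) hX (by omega)
      have h5 := he.mono _ _ h3.1 a1
      omega
    · have := hb h3.1
      omega
  · rintro ⟨h2, h3⟩
    have := hb h3.le
    omega

/-- A site left of `xt` with a right port lies left of the path or below it, and `hright` puts its
port at or below `y₀`. So its leader meets no leader above the path. -/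
theorem nc_tr (h : D.GreedyLeft xt y₀ e m) (he : D.Full xt y₀ e)
    (hright : ∀ q, D.side (m q) = Side.right → D.X q < xt → y₀ ≤ D.P (m q)) {p q : Fin n}
    (hp : D.Above xt y₀ e p) (hq : D.side (m q) = Side.right) :
    ¬ (Btw (D.X p) (D.X q) (D.P (m p)) ∧ Btw (D.Y q) (D.Y p) (D.P (m q))) ∧
    ¬ (D.X q < D.P (m p) ∧ D.P (m q) < D.Y p) := by
  have h1 := h.P_ge he.toChain hp
  have h0 : D.P (m p) < xt := by
    rcases h.top p (h.above p hp) with h' | h'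
    · exact h'.1
    · have := hp.2.2; omega
  obtain ⟨a1, a2, a3⟩ := hp
  constructor
  · rintro ⟨h2, h3⟩
    unfold Btw at h2 h3
    have hX : D.X q < xt := by omega
    have hr := hright q hq hX
    have h4 := h.not_above (by simp [hq]) hX (by omega)
    have h5 := he.mono (D.Y q) (D.Y p) (by omega) a1
    omega
  · rintro ⟨h2, h3⟩
    have := hright q hq (by omega)
    omega

end GreedyLeft

/-- Two greedy halves form a planar labeling. -/
theorem planar_of_greedy {D : Disc n} {xt y₀ : ℕ} {e e' : ℕ → ℕ} {m : Fin n ≃ Fin n}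
    (hx : xt ≤ 2 * n) (he : D.Full xt y₀ e) (he' : D.mirror.Full (2 * n - xt) y₀ e')
    (h : D.GreedyLeft xt y₀ e m) (h' : D.mirror.GreedyLeft (2 * n - xt) y₀ e' m) :
    D.Planar m := by
  -- The information about the right ports that the left half needs is `left_right` for the mirrored
  -- half.
  have hright : ∀ q, D.side (m q) = Side.right → D.X q < xt → y₀ ≤ D.P (m q) := by
    intro q hq hX
    have := h'.left_right he' (D.mirror_eq_left.2 hq) (by rw [X_mirror]; have := D.X_lt q; omega)
    rwa [P_mirror_right _ hq] at this
  have hright' : ∀ q, D.mirror.side (m q) = Side.right → D.mirror.X q < 2 * n - xt →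
      y₀ ≤ D.mirror.P (m q) := by
    intro q hq hX
    rw [mirror_eq_right] at hq
    rw [X_mirror] at hX
    rw [P_mirror_left _ hq]
    exact h.left_right he hq (by omega)
  have htop' : ∀ s, D.side (m s) = Side.top → xt ≤ D.P (m s) → 
      D.mirror.Above (2 * n - xt) y₀ e' s := by
    intro s hs hP
    rcases h'.top s (D.mirror_eq_top.2 hs) with h1 | h1
    · exact h1.2
    · rw [P_mirror_top _ hs] at h1
      have := D.P_lt (m s)
      omega
  have htop : ∀ s, D.side (m s) = Side.top → D.P (m s) < xt → D.Above xt y₀ e s := by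
    intro s hs hP
    rcases h.top s hs with h1 | h1
    · exact h1.2
    · omega
  intro i i' hne
  have xi := D.X_lt i
  have xi' := D.X_lt i'
  have pi := D.P_lt (m i)
  have pi' := D.P_lt (m i')
  constructor
  · intro h1 h2 h3 h4
    have := h.greedyL i i' h1 h2 h3
    have hP : D.P (m i) ≠ D.P (m i') := fun hh =>
      hne (m.injective (D.P_inj _ _ (h1.trans h2.symm) hh))
    have := D.P_ne_Y (m i') (by simp [h2]) i
    unfold Prefers at *
    unfold Btw at *
    omega
  · intro h1 h2 h3 h4
    have := h'.greedyL i i' (D.mirror_eq_left.2 h1) (D.mirror_eq_left.2 h2)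
      (by rw [X_mirror, X_mirror]; omega)
    rw [P_mirror_right _ h1, P_mirror_right _ h2, Y_mirror] at this
    have hP : D.P (m i) ≠ D.P (m i') := fun hh =>
      hne (m.injective (D.P_inj _ _ (h1.trans h2.symm) hh))
    have := D.P_ne_Y (m i') (by simp [h2]) i
    unfold Prefers at *
    unfold Btw at *
    omega
  · intro h1 h2 h3 h4
    have hP : D.P (m i) ≠ D.P (m i') := fun hh =>
      hne (m.injective (D.P_inj _ _ (h1.trans h2.symm) hh))
    have hPX := D.P_ne_X (m i') h2 i
    -- Two top leaders on different sides of `xt` cannot meet, since each site lies on the same side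
    -- as its port; on one side the greedy choice applies.
    by_cases c1 : D.P (m i) < xt <;> by_cases c2 : D.P (m i') < xt
    · have := h.greedyT i i' (htop _ h1 c1) (htop _ h2 c2) h3
      unfold Prefers at *
      unfold Btw at *
      omega
    · have := (htop _ h1 c1).2.2
      unfold Btw at *
      omega
    · have := (htop' _ h1 (not_lt.1 c1)).2.2
      rw [X_mirror] at this
      unfold Btw at *
      omega
    · have := h'.greedyT i i' (htop' _ h1 (not_lt.1 c1)) (htop' _ h2 (not_lt.1 c2)) h3
      rw [P_mirror_top _ h1, P_mirror_top _ h2, X_mirror] at this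
      unfold Prefers at *
      unfold Btw at *
      omega
  · intro h1 h2
    by_cases c1 : D.P (m i) < xt
    · exact h.nc_tl he (htop _ h1 c1) h2
    · have := h'.nc_tr he' hright' (htop' _ h1 (not_lt.1 c1)) (D.mirror_eq_right.2 h2)
      rw [P_mirror_top _ h1, P_mirror_left _ h2, X_mirror, X_mirror, Y_mirror, Y_mirror,
        btw_mirror xi xi' pi] at this
      exact ⟨this.1, fun hh => this.2 ⟨by omega, hh.2⟩⟩
  · intro h1 h2
    by_cases c1 : D.P (m i) < xt
    · exact h.nc_tr he hright (htop _ h1 c1) h2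
    · have := h'.nc_tl he' (htop' _ h1 (not_lt.1 c1)) (D.mirror_eq_left.2 h2)
      rw [P_mirror_top _ h1, P_mirror_right _ h2, X_mirror, X_mirror, Y_mirror, Y_mirror,
        btw_mirror xi xi' pi] at this
      exact ⟨this.1, fun hh => this.2 ⟨by omega, hh.2⟩⟩
  · intro h1 h2 h3
    have := h.lr i i' h1 h2
    omega

end Disc
end BoundaryLabeling

/-! ### Ranks of coordinates, and leaders as point sets -/

namespace BoundaryLabeling

/-- The number of indices with a value below `v`. -/
noncomputable def rank {κ : Type} [Fintype κ] (g : κ → ℝ) (v : ℝ) : ℕ := by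
  classical exact (Finset.univ.filter fun k => g k < v).card

theorem rank_lt_card {κ : Type} [Fintype κ] (g : κ → ℝ) (k : κ) :
    rank g (g k) < Fintype.card κ := by
  classical
  unfold rank
  apply Finset.card_lt_univ_of_notMem (x := k)
  simp

theorem rank_lt_iff {κ : Type} [Fintype κ] (g : κ → ℝ) (k k' : κ) :
    rank g (g k) < rank g (g k') ↔ g k < g k' := by
  classical
  unfold rank
  constructor
  · intro h
    by_contra h1
    refine absurd (Finset.card_le_card ?_) (not_le.2 h)
    intro a
    simp only [Finset.mem_filter, Finset.mem_univ, true_and]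
    exact fun h2 => h2.trans_le (not_lt.1 h1)
  · intro h
    apply Finset.card_lt_card
    rw [Finset.ssubset_iff_of_subset]
    · exact ⟨k, by simpa using h, by simp⟩
    · intro a
      simp only [Finset.mem_filter, Finset.mem_univ, true_and]
      exact fun h2 => h2.trans h

theorem rank_le_iff {κ : Type} [Fintype κ] (g : κ → ℝ) (k k' : κ) :
    rank g (g k) ≤ rank g (g k') ↔ g k ≤ g k' := by
  rw [← not_lt, rank_lt_iff, not_lt]

namespace Instance

variable {n : ℕ} (I : Instance n)

/-- All abscissae. -/
def gx : Fin n ⊕ Fin n → ℝ := Sum.elim (fun i => (I.site i).1) (fun j => (I.port j).1)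

/-- All ordinates, reversed. -/
def gy : Fin n ⊕ Fin n → ℝ := Sum.elim (fun i => -(I.site i).2) (fun j => -(I.port j).2)

theorem card_sum : Fintype.card (Fin n ⊕ Fin n) = 2 * n := by simp [two_mul]

theorem gx_ne (i j : Fin n) : I.gx (Sum.inl i) ≠ I.gx (Sum.inr j) := (I.port_general i j).1

theorem gy_ne (i j : Fin n) : I.gy (Sum.inl i) ≠ I.gy (Sum.inr j) := fun h =>
  (I.port_general i j).2 (neg_injective h)

theorem rank_inj {g : Fin n ⊕ Fin n → ℝ} {k k' : Fin n ⊕ Fin n}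
    (h : rank g (g k) = rank g (g k')) : g k = g k' :=
  le_antisymm ((rank_le_iff g k k').1 h.le) ((rank_le_iff g k' k).1 h.ge)

/-- The instance with all coordinates replaced by their ranks. -/
noncomputable def disc : Disc n where
  X := fun s => rank I.gx (I.gx (Sum.inl s))
  Y := fun s => rank I.gy (I.gy (Sum.inl s))
  P := fun j => match I.side j with
    | Side.top => rank I.gx (I.gx (Sum.inr j))
    | _ => rank I.gy (I.gy (Sum.inr j))
  side := I.side
  X_lt := fun s => card_sum (n := n) ▸ rank_lt_card I.gx _
  Y_lt := fun s => card_sum (n := n) ▸ rank_lt_card I.gy _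
  P_lt := fun j => by
    have h1 : _ < 2 * n := card_sum (n := n) ▸ rank_lt_card I.gx (Sum.inr j)
    have h2 : _ < 2 * n := card_sum (n := n) ▸ rank_lt_card I.gy (Sum.inr j)
    split <;> assumption
  injX := fun s s' h => by
    by_contra hne
    exact (I.site_general s s' hne).1 (rank_inj h)
  injY := fun s s' h => by
    by_contra hne
    exact (I.site_general s s' hne).2 (neg_injective (rank_inj h))
  P_inj := fun j j' h1 h2 => by
    apply I.port_injective
    have p1 := I.port_mem j
    have p2 := I.port_mem j'
    rw [← h1] at p2
    simp only [← h1] at h2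
    -- Ports on the same side share the coordinate orthogonal to it, so a common rank along the side
    -- makes them equal.
    rcases hs : I.side j with _ | _ | _ <;>
      simp only [hs, Side.edge, Set.mem_ofPred_eq] at p1 p2 h2
    · exact Prod.ext (p1.1.trans p2.1.symm) (neg_injective (rank_inj h2))
    · exact Prod.ext (rank_inj h2) (p1.2.2.trans p2.2.2.symm)
    · exact Prod.ext (p1.1.trans p2.1.symm) (neg_injective (rank_inj h2))
  P_ne_X := fun j h s h1 => by
    simp only [h] at h1
    exact I.gx_ne s j (rank_inj h1).symm
  P_ne_Y := fun j h s h1 => by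
    rcases hs : I.side j with _ | _ | _ <;> simp only [hs] at h1 h
    · exact I.gy_ne s j (rank_inj h1).symm
    · exact h rfl
    · exact I.gy_ne s j (rank_inj h1).symm

theorem disc_side (j : Fin n) : I.disc.side j = I.side j := rfl

/-- `v` lies between `a` and `b`. -/
def RBtw (a v b : ℝ) : Prop := (a ≤ v ∧ v ≤ b) ∨ (b ≤ v ∧ v ≤ a)

theorem btw_rank {κ : Type} [Fintype κ] (g : κ → ℝ) (a v b : κ) :
    Btw (rank g (g a)) (rank g (g v)) (rank g (g b)) ↔ RBtw (g a) (g v) (g b) := by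
  unfold Btw RBtw
  simp only [rank_le_iff]

theorem rbtw_neg (a v b : ℝ) : RBtw (-a) (-v) (-b) ↔ RBtw a v b := by
  unfold RBtw
  simp only [neg_le_neg_iff]
  tauto

theorem mem_segment_vert {a b c : ℝ} {z : ℝ × ℝ} :
    z ∈ segment ℝ (a, b) (a, c) ↔ z.1 = a ∧ RBtw b z.2 c := by
  rw [← Prod.image_mk_segment_right, segment_eq_uIcc]
  constructor
  · rintro ⟨y, hy, rfl⟩
    refine ⟨rfl, ?_⟩
    rw [Set.mem_uIcc] at hy
    exact hy
  · rintro ⟨h1, h2⟩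
    exact ⟨z.2, Set.mem_uIcc.2 h2, Prod.ext h1.symm rfl⟩

theorem mem_segment_horiz {a b c : ℝ} {z : ℝ × ℝ} :
    z ∈ segment ℝ (b, a) (c, a) ↔ z.2 = a ∧ RBtw b z.1 c := by
  rw [← Prod.image_mk_segment_left, segment_eq_uIcc]
  constructor
  · rintro ⟨y, hy, rfl⟩
    refine ⟨rfl, ?_⟩
    rw [Set.mem_uIcc] at hy
    exact hy
  · rintro ⟨h1, h2⟩
    exact ⟨z.1, Set.mem_uIcc.2 h2, Prod.ext rfl h1.symm⟩

theorem mem_leader_left {i j : Fin n} (h : I.side j = Side.left) {z : ℝ × ℝ} :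
    z ∈ I.leaderOf i j ↔ (z.1 = (I.site i).1 ∧ RBtw (I.site i).2 z.2 (I.port j).2) ∨
      (z.2 = (I.port j).2 ∧ 0 ≤ z.1 ∧ z.1 ≤ (I.site i).1) := by
  have hp := I.port_mem j
  have hs := I.site_mem i
  rw [h] at hp
  simp only [Side.edge, Set.mem_ofPred_eq] at hp
  unfold leaderOf leader bend
  rw [h]
  simp only [Set.mem_union]
  rw [show I.site i = ((I.site i).1, (I.site i).2) from rfl,
    show I.port j = ((I.port j).1, (I.port j).2) from rfl, mem_segment_vert, mem_segment_horiz]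
  simp only [RBtw]
  grind

theorem mem_leader_right {i j : Fin n} (h : I.side j = Side.right) {z : ℝ × ℝ} :
    z ∈ I.leaderOf i j ↔ (z.1 = (I.site i).1 ∧ RBtw (I.site i).2 z.2 (I.port j).2) ∨
      (z.2 = (I.port j).2 ∧ z.1 ≤ I.W ∧ (I.site i).1 ≤ z.1) := by
  have hp := I.port_mem j
  have hs := I.site_mem i
  rw [h] at hp
  simp only [Side.edge, Set.mem_ofPred_eq] at hp
  unfold leaderOf leader bend
  rw [h]
  simp only [Set.mem_union]
  rw [show I.site i = ((I.site i).1, (I.site i).2) from rfl,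
    show I.port j = ((I.port j).1, (I.port j).2) from rfl, mem_segment_vert, mem_segment_horiz]
  simp only [RBtw]
  grind

theorem mem_leader_top {i j : Fin n} (h : I.side j = Side.top) {z : ℝ × ℝ} :
    z ∈ I.leaderOf i j ↔ (z.2 = (I.site i).2 ∧ RBtw (I.site i).1 z.1 (I.port j).1) ∨
      (z.1 = (I.port j).1 ∧ z.2 ≤ I.H ∧ (I.site i).2 ≤ z.2) := by
  have hp := I.port_mem j
  have hs := I.site_mem i
  rw [h] at hp
  simp only [Side.edge, Set.mem_ofPred_eq] at hp
  unfold leaderOf leader bend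
  rw [h]
  simp only [Set.mem_union]
  rw [show I.site i = ((I.site i).1, (I.site i).2) from rfl,
    show I.port j = ((I.port j).1, (I.port j).2) from rfl, mem_segment_vert, mem_segment_horiz]
  simp only [RBtw]
  grind

end Instance
end BoundaryLabeling

/-! ### Disjointness of leaders in terms of order -/

namespace BoundaryLabeling
namespace Instance

variable {n : ℕ} (I : Instance n)

theorem disc_P_top {j : Fin n} (h : I.side j = Side.top) :
    I.disc.P j = rank I.gx (I.gx (Sum.inr j)) := by simp [disc, h]

theorem disc_P_left {j : Fin n} (h : I.side j = Side.left) :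
    I.disc.P j = rank I.gy (I.gy (Sum.inr j)) := by simp [disc, h]

theorem disc_P_right {j : Fin n} (h : I.side j = Side.right) :
    I.disc.P j = rank I.gy (I.gy (Sum.inr j)) := by simp [disc, h]

theorem disc_X (s : Fin n) : I.disc.X s = rank I.gx (I.gx (Sum.inl s)) := rfl

theorem disc_Y (s : Fin n) : I.disc.Y s = rank I.gy (I.gy (Sum.inl s)) := rfl

theorem gx_inl (s : Fin n) : I.gx (Sum.inl s) = (I.site s).1 := rfl
theorem gx_inr (j : Fin n) : I.gx (Sum.inr j) = (I.port j).1 := rfl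
theorem gy_inl (s : Fin n) : I.gy (Sum.inl s) = -(I.site s).2 := rfl
theorem gy_inr (j : Fin n) : I.gy (Sum.inr j) = -(I.port j).2 := rfl

/-- The vertical parts lie in different columns and the horizontal parts in different rows, so only
a vertical part can meet a horizontal one. A horizontal part reaches the column of the other site
exactly if its own site is farther right. -/
theorem disjoint_left_left {i j i' j' : Fin n} (hi : i ≠ i') (hj : j ≠ j')
    (h : I.side j = Side.left) (h' : I.side j' = Side.left) :
    Disjoint (I.leaderOf i j) (I.leaderOf i' j') ↔
      ((I.site i).1 < (I.site i').1 → ¬ RBtw (I.site i).2 (I.port j').2 (I.port j).2) ∧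
      ((I.site i').1 < (I.site i).1 → ¬ RBtw (I.site i').2 (I.port j).2 (I.port j').2) := by
  have g := (I.site_general i i' hi).1
  have p := I.port_mem j
  have p' := I.port_mem j'
  rw [h] at p
  rw [h'] at p'
  simp only [Side.edge, Set.mem_ofPred_eq] at p p'
  have q : (I.port j).2 ≠ (I.port j').2 := fun hh =>
    hj (I.port_injective (Prod.ext (p.1.trans p'.1.symm) hh))
  have s := I.site_mem i
  have s' := I.site_mem i'
  rw [Set.disjoint_left]
  simp only [I.mem_leader_left h, I.mem_leader_left h']
  constructor
  · intro hd
    refine ⟨fun h1 h2 => ?_, fun h1 h2 => ?_⟩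
    · exact hd (a := ((I.site i).1, (I.port j').2)) (Or.inl ⟨rfl, h2⟩) (Or.inr ⟨rfl, s.1, h1.le⟩)
    · exact hd (a := ((I.site i').1, (I.port j).2)) (Or.inr ⟨rfl, s'.1, h1.le⟩) (Or.inl ⟨rfl, h2⟩)
  · rintro ⟨h1, h2⟩ z (⟨a1, a2⟩ | ⟨a1, a2, a3⟩) (⟨b1, b2⟩ | ⟨b1, b2, b3⟩)
    · exact g (a1.symm.trans b1)
    · exact h1 (by rw [a1] at b3; exact lt_of_le_of_ne b3 g) (b1 ▸ a2)
    · exact h2 (by rw [b1] at a3; exact lt_of_le_of_ne a3 g.symm) (a1 ▸ b2)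
    · exact q (a1.symm.trans b1)

theorem disjoint_right_right {i j i' j' : Fin n} (hi : i ≠ i') (hj : j ≠ j')
    (h : I.side j = Side.right) (h' : I.side j' = Side.right) :
    Disjoint (I.leaderOf i j) (I.leaderOf i' j') ↔
      ((I.site i').1 < (I.site i).1 → ¬ RBtw (I.site i).2 (I.port j').2 (I.port j).2) ∧
      ((I.site i).1 < (I.site i').1 → ¬ RBtw (I.site i').2 (I.port j).2 (I.port j').2) := by
  have g := (I.site_general i i' hi).1
  have p := I.port_mem j
  have p' := I.port_mem j'
  rw [h] at p
  rw [h'] at p'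
  simp only [Side.edge, Set.mem_ofPred_eq] at p p'
  have q : (I.port j).2 ≠ (I.port j').2 := fun hh =>
    hj (I.port_injective (Prod.ext (p.1.trans p'.1.symm) hh))
  have s := I.site_mem i
  have s' := I.site_mem i'
  rw [Set.disjoint_left]
  simp only [I.mem_leader_right h, I.mem_leader_right h']
  constructor
  · intro hd
    refine ⟨fun h1 h2 => ?_, fun h1 h2 => ?_⟩
    · exact hd (a := ((I.site i).1, (I.port j').2)) (Or.inl ⟨rfl, h2⟩)
        (Or.inr ⟨rfl, s.2.1, h1.le⟩)
    · exact hd (a := ((I.site i').1, (I.port j).2)) (Or.inr ⟨rfl, s'.2.1, h1.le⟩)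
        (Or.inl ⟨rfl, h2⟩)
  · rintro ⟨h1, h2⟩ z (⟨a1, a2⟩ | ⟨a1, a2, a3⟩) (⟨b1, b2⟩ | ⟨b1, b2, b3⟩)
    · exact g (a1.symm.trans b1)
    · exact h1 (by rw [a1] at b3; exact lt_of_le_of_ne b3 g.symm) (b1 ▸ a2)
    · exact h2 (by rw [b1] at a3; exact lt_of_le_of_ne a3 g) (a1 ▸ b2)
    · exact q (a1.symm.trans b1)

theorem disjoint_top_top {i j i' j' : Fin n} (hi : i ≠ i') (hj : j ≠ j')
    (h : I.side j = Side.top) (h' : I.side j' = Side.top) :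
    Disjoint (I.leaderOf i j) (I.leaderOf i' j') ↔
      ((I.site i').2 < (I.site i).2 → ¬ RBtw (I.site i).1 (I.port j').1 (I.port j).1) ∧
      ((I.site i).2 < (I.site i').2 → ¬ RBtw (I.site i').1 (I.port j).1 (I.port j').1) := by
  have g := (I.site_general i i' hi).2
  have p := I.port_mem j
  have p' := I.port_mem j'
  rw [h] at p
  rw [h'] at p'
  simp only [Side.edge, Set.mem_ofPred_eq] at p p'
  have q : (I.port j).1 ≠ (I.port j').1 := fun hh =>
    hj (I.port_injective (Prod.ext hh (p.2.2.trans p'.2.2.symm)))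
  have s := I.site_mem i
  have s' := I.site_mem i'
  rw [Set.disjoint_left]
  simp only [I.mem_leader_top h, I.mem_leader_top h']
  constructor
  · intro hd
    refine ⟨fun h1 h2 => ?_, fun h1 h2 => ?_⟩
    · exact hd (a := ((I.port j').1, (I.site i).2)) (Or.inl ⟨rfl, h2⟩)
        (Or.inr ⟨rfl, s.2.2.2, h1.le⟩)
    · exact hd (a := ((I.port j).1, (I.site i').2)) (Or.inr ⟨rfl, s'.2.2.2, h1.le⟩)
        (Or.inl ⟨rfl, h2⟩)
  · rintro ⟨h1, h2⟩ z (⟨a1, a2⟩ | ⟨a1, a2, a3⟩) (⟨b1, b2⟩ | ⟨b1, b2, b3⟩)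
    · exact g (a1.symm.trans b1)
    · exact h1 (by rw [a1] at b3; exact lt_of_le_of_ne b3 g.symm) (b1 ▸ a2)
    · exact h2 (by rw [b1] at a3; exact lt_of_le_of_ne a3 g) (a1 ▸ b2)
    · exact q (a1.symm.trans b1)

/-- General position with respect to ports excludes collinear parts. What remains are a crossing of
the segments at the sites and a crossing of the segments at the ports. -/
theorem disjoint_top_left {i j i' j' : Fin n} (hi : i ≠ i')
    (h : I.side j = Side.top) (h' : I.side j' = Side.left) :
    Disjoint (I.leaderOf i j) (I.leaderOf i' j') ↔
      ¬ (RBtw (I.site i).1 (I.site i').1 (I.port j).1 ∧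
        RBtw (I.site i').2 (I.site i).2 (I.port j').2) ∧
      ¬ ((I.port j).1 < (I.site i').1 ∧ (I.site i).2 < (I.port j').2) := by
  have g := I.site_general i i' hi
  have p := I.port_mem j
  have p' := I.port_mem j'
  rw [h] at p
  rw [h'] at p'
  simp only [Side.edge, Set.mem_ofPred_eq] at p p'
  have s := I.site_mem i
  have s' := I.site_mem i'
  have q1 := (I.port_general i' j).1
  have q2 := (I.port_general i j').2
  rw [Set.disjoint_left]
  simp only [I.mem_leader_top h, I.mem_leader_left h']
  constructor
  · intro hd
    refine ⟨fun h1 => ?_, fun h1 => ?_⟩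
    · exact hd (a := ((I.site i').1, (I.site i).2)) (Or.inl ⟨rfl, h1.1⟩) (Or.inl ⟨rfl, h1.2⟩)
    · exact hd (a := ((I.port j).1, (I.port j').2)) (Or.inr ⟨rfl, p'.2.2, h1.2.le⟩)
        (Or.inr ⟨rfl, p.1, h1.1.le⟩)
  · rintro ⟨h1, h2⟩ z (⟨a1, a2⟩ | ⟨a1, a2, a3⟩) (⟨b1, b2⟩ | ⟨b1, b2, b3⟩)
    · exact h1 ⟨b1 ▸ a2, a1 ▸ b2⟩
    · exact q2 (a1.symm.trans b1)
    · exact q1 (b1.symm.trans a1)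
    · rw [a1] at b3
      rw [b1] at a3
      exact h2 ⟨lt_of_le_of_ne b3 q1.symm, lt_of_le_of_ne a3 q2⟩

theorem disjoint_top_right {i j i' j' : Fin n} (hi : i ≠ i')
    (h : I.side j = Side.top) (h' : I.side j' = Side.right) :
    Disjoint (I.leaderOf i j) (I.leaderOf i' j') ↔
      ¬ (RBtw (I.site i).1 (I.site i').1 (I.port j).1 ∧
        RBtw (I.site i').2 (I.site i).2 (I.port j').2) ∧
      ¬ ((I.site i').1 < (I.port j).1 ∧ (I.site i).2 < (I.port j').2) := by
  have g := I.site_general i i' hi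
  have p := I.port_mem j
  have p' := I.port_mem j'
  rw [h] at p
  rw [h'] at p'
  simp only [Side.edge, Set.mem_ofPred_eq] at p p'
  have s := I.site_mem i
  have s' := I.site_mem i'
  have q1 := (I.port_general i' j).1
  have q2 := (I.port_general i j').2
  rw [Set.disjoint_left]
  simp only [I.mem_leader_top h, I.mem_leader_right h']
  constructor
  · intro hd
    refine ⟨fun h1 => ?_, fun h1 => ?_⟩
    · exact hd (a := ((I.site i').1, (I.site i).2)) (Or.inl ⟨rfl, h1.1⟩) (Or.inl ⟨rfl, h1.2⟩)
    · exact hd (a := ((I.port j).1, (I.port j').2)) (Or.inr ⟨rfl, p'.2.2, h1.2.le⟩)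
        (Or.inr ⟨rfl, p.2.1, h1.1.le⟩)
  · rintro ⟨h1, h2⟩ z (⟨a1, a2⟩ | ⟨a1, a2, a3⟩) (⟨b1, b2⟩ | ⟨b1, b2, b3⟩)
    · exact h1 ⟨b1 ▸ a2, a1 ▸ b2⟩
    · exact q2 (a1.symm.trans b1)
    · exact q1 (b1.symm.trans a1)
    · rw [a1] at b3
      rw [b1] at a3
      exact h2 ⟨lt_of_le_of_ne b3 q1, lt_of_le_of_ne a3 q2⟩

theorem disjoint_left_right {i j i' j' : Fin n} (hi : i ≠ i')
    (h : I.side j = Side.left) (h' : I.side j' = Side.right) :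
    Disjoint (I.leaderOf i j) (I.leaderOf i' j') ↔
      ((I.site i').1 < (I.site i).1 → ¬ RBtw (I.site i).2 (I.port j').2 (I.port j).2 ∧
        ¬ RBtw (I.site i').2 (I.port j).2 (I.port j').2) := by
  have g := (I.site_general i i' hi).1
  have p := I.port_mem j
  have p' := I.port_mem j'
  rw [h] at p
  rw [h'] at p'
  simp only [Side.edge, Set.mem_ofPred_eq] at p p'
  have s := I.site_mem i
  have s' := I.site_mem i'
  rw [Set.disjoint_left]
  simp only [I.mem_leader_left h, I.mem_leader_right h']
  constructor
  · intro hd h0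
    refine ⟨fun h1 => ?_, fun h1 => ?_⟩
    · exact hd (a := ((I.site i).1, (I.port j').2)) (Or.inl ⟨rfl, h1⟩)
        (Or.inr ⟨rfl, s.2.1, h0.le⟩)
    · exact hd (a := ((I.site i').1, (I.port j).2)) (Or.inr ⟨rfl, s'.1, h0.le⟩)
        (Or.inl ⟨rfl, h1⟩)
  · rintro h1 z (⟨a1, a2⟩ | ⟨a1, a2, a3⟩) (⟨b1, b2⟩ | ⟨b1, b2, b3⟩)
    · exact g (a1.symm.trans b1)
    · exact (h1 (by rw [a1] at b3; exact lt_of_le_of_ne b3 g.symm)).1 (b1 ▸ a2)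
    · exact (h1 (by rw [b1] at a3; exact lt_of_le_of_ne a3 g.symm)).2 (a1 ▸ b2)
    -- A left and a right port may have the same height. If the horizontal parts then overlap, the
    -- common height is an end point of the vertical segment of site `i`, so the first clause
    -- already excludes this.
    · refine (h1 (lt_of_le_of_ne (b3.trans a3) g.symm)).1 ?_
      have hh : (I.port j').2 = (I.port j).2 := b1.symm.trans a1
      rw [hh]
      unfold RBtw
      rcases le_total (I.site i).2 (I.port j).2 with h | h
      · exact Or.inl ⟨h, le_rfl⟩
      · exact Or.inr ⟨le_rfl, h⟩

/-- Ranks preserve the order, and reversing the ordinates does not affect betweenness. `NC` looks at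
a pair from one side only, so the converse uses it for both orders of the pair. -/
theorem isPlanarSolution_iff (m : Fin n ≃ Fin n) : I.IsPlanarSolution m ↔ I.disc.Planar m := by
  constructor
  · intro h i i' hne
    have hd := h i i' hne
    have hj : m i ≠ m i' := fun hh => hne (m.injective hh)
    constructor <;> intro h1 h2
    · rw [disc_side] at h1 h2
      have := (I.disjoint_left_left hne hj h1 h2).1 hd
      simp only [I.disc_P_left h1, I.disc_P_left h2, disc_X, disc_Y, rank_lt_iff, btw_rank]
      simp only [gx_inl, gy_inl, gy_inr, rbtw_neg]
      exact this.1
    · rw [disc_side] at h1 h2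
      have := (I.disjoint_right_right hne hj h1 h2).1 hd
      simp only [I.disc_P_right h1, I.disc_P_right h2, disc_X, disc_Y, rank_lt_iff, btw_rank]
      simp only [gx_inl, gy_inl, gy_inr, rbtw_neg]
      exact this.1
    · rw [disc_side] at h1 h2
      have := (I.disjoint_top_top hne hj h1 h2).1 hd
      simp only [I.disc_P_top h1, I.disc_P_top h2, disc_X, disc_Y, rank_lt_iff, btw_rank]
      simp only [gx_inl, gx_inr, gy_inl, neg_lt_neg_iff]
      exact this.1
    · rw [disc_side] at h1 h2
      have := (I.disjoint_top_left hne h1 h2).1 hd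
      simp only [I.disc_P_top h1, I.disc_P_left h2, disc_X, disc_Y, rank_lt_iff, btw_rank]
      simpa only [gx_inl, gx_inr, gy_inl, gy_inr, rbtw_neg, neg_lt_neg_iff] using this
    · rw [disc_side] at h1 h2
      have := (I.disjoint_top_right hne h1 h2).1 hd
      simp only [I.disc_P_top h1, I.disc_P_right h2, disc_X, disc_Y, rank_lt_iff, btw_rank]
      simpa only [gx_inl, gx_inr, gy_inl, gy_inr, rbtw_neg, neg_lt_neg_iff] using this
    · rw [disc_side] at h1 h2
      have := (I.disjoint_left_right hne h1 h2).1 hd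
      simp only [I.disc_P_left h1, I.disc_P_right h2, disc_X, disc_Y, rank_lt_iff, btw_rank]
      simpa only [gx_inl, gx_inr, gy_inl, gy_inr, rbtw_neg, neg_lt_neg_iff] using this
  · intro h
    have key : ∀ i i', i ≠ i' → I.side (m i) = Side.top → I.side (m i') ≠ Side.top →
        Disjoint (I.leaderOf i (m i)) (I.leaderOf i' (m i')) := by
      intro i i' hne h1 h2
      rcases h2' : I.side (m i') with _ | _ | _
      · rw [I.disjoint_top_left hne h1 h2']
        have := (h i i' hne).tl h1 h2'
        simp only [I.disc_P_top h1, I.disc_P_left h2', disc_X, disc_Y, rank_lt_iff, btw_rank] at this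
        simpa only [gx_inl, gx_inr, gy_inl, gy_inr, rbtw_neg, neg_lt_neg_iff] using this
      · exact absurd h2' h2
      · rw [I.disjoint_top_right hne h1 h2']
        have := (h i i' hne).tr h1 h2'
        simp only [I.disc_P_top h1, I.disc_P_right h2', disc_X, disc_Y, rank_lt_iff, btw_rank] at this
        simpa only [gx_inl, gx_inr, gy_inl, gy_inr, rbtw_neg, neg_lt_neg_iff] using this
    have key2 : ∀ i i', i ≠ i' → I.side (m i) = Side.left → I.side (m i') = Side.right →
        Disjoint (I.leaderOf i (m i)) (I.leaderOf i' (m i')) := by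
      intro i i' hne h1 h2
      rw [I.disjoint_left_right hne h1 h2]
      have := (h i i' hne).lr h1 h2
      simp only [I.disc_P_left h1, I.disc_P_right h2, disc_X, disc_Y, rank_lt_iff, btw_rank] at this
      simpa only [gx_inl, gx_inr, gy_inl, gy_inr, rbtw_neg, neg_lt_neg_iff] using this
    intro i i' hne
    have hj : m i ≠ m i' := fun hh => hne (m.injective hh)
    rcases h1 : I.side (m i) with _ | _ | _ <;> rcases h2 : I.side (m i') with _ | _ | _
    · rw [I.disjoint_left_left hne hj h1 h2]
      have a1 := (h i i' hne).ll h1 h2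
      have a2 := (h i' i hne.symm).ll h2 h1
      simp only [I.disc_P_left h1, I.disc_P_left h2, disc_X, disc_Y, rank_lt_iff, btw_rank] at a1 a2
      simp only [gx_inl, gy_inl, gy_inr, rbtw_neg] at a1 a2
      exact ⟨a1, a2⟩
    · exact (key i' i hne.symm h2 (by simp [h1])).symm
    · exact key2 i i' hne h1 h2
    · exact key i i' hne h1 (by simp [h2])
    · rw [I.disjoint_top_top hne hj h1 h2]
      have a1 := (h i i' hne).tt h1 h2
      have a2 := (h i' i hne.symm).tt h2 h1
      simp only [I.disc_P_top h1, I.disc_P_top h2, disc_X, disc_Y, rank_lt_iff, btw_rank] at a1 a2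
      simp only [gx_inl, gx_inr, gy_inl, neg_lt_neg_iff] at a1 a2
      exact ⟨a1, a2⟩
    · exact key i i' hne h1 (by simp [h2])
    · exact (key2 i' i hne.symm h2 h1).symm
    · exact (key i' i hne.symm h2 (by simp [h1])).symm
    · rw [I.disjoint_right_right hne hj h1 h2]
      have a1 := (h i i' hne).rr h1 h2
      have a2 := (h i' i hne.symm).rr h2 h1
      simp only [I.disc_P_right h1, I.disc_P_right h2, disc_X, disc_Y, rank_lt_iff, btw_rank] at a1 a2
      simp only [gx_inl, gy_inl, gy_inr, rbtw_neg] at a1 a2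
      exact ⟨a1, a2⟩

end Instance
end BoundaryLabeling

/-! ### The recurrence for reachable columns -/

namespace BoundaryLabeling
namespace Disc

variable {n : ℕ} (D : Disc n)

/-- The number of sites in row `y` left of `x`. -/
noncomputable def hit (y x : ℕ) : ℕ := by
  classical exact if ∃ s, D.Y s = y ∧ D.X s < x then 1 else 0

theorem hit_eq_card (y x : ℕ) : by
    classical exact D.hit y x = (Finset.univ.filter fun s => D.Y s = y ∧ D.X s < x).card := by
  classical
  unfold hit
  split_ifs with h
  · obtain ⟨s, h1, h2⟩ := h
    symm
    rw [Finset.card_eq_one]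
    refine ⟨s, ?_⟩
    ext s'
    simp only [Finset.mem_filter, Finset.mem_univ, true_and, Finset.mem_singleton]
    constructor
    · exact fun h => D.injY (h.1.trans h1.symm)
    · rintro rfl
      exact ⟨h1, h2⟩
  · symm
    rw [Finset.card_eq_zero, Finset.filter_eq_empty_iff]
    rintro s - h1
    exact h ⟨s, h1⟩

theorem nw_zero (x : ℕ) : D.nw x 0 = 0 := by simp [nw, boxSites]

theorem nw_succ (x y : ℕ) : D.nw x (y + 1) = D.nw x y + D.hit y x := by
  classical
  rw [hit_eq_card]
  unfold nw
  rw [← Finset.card_union_of_disjoint]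
  · congr 1
    ext s
    simp only [boxSites, Finset.mem_union, Finset.mem_filter, Finset.mem_univ, true_and, and_true]
    omega
  · rw [Finset.disjoint_left]
    intro s
    simp only [boxSites, Finset.mem_filter, Finset.mem_univ, true_and]
    omega

theorem bb_zero (e : ℕ → ℕ) : D.bb e 0 = 0 := by simp [bb]

theorem bb_succ (e : ℕ → ℕ) (y : ℕ) : D.bb e (y + 1) = D.bb e y + D.hit y (e y) := by
  classical
  rw [hit_eq_card]
  unfold bb
  rw [← Finset.card_union_of_disjoint]
  · congr 1
    ext s
    simp only [Finset.mem_union, Finset.mem_filter, Finset.mem_univ, true_and]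
    constructor
    · rintro ⟨h1, h2⟩
      rcases Nat.lt_succ_iff_lt_or_eq.1 h1 with h | h
      · exact Or.inl ⟨h, h2⟩
      · exact Or.inr ⟨h, h ▸ h2⟩
    · rintro (⟨h1, h2⟩ | ⟨h1, h2⟩)
      · exact ⟨by omega, h2⟩
      · exact ⟨by omega, h1.symm ▸ h2⟩
  · rw [Finset.disjoint_left]
    intro s
    simp only [Finset.mem_filter, Finset.mem_univ, true_and]
    omega

theorem bb_congr {e e' : ℕ → ℕ} {y : ℕ} (h : ∀ r, r < y → e r = e' r) : D.bb e y = D.bb e' y := by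
  induction y with
  | zero => simp [bb_zero]
  | succ y ih => rw [bb_succ, bb_succ, ih fun r hr => h r (by omega), h y (by omega)]

theorem nw_le (x y : ℕ) : D.nw x y ≤ n := by
  unfold nw
  exact (Finset.card_le_univ _).trans (by simp)

theorem tp_le (x : ℕ) : D.tp x ≤ n := by
  unfold tp
  exact (Finset.card_le_univ _).trans (by simp)

theorem lp_le (x : ℕ) : D.lp x ≤ n := by
  unfold lp
  exact (Finset.card_le_univ _).trans (by simp)

/-- An admissible path through the rows above `y` with `b` sites on the left can reach the
column `x`. -/
def Reach (xt y x b : ℕ) : Prop :=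
  ∃ e, D.Chain xt y e ∧ D.bb e y = b ∧ ∀ r, r < y → e r ≤ x

theorem reach_zero (xt x b : ℕ) : D.Reach xt 0 x b ↔ b = 0 := by
  constructor
  · rintro ⟨e, -, h, -⟩
    rw [← h, bb_zero]
  · rintro rfl
    exact ⟨fun _ => 0, ⟨fun _ _ _ h => absurd h (by omega), fun _ h => absurd h (by omega),
      fun _ h => absurd h (by omega), fun _ h => absurd h (by omega)⟩, bb_zero _ _,
      fun _ h => absurd h (by omega)⟩

theorem Chain.of_le {D : Disc n} {xt y y' : ℕ} {e : ℕ → ℕ} (h : D.Chain xt y e) (hy : y' ≤ y) :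
    D.Chain xt y' e :=
  ⟨fun r r' h1 h2 => h.mono r r' h1 (h2.trans_le hy), fun r h1 => h.le r (h1.trans_le hy),
    fun r h1 => h.tg r (h1.trans_le hy), fun r h1 => h.lg r (h1.trans_le hy)⟩

theorem Chain.congr {D : Disc n} {xt y : ℕ} {e e' : ℕ → ℕ} (h : D.Chain xt y e)
    (hee : ∀ r, r < y → e r = e' r) : D.Chain xt y e' := by
  refine ⟨fun r r' h1 h2 => ?_, fun r h1 => ?_, fun r h1 => ?_, fun r h1 => ?_⟩
  · rw [← hee r (by omega), ← hee r' h2]; exact h.mono r r' h1 h2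
  · rw [← hee r h1]; exact h.le r h1
  · rw [← hee r h1, ← D.bb_congr fun r' hr' => hee r' (by omega)]; exact h.tg r h1
  · rw [← hee r h1, ← D.bb_congr fun r' hr' => hee r' (by omega)]; exact h.lg r h1

/-- All that matters of the first `y` rows is that their columns are at most `x₀` and how many sites
they leave on the left. Both conditions on the new row depend only on `x₀` and this number. -/
theorem reach_succ (xt y x b : ℕ) : D.Reach xt (y + 1) x b ↔ ∃ x₀ ≤ x, x₀ ≤ xt ∧
    D.hit y x₀ ≤ b ∧ D.Reach xt y x₀ (b - D.hit y x₀) ∧ D.TG xt x₀ y (b - D.hit y x₀) ∧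
    D.LG x₀ (y + 1) b := by
  constructor
  · rintro ⟨e, h1, h2, h3⟩
    rw [bb_succ] at h2
    have h4 : b - D.hit y (e y) = D.bb e y := by omega
    refine ⟨e y, h3 y (by omega), h1.le y (by omega), by omega, ?_, ?_, ?_⟩
    · exact ⟨e, h1.of_le (by omega), h4.symm, fun r hr => h1.mono r y hr.le (by omega)⟩
    · rw [h4]; exact h1.tg y (by omega)
    · have := h1.lg y (by omega)
      rwa [bb_succ, h2] at this
  · rintro ⟨x₀, h1, h2, h3, ⟨e, h4, h5, h6⟩, h7, h8⟩
    let e' : ℕ → ℕ := fun r => if r < y then e r else x₀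
    have hlt : ∀ r, r < y → e r = e' r := fun r hr => by simp [e', hr]
    have hy : e' y = x₀ := by simp [e']
    have hb : D.bb e' y = b - D.hit y x₀ := by rw [← D.bb_congr hlt, h5]
    have hb' : D.bb e' (y + 1) = b := by rw [bb_succ, hb, hy]; omega
    have hc := h4.congr hlt
    refine ⟨e', ⟨?_, ?_, ?_, ?_⟩, hb', ?_⟩
    · intro r r' g1 g2
      rcases Nat.lt_succ_iff_lt_or_eq.1 g2 with g | g
      · exact hc.mono r r' g1 g
      · subst g
        rcases Nat.lt_or_ge r r' with g3 | g3
        · rw [hy, ← hlt r g3]; exact h6 r g3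
        · rw [le_antisymm g1 g3]
    · intro r g
      rcases Nat.lt_succ_iff_lt_or_eq.1 g with g | rfl
      · exact hc.le r g
      · rw [hy]; exact h2
    · intro r g
      rcases Nat.lt_succ_iff_lt_or_eq.1 g with g | rfl
      · exact hc.tg r g
      · rw [hy, hb]; exact h7
    · intro r g
      rcases Nat.lt_succ_iff_lt_or_eq.1 g with g | rfl
      · exact hc.lg r g
      · rw [hy, hb']; exact h8
    · intro r g
      rcases Nat.lt_succ_iff_lt_or_eq.1 g with g | rfl
      · rw [← hlt r g]; exact (h6 r g).trans h1
      · rw [hy]; exact h1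

/-- The condition on the number of top ports determines the number of sites left of a complete path,
so only one entry of the table has to be inspected. -/
theorem exists_full_iff (xt y₀ : ℕ) : (∃ e, D.Full xt y₀ e) ↔
    D.tp xt ≤ D.nw xt y₀ ∧ D.Reach xt y₀ xt (D.nw xt y₀ - D.tp xt) ∧
    D.LG xt y₀ (D.nw xt y₀ - D.tp xt) := by
  constructor
  · rintro ⟨e, h⟩
    have h1 := h.count
    have h2 : D.nw xt y₀ - D.tp xt = D.bb e y₀ := by omega
    rw [h2]
    exact ⟨by omega, ⟨e, h.toChain, rfl, h.le⟩, h.lg_end⟩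
  · rintro ⟨h1, ⟨e, h2, h3, h4⟩, h5⟩
    exact ⟨e, h2, by omega, h3 ▸ h5⟩

/-- The initial part of a path can be exchanged. -/
theorem Full.exchange {D : Disc n} {xt y₀ y x : ℕ} {e : ℕ → ℕ} (h : D.Full xt y₀ e)
    (hy : y < y₀) (hr : D.Reach xt (y + 1) x (D.bb e (y + 1))) (hx : x ≤ e y)
    (hmin : ∀ x', x' < x → ¬ D.Reach xt (y + 1) x' (D.bb e (y + 1))) :
    ∃ e', D.Full xt y₀ e' ∧ e' y = x ∧ (∀ r, y < r → e' r = e r) ∧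
      D.bb e' (y + 1) = D.bb e (y + 1) := by
  obtain ⟨e₁, h1, h2, h3⟩ := hr
  let e' : ℕ → ℕ := fun r => if r < y + 1 then e₁ r else e r
  have hlt : ∀ r, r < y + 1 → e₁ r = e' r := fun r hr => (if_pos hr).symm
  have hge : ∀ r, y < r → e' r = e r := fun r hr => by
    have : ¬ r < y + 1 := by omega
    exact if_neg this
  -- Both initial parts leave the same number of sites on the left, so the conditions in all later
  -- rows are unchanged.
  have hb : ∀ k, D.bb e' (y + 1 + k) = D.bb e (y + 1 + k) := by
    intro k
    induction k with
    | zero => rw [← D.bb_congr hlt]; exact h2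
    | succ k ih => rw [← add_assoc, bb_succ, bb_succ, ih, hge _ (by omega)]
  have hb' : ∀ z, y < z → D.bb e' z = D.bb e z := fun z hz => by
    obtain ⟨k, rfl⟩ := Nat.exists_eq_add_of_le (Nat.succ_le_of_lt hz)
    exact hb k
  have hc := h1.congr hlt
  -- If the new initial part ended left of `x`, it would reach a smaller column, against the
  -- minimality of `x`.
  have hyx : e' y = x := by
    rw [← hlt y (by omega)]
    refine le_antisymm (h3 y (by omega)) ?_
    by_contra hlt
    exact hmin _ (not_le.1 hlt) ⟨e₁, h1, h2, fun r hr => h1.mono r y (by omega) (by omega)⟩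
  refine ⟨e', ⟨⟨?_, ?_, ?_, ?_⟩, ?_, ?_⟩, hyx, hge, hb' _ (by omega)⟩
  · intro r r' g1 g2
    rcases Nat.lt_or_ge r' (y + 1) with g3 | g3
    · exact hc.mono r r' g1 g3
    · rcases Nat.lt_or_ge r (y + 1) with g4 | g4
      · calc e' r ≤ e' y := hc.mono r y (by omega) (by omega)
          _ ≤ e y := hyx ▸ hx
          _ ≤ e r' := h.mono _ _ (by omega) g2
          _ = e' r' := (hge r' (by omega)).symm
      · rw [hge r (by omega), hge r' (by omega)]; exact h.mono _ _ g1 g2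
  · intro r g
    rcases Nat.lt_or_ge r (y + 1) with g3 | g3
    · exact hc.le r g3
    · rw [hge r (by omega)]; exact h.le r g
  · intro r g
    rcases Nat.lt_or_ge r (y + 1) with g3 | g3
    · exact hc.tg r g3
    · rw [hge r (by omega), hb' r (by omega)]; exact h.tg r g
  · intro r g
    rcases Nat.lt_or_ge r (y + 1) with g3 | g3
    · exact hc.lg r g3
    · rw [hge r (by omega), hb' (r + 1) (by omega)]; exact h.lg r g
  · rw [hb' y₀ hy]; exact h.count
  · rw [hb' y₀ hy]; exact h.lg_end

end Disc
end BoundaryLabeling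

/-! ### A language with total expressions and loops of fixed length -/

namespace BoundaryLabeling

/-- Expressions over named registers and arrays. Sums are reduced modulo `4 * n + 8`, and indices
of input data modulo the length of the input, so that every expression can be evaluated. -/
inductive Ex (ρ α : Type) where
  | const (k : Fin 8)
  | size
  | reg (r : ρ)
  | arr (a : α) (e : Ex ρ α)
  | word (e : Ex ρ α)
  | add (e f : Ex ρ α)
  | sub (e f : Ex ρ α)
  | lt (e f : Ex ρ α)
  | eq (e f : Ex ρ α)
  | ltR (e f : Ex ρ α)

/-- Commands whose loops run through the numbers below `2 * n + 2`. -/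
inductive Pr (ρ α : Type) where
  | skip
  | set (r : ρ) (e : Ex ρ α)
  | put (a : α) (e f : Ex ρ α)
  | seq (c d : Pr ρ α)
  | ite (e : Ex ρ α) (c d : Pr ρ α)
  | rep (r : ρ) (c : Pr ρ α)

/-- The contents of registers and arrays. -/
structure St (ρ α : Type) where
  reg : ρ → ℕ
  arr : α → ℕ → ℕ

namespace St

variable {ρ α : Type} [DecidableEq ρ] [DecidableEq α]

/-- Write a register. -/
def set (σ : St ρ α) (r : ρ) (x : ℕ) : St ρ α := ⟨Function.update σ.reg r x, σ.arr⟩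

/-- Write an array cell. -/
def put (σ : St ρ α) (a : α) (i x : ℕ) : St ρ α :=
  ⟨σ.reg, Function.update σ.arr a (Function.update (σ.arr a) i x)⟩

omit [DecidableEq α] in
@[simp] theorem set_reg (σ : St ρ α) (r r' : ρ) (x : ℕ) :
    (σ.set r x).reg r' = if r' = r then x else σ.reg r' := by
  simp [set, Function.update_apply]

omit [DecidableEq α] in
@[simp] theorem set_arr (σ : St ρ α) (r : ρ) (x : ℕ) : (σ.set r x).arr = σ.arr := rfl

omit [DecidableEq ρ] in
@[simp] theorem put_reg (σ : St ρ α) (a : α) (i x : ℕ) : (σ.put a i x).reg = σ.reg := rfl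

omit [DecidableEq ρ] in
@[simp] theorem put_arr (σ : St ρ α) (a a' : α) (i i' x : ℕ) :
    (σ.put a i x).arr a' i' = if a' = a ∧ i' = i then x else σ.arr a' i' := by
  by_cases h : a' = a
  · subst h
    simp [put, Function.update_apply]
  · simp [put, h]

/-- All cells hold numbers below `B`. -/
def Bdd (σ : St ρ α) (B : ℕ) : Prop := (∀ r, σ.reg r < B) ∧ ∀ a i, σ.arr a i < B

omit [DecidableEq α] in
theorem Bdd.set {σ : St ρ α} {B : ℕ} (h : σ.Bdd B) (r : ρ) {x : ℕ} (hx : x < B) :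
    (σ.set r x).Bdd B := by
  refine ⟨fun r' => ?_, fun a i => ?_⟩
  · rw [set_reg]; split_ifs <;> [exact hx; exact h.1 r']
  · rw [set_arr]; exact h.2 a i

omit [DecidableEq ρ] in
theorem Bdd.put {σ : St ρ α} {B : ℕ} (h : σ.Bdd B) (a : α) (i : ℕ) {x : ℕ} (hx : x < B) :
    (σ.put a i x).Bdd B := by
  refine ⟨fun r' => ?_, fun a' i' => ?_⟩
  · rw [put_reg]; exact h.1 r'
  · rw [put_arr]; split_ifs <;> [exact hx; exact h.2 a' i']

end St

section semantics

variable {ρ α : Type} [DecidableEq ρ] [DecidableEq α] {n : ℕ} (I : Instance n)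

open Classical in
/-- The value of an expression. -/
noncomputable def Ex.ev (σ : St ρ α) : Ex ρ α → ℕ
  | const k => k
  | size => n
  | reg r => σ.reg r
  | arr a e => σ.arr a (e.ev σ)
  | word e => I.input.words.getD (e.ev σ % (n + 1)) 0
  | add e f => (e.ev σ + f.ev σ) % (4 * n + 8)
  | sub e f => e.ev σ - f.ev σ
  | lt e f => if e.ev σ < f.ev σ then 1 else 0
  | eq e f => if e.ev σ = f.ev σ then 1 else 0
  | ltR e f => if I.input.reals.getD (e.ev σ % (4 * n + 2)) 0 <
      I.input.reals.getD (f.ev σ % (4 * n + 2)) 0 then 1 else 0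

/-- The result of `k` rounds of a loop. -/
def Pr.iter (r : ρ) (f : St ρ α → St ρ α) (σ : St ρ α) : ℕ → St ρ α
  | 0 => σ.set r 0
  | k + 1 => (f (iter r f σ k)).set r (k + 1)

/-- The result of a command. -/
noncomputable def Pr.run : Pr ρ α → St ρ α → St ρ α
  | skip, σ => σ
  | set r e, σ => σ.set r (e.ev I σ)
  | put a e f, σ => σ.put a (e.ev I σ) (f.ev I σ)
  | seq c d, σ => d.run (c.run σ)
  | ite e c d, σ => if e.ev I σ ≠ 0 then c.run σ else d.run σ
  | .rep r c, σ => Pr.iter r c.run σ (2 * n + 2)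

/-- The command may write the register `r`. -/
def Pr.writesR : Pr ρ α → ρ → Bool
  | skip, _ => false
  | set r' _, r => decide (r' = r)
  | put _ _ _, _ => false
  | seq c d, r => c.writesR r || d.writesR r
  | ite _ c d, r => c.writesR r || d.writesR r
  | .rep r' c, r => decide (r' = r) || c.writesR r

/-- The command may write the array `a`. -/
def Pr.writesA : Pr ρ α → α → Bool
  | skip, _ => false
  | set _ _, _ => false
  | put a' _ _, a => decide (a' = a)
  | seq c d, a => c.writesA a || d.writesA a
  | ite _ c d, a => c.writesA a || d.writesA a
  | .rep _ c, a => c.writesA a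

/-- No loop changes its own counter. -/
def Pr.wf : Pr ρ α → Bool
  | seq c d => c.wf && d.wf
  | ite _ c d => c.wf && d.wf
  | .rep r c => c.wf && !c.writesR r
  | _ => true

/-- The stores agree on all cells that the command does not write. -/
structure Agree (c : Pr ρ α) (σ τ : St ρ α) : Prop where
  reg : ∀ r, c.writesR r = false → τ.reg r = σ.reg r
  arr : ∀ a, c.writesA a = false → τ.arr a = σ.arr a

theorem iter_agree {c : Pr ρ α} (ih : ∀ σ, Agree c σ (c.run I σ)) (r : ρ) (σ : St ρ α) (k : ℕ) :
    Agree (.rep r c) σ (Pr.iter r (c.run I) σ k) := by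
  induction k with
  | zero =>
    refine ⟨fun r' h => ?_, fun a _ => rfl⟩
    simp only [Pr.writesR, Bool.or_eq_false_iff, decide_eq_false_iff_not] at h
    simp only [Pr.iter, St.set_reg]
    rw [if_neg (Ne.symm h.1)]
  | succ k hk =>
    refine ⟨fun r' h => ?_, fun a h => ?_⟩
    · have h' := h
      simp only [Pr.writesR, Bool.or_eq_false_iff, decide_eq_false_iff_not] at h
      simp only [Pr.iter, St.set_reg]
      rw [if_neg (Ne.symm h.1), (ih _).reg r' h.2, hk.reg r' h']
    · have h' := h
      simp only [Pr.writesA] at h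
      simp only [Pr.iter, St.set_arr]
      rw [(ih _).arr a h, hk.arr a h']

theorem run_agree (c : Pr ρ α) (σ : St ρ α) : Agree c σ (c.run I σ) := by
  induction c generalizing σ with
  | skip => exact ⟨fun _ _ => rfl, fun _ _ => rfl⟩
  | set r e =>
    refine ⟨fun r' h => ?_, fun _ _ => rfl⟩
    simp only [Pr.writesR, decide_eq_false_iff_not] at h
    simp only [Pr.run, St.set_reg]
    rw [if_neg (Ne.symm h)]
  | put a e f =>
    refine ⟨fun _ _ => rfl, fun a' h => ?_⟩
    simp only [Pr.writesA, decide_eq_false_iff_not] at h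
    funext i
    simp only [Pr.run, St.put_arr]
    rw [if_neg (fun hh => h hh.1.symm)]
  | seq c d hc hd =>
    refine ⟨fun r h => ?_, fun a h => ?_⟩
    · simp only [Pr.writesR, Bool.or_eq_false_iff] at h
      simp only [Pr.run]
      rw [(hd _).reg r h.2, (hc _).reg r h.1]
    · simp only [Pr.writesA, Bool.or_eq_false_iff] at h
      simp only [Pr.run]
      rw [(hd _).arr a h.2, (hc _).arr a h.1]
  | ite e c d hc hd =>
    refine ⟨fun r h => ?_, fun a h => ?_⟩
    · simp only [Pr.writesR, Bool.or_eq_false_iff] at h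
      simp only [Pr.run]
      split_ifs <;> [exact (hc _).reg r h.1; exact (hd _).reg r h.2]
    · simp only [Pr.writesA, Bool.or_eq_false_iff] at h
      simp only [Pr.run]
      split_ifs <;> [exact (hc _).arr a h.1; exact (hd _).arr a h.2]
  | rep r c hc => exact iter_agree I hc r σ _

/-- Induction along a loop. -/
theorem run_for {c : Pr ρ α} {r : ρ} (P : ℕ → St ρ α → Prop)
    {σ : St ρ α} (h0 : P 0 (σ.set r 0))
    (hs : ∀ k τ, k < 2 * n + 2 → Agree (.rep r c) σ τ → τ.reg r = k → P k τ →
      P (k + 1) ((c.run I τ).set r (k + 1))) : P (2 * n + 2) ((Pr.rep r c).run I σ) := by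
  suffices h : ∀ k ≤ 2 * n + 2, P k (Pr.iter r (c.run I) σ k) from h _ le_rfl
  intro k hk
  induction k with
  | zero => exact h0
  | succ k ih =>
    refine hs k _ (by omega) (iter_agree I (run_agree I c) r σ k) ?_ (ih (by omega))
    cases k <;> simp [Pr.iter]

end semantics

end BoundaryLabeling

/-! ### Translation to the machine -/

namespace BoundaryLabeling

section compile

variable {ρ α : Type} [Fintype ρ] [Fintype α]

/-- `Fin`-indexed registers. -/
noncomputable abbrev regIx (ρ : Type) [Fintype ρ] : ρ ≃ Fin (Fintype.card ρ) := Fintype.equivFin ρ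

/-- The store of the machine. -/
noncomputable def St.enc (σ : St ρ α) : Store (Fintype.card ρ) (Fintype.card α) :=
  ⟨fun r => σ.reg ((regIx ρ).symm r), fun a => σ.arr ((regIx α).symm a)⟩

theorem enc_set [DecidableEq ρ] (σ : St ρ α) (r : ρ) (x : ℕ) :
    (σ.set r x).enc = σ.enc.setReg (regIx ρ r) x := by
  unfold St.enc Store.setReg St.set
  congr 1
  funext r'
  simp only [Function.update_apply, Equiv.symm_apply_eq]

theorem enc_put [DecidableEq α] (σ : St ρ α) (a : α) (i x : ℕ) :
    (σ.put a i x).enc = σ.enc.setArr (regIx α a) i x := by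
  unfold St.enc Store.setArr St.put
  congr 1
  funext a'
  simp only [Function.update_apply, Equiv.symm_apply_eq, Equiv.symm_apply_apply]

variable {V K : ℕ}

/-- The number of sites. -/
def sizeE : Expr V K := .word (.const 0)

/-- The remainder. -/
def modE (e m : Expr V K) : Expr V K := .op .sub e (.op .mul (.op .div e m) m)

/-- Translation of expressions. -/
noncomputable def Ex.comp : Ex ρ α → Expr (Fintype.card ρ) (Fintype.card α)
  | const k => .const k
  | size => sizeE
  | reg r => .reg (regIx ρ r)
  | arr a e => .arr (regIx α a) e.comp
  | word e => .word (modE e.comp (.op .add sizeE (.const 1)))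
  | add e f => modE (.op .add e.comp f.comp) (.op .mul (.const 4) (.op .add sizeE (.const 2)))
  | sub e f => .op .sub e.comp f.comp
  | lt e f => .op .lt e.comp f.comp
  | eq e f => .op .eq e.comp f.comp
  | ltR e f => .ltReal (modE e.comp (.op .add (.op .mul (.const 4) sizeE) (.const 2)))
      (modE f.comp (.op .add (.op .mul (.const 4) sizeE) (.const 2)))

/-- Translation of commands. -/
noncomputable def Pr.comp : Pr ρ α → Cmd (Fintype.card ρ) (Fintype.card α)
  | skip => .skip
  | set r e => .setReg (regIx ρ r) e.comp
  | put a e f => .setArr (regIx α a) e.comp f.comp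
  | seq c d => .seq c.comp d.comp
  | ite e c d => .ite e.comp c.comp d.comp
  | .rep r c => .seq (.setReg (regIx ρ r) (.const 0))
      (.loop (.op .lt (.reg (regIx ρ r)) (.op .add (.op .add sizeE sizeE) (.const 2)))
        (.seq c.comp (.setReg (regIx ρ r) (.op .add (.reg (regIx ρ r)) (.const 1)))))

/-- A bound for the number of steps outside of loops. -/
noncomputable def Pr.size : Pr ρ α → ℕ
  | skip => 1
  | set _ e => e.comp.cost + 1
  | put _ e f => e.comp.cost + f.comp.cost + 1
  | seq c d => c.size + d.size
  | ite e c d => e.comp.cost + 1 + c.size + d.size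
  | .rep _ c => c.size + 20

/-- The depth of nested loops. -/
def Pr.depth : Pr ρ α → ℕ
  | skip => 0
  | set _ _ => 0
  | put _ _ _ => 0
  | seq c d => max c.depth d.depth
  | ite _ c d => max c.depth d.depth
  | .rep _ c => c.depth + 1

end compile

section correctness

variable {n : ℕ} (I : Instance n)

/-- The machine on which the instance is solved. -/
def mach : Machine := ⟨I.input, (n + 2) ^ 10, 4 * n + 8⟩

/-- Values of expressions stay below `4 * n + 8`; the bound leaves room for the sum of two of them
before it is reduced. The factor 16 is at most `(n + 2) ^ 4`, so the exponent 10 is generous. -/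
theorem mach_bound : 16 * (n + 2) ≤ (mach I).bound := by
  change 16 * (n + 2) ≤ (n + 2) ^ 10
  have h1 : 2 ^ 4 ≤ (n + 2) ^ 9 :=
    (Nat.pow_le_pow_right (by norm_num) (by norm_num)).trans
      (Nat.pow_le_pow_left (show 2 ≤ n + 2 by omega) 9)
  calc 16 * (n + 2) ≤ (n + 2) ^ 9 * (n + 2) := Nat.mul_le_mul_right _ h1
    _ = (n + 2) ^ 10 := (pow_succ _ _).symm

theorem words_length : I.input.words.length = n + 1 := by simp [Instance.input]

theorem reals_length : I.input.reals.length = 4 * n + 2 := by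
  simp [Instance.input]; ring

theorem words_lt (k : ℕ) : I.input.words.getD k 0 < 4 * n + 8 := by
  unfold Instance.input
  rcases k with _ | k
  · simp; omega
  · simp only [List.getD_cons_succ]
    rw [List.getD_eq_getElem?_getD, List.getElem?_ofFn]
    split_ifs with h
    · simp only [Option.getD_some]
      cases I.side ⟨k, h⟩ <;> simp [Side.code]
    · simp

variable {V K : ℕ} {M : Machine} {σ : Store V K}

theorem modE_val (e m : Expr V K) : (modE e m).val M σ = e.val M σ % m.val M σ := by
  simp only [modE, Expr.val, Op.eval]
  have := Nat.div_add_mod' (e.val M σ) (m.val M σ)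
  omega

/-- The quotient and its product with the divisor do not exceed the dividend, so no intermediate
result leaves the range of words. -/
theorem modE_safe {e m : Expr V K} (he : e.Safe M σ) (hm : m.Safe M σ)
    (hb : e.val M σ < M.bound) : (modE e m).Safe M σ := by
  simp only [modE, Expr.Safe, Expr.val, Op.eval]
  have h1 := Nat.div_add_mod' (e.val M σ) (m.val M σ)
  have h2 := Nat.div_le_self (e.val M σ) (m.val M σ)
  exact ⟨he, ⟨⟨he, hm, by omega⟩, hm, by omega⟩, by omega⟩

theorem sizeE_val {σ : Store V K} : (sizeE : Expr V K).val (mach I) σ = n := by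
  simp [sizeE, Expr.val, mach, Instance.input]

theorem sizeE_safe {σ : Store V K} : (sizeE : Expr V K).Safe (mach I) σ := by
  have := mach_bound I
  have h2 := words_lt I 0
  have h3 := words_length I
  refine ⟨?_, ?_, ?_⟩
  · change 0 < _; omega
  · change 0 < I.input.words.length; omega
  · change I.input.words.getD 0 0 < _; omega

variable {ρ α : Type} [Fintype ρ] [Fintype α] [DecidableEq ρ] [DecidableEq α]

-- The bound `4 * n + 8` is preserved because sums are reduced, differences do not grow, comparisons
-- give 0 or 1, and the input words are small. Since it is also the length of the arrays, every
-- index is in range; from here on safety plays no role in the correctness proof.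
omit [DecidableEq ρ] [DecidableEq α] in
theorem Ex.comp_spec (σ : St ρ α) (hσ : σ.Bdd (4 * n + 8)) (e : Ex ρ α) :
    e.comp.Safe (mach I) σ.enc ∧ e.comp.val (mach I) σ.enc = e.ev I σ ∧
      e.ev I σ < 4 * n + 8 := by
  classical
  have hb := mach_bound I
  have hs := sizeE_safe I (V := Fintype.card ρ) (K := Fintype.card α) (σ := σ.enc)
  have hv := sizeE_val I (V := Fintype.card ρ) (K := Fintype.card α) (σ := σ.enc)
  induction e with
  | const k =>
    have := k.2
    refine ⟨?_, rfl, ?_⟩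
    · change k.1 < _; omega
    · change k.1 < _; omega
  | size => exact ⟨hs, hv, by change n < _; omega⟩
  | reg r =>
    refine ⟨trivial, ?_, hσ.1 r⟩
    simp [Ex.comp, Expr.val, St.enc, Ex.ev]
  | arr a e ih =>
    obtain ⟨h1, h2, h3⟩ := ih
    refine ⟨⟨h1, h2 ▸ h3⟩, ?_, hσ.2 _ _⟩
    simp [Ex.comp, Expr.val, St.enc, Ex.ev] at h2 ⊢
    rw [h2]
  | word e ih =>
    obtain ⟨h1, h2, h3⟩ := ih
    have hm : (Expr.op .add sizeE (.const 1) : Expr (Fintype.card ρ) (Fintype.card α)).Safe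
        (mach I) σ.enc := by
      refine ⟨hs, ?_, ?_⟩
      · change 1 < _; omega
      · simp only [Expr.val, Op.eval, hv]; omega
    have hmv : (Expr.op .add sizeE (.const 1) : Expr (Fintype.card ρ) (Fintype.card α)).val
        (mach I) σ.enc = n + 1 := by simp only [Expr.val, Op.eval, hv]
    have hw := words_lt I (e.ev I σ % (n + 1))
    refine ⟨⟨modE_safe h1 hm (by omega), ?_, ?_⟩, ?_, hw⟩
    · rw [modE_val, hmv, h2]
      change _ < I.input.words.length
      rw [words_length]
      exact Nat.mod_lt _ (by omega)
    · rw [modE_val, hmv, h2]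
      change I.input.words.getD _ _ < _
      omega
    · simp only [Ex.comp, Expr.val, modE_val, Ex.ev]
      rw [h2]
      simp only [Op.eval, hv]
      rfl
  | add e f ihe ihf =>
    obtain ⟨h1, h2, h3⟩ := ihe
    obtain ⟨g1, g2, g3⟩ := ihf
    have hm : (Expr.op .mul (.const 4) (.op .add sizeE (.const 2)) :
        Expr (Fintype.card ρ) (Fintype.card α)).Safe (mach I) σ.enc := by
      refine ⟨?_, ⟨hs, ?_, ?_⟩, ?_⟩
      · change 4 < _; omega
      · change 2 < _; omega
      · simp only [Expr.val, Op.eval, hv]; omega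
      · simp only [Expr.val, Op.eval, hv]; omega
    have hmv : (Expr.op .mul (.const 4) (.op .add sizeE (.const 2)) :
        Expr (Fintype.card ρ) (Fintype.card α)).val (mach I) σ.enc = 4 * n + 8 := by
      simp only [Expr.val, Op.eval, hv]; ring
    have hadd : (Expr.op .add e.comp f.comp).val (mach I) σ.enc = e.ev I σ + f.ev I σ := by
      simp only [Expr.val, Op.eval, h2, g2]
    have hlt : (Expr.op .add e.comp f.comp).val (mach I) σ.enc < (mach I).bound := by
      rw [hadd]; omega
    refine ⟨modE_safe ⟨h1, g1, hlt⟩ hm hlt, ?_, Nat.mod_lt _ (by omega)⟩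
    simp only [Ex.comp, modE_val, Ex.ev]
    rw [hmv, hadd]
  | sub e f ihe ihf =>
    obtain ⟨h1, h2, h3⟩ := ihe
    obtain ⟨g1, g2, g3⟩ := ihf
    refine ⟨⟨h1, g1, ?_⟩, ?_, ?_⟩
    · simp only [Op.eval]; omega
    · simp only [Ex.comp, Expr.val, Op.eval, h2, g2, Ex.ev]
    · simp only [Ex.ev]; omega
  | lt e f ihe ihf =>
    obtain ⟨h1, h2, h3⟩ := ihe
    obtain ⟨g1, g2, g3⟩ := ihf
    refine ⟨⟨h1, g1, ?_⟩, ?_, ?_⟩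
    · simp only [Op.eval]; split_ifs <;> omega
    · simp only [Ex.comp, Expr.val, Op.eval, h2, g2, Ex.ev]
    · simp only [Ex.ev]; split_ifs <;> omega
  | eq e f ihe ihf =>
    obtain ⟨h1, h2, h3⟩ := ihe
    obtain ⟨g1, g2, g3⟩ := ihf
    refine ⟨⟨h1, g1, ?_⟩, ?_, ?_⟩
    · simp only [Op.eval]; split_ifs <;> omega
    · simp only [Ex.comp, Expr.val, Op.eval, h2, g2, Ex.ev]
    · simp only [Ex.ev]; split_ifs <;> omega
  | ltR e f ihe ihf =>
    obtain ⟨h1, h2, h3⟩ := ihe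
    obtain ⟨g1, g2, g3⟩ := ihf
    have hm : (Expr.op .add (.op .mul (.const 4) sizeE) (.const 2) :
        Expr (Fintype.card ρ) (Fintype.card α)).Safe (mach I) σ.enc := by
      refine ⟨⟨?_, hs, ?_⟩, ?_, ?_⟩
      · change 4 < _; omega
      · simp only [Expr.val, Op.eval, hv]; omega
      · change 2 < _; omega
      · simp only [Expr.val, Op.eval, hv]; omega
    have hmv : (Expr.op .add (.op .mul (.const 4) sizeE) (.const 2) :
        Expr (Fintype.card ρ) (Fintype.card α)).val (mach I) σ.enc = 4 * n + 2 := by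
      simp only [Expr.val, Op.eval, hv]
    refine ⟨⟨modE_safe h1 hm (by omega), modE_safe g1 hm (by omega), ?_, ?_⟩, ?_, ?_⟩
    · rw [modE_val, hmv, h2]
      change _ < I.input.reals.length
      rw [reals_length]
      exact Nat.mod_lt _ (by omega)
    · rw [modE_val, hmv, g2]
      change _ < I.input.reals.length
      rw [reals_length]
      exact Nat.mod_lt _ (by omega)
    · simp only [Ex.comp, Expr.val, modE_val, Ex.ev]
      rw [h2, g2]
      simp only [Op.eval, hv]
      rfl
    · simp only [Ex.ev]; split_ifs <;> omega

/-- The machine executes the translation of a command. -/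
theorem Pr.exec (c : Pr ρ α) (hw : c.wf = true) (σ : St ρ α) (hσ : σ.Bdd (4 * n + 8)) :
    (c.run I σ).Bdd (4 * n + 8) ∧ ∃ t ≤ c.size * (2 * n + 3) ^ c.depth,
      Exec (mach I) c.comp σ.enc t (c.run I σ).enc := by
  have hb := mach_bound I
  induction c generalizing σ with
  | skip => exact ⟨hσ, 1, by simp [Pr.size, Pr.depth], Exec.skip _⟩
  | set r e =>
    obtain ⟨h1, h2, h3⟩ := Ex.comp_spec I σ hσ e
    refine ⟨hσ.set r h3, e.comp.cost + 1, by simp [Pr.size, Pr.depth], ?_⟩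
    · simp only [Pr.run]
      rw [enc_set, ← h2]
      exact Exec.setReg _ _ _ h1
  | put a e f =>
    obtain ⟨h1, h2, h3⟩ := Ex.comp_spec I σ hσ e
    obtain ⟨g1, g2, g3⟩ := Ex.comp_spec I σ hσ f
    refine ⟨hσ.put a _ g3, e.comp.cost + f.comp.cost + 1, by simp [Pr.size, Pr.depth], ?_⟩
    · simp only [Pr.run]
      rw [enc_put, ← h2, ← g2]
      exact Exec.setArr _ _ _ _ h1 g1 (h2 ▸ h3)
  | seq c d hc hd =>
    simp only [Pr.wf, Bool.and_eq_true] at hw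
    obtain ⟨h1, t, h2, h3⟩ := hc hw.1 σ hσ
    obtain ⟨g1, s, g2, g3⟩ := hd hw.2 _ h1
    refine ⟨g1, t + s, ?_, Exec.seq _ _ _ _ _ _ _ h3 g3⟩
    simp only [Pr.size, Pr.depth, add_mul]
    exact Nat.add_le_add
      (h2.trans (Nat.mul_le_mul_left _ (Nat.pow_le_pow_right (by omega) (le_max_left _ _))))
      (g2.trans (Nat.mul_le_mul_left _ (Nat.pow_le_pow_right (by omega) (le_max_right _ _))))
  | ite e c d hc hd =>
    simp only [Pr.wf, Bool.and_eq_true] at hw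
    obtain ⟨e1, e2, e3⟩ := Ex.comp_spec I σ hσ e
    have hpos : 1 ≤ (2 * n + 3) ^ max c.depth d.depth := Nat.one_le_pow _ _ (by omega)
    have hcost : e.comp.cost + 1 ≤ (e.comp.cost + 1) * (2 * n + 3) ^ max c.depth d.depth :=
      Nat.le_mul_of_pos_right _ hpos
    simp only [Pr.run]
    split_ifs with h
    · obtain ⟨h1, t, h2, h3⟩ := hc hw.1 σ hσ
      refine ⟨h1, _, ?_, Exec.ite_true _ _ _ _ _ _ e1 (e2 ▸ h) h3⟩
      have : t ≤ c.size * (2 * n + 3) ^ max c.depth d.depth :=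
        h2.trans (Nat.mul_le_mul_left _ (Nat.pow_le_pow_right (by omega) (le_max_left _ _)))
      simp only [Pr.size, Pr.depth, add_mul]
      rw [add_mul] at hcost
      omega
    · obtain ⟨h1, t, h2, h3⟩ := hd hw.2 σ hσ
      push Not at h
      refine ⟨h1, _, ?_, Exec.ite_false _ _ _ _ _ _ e1 (e2 ▸ h) h3⟩
      have : t ≤ d.size * (2 * n + 3) ^ max c.depth d.depth :=
        h2.trans (Nat.mul_le_mul_left _ (Nat.pow_le_pow_right (by omega) (le_max_right _ _)))
      simp only [Pr.size, Pr.depth, add_mul]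
      rw [add_mul] at hcost
      omega
  | rep r c hc =>
    simp only [Pr.wf, Bool.and_eq_true, Bool.not_eq_true'] at hw
    let T := c.size * (2 * n + 3) ^ c.depth
    let ix := regIx ρ r
    let cond : Expr (Fintype.card ρ) (Fintype.card α) :=
      .op .lt (.reg ix) (.op .add (.op .add sizeE sizeE) (.const 2))
    let body := Cmd.seq c.comp (.setReg ix (.op .add (.reg ix) (.const 1)))
    have hreg : ∀ k, (Pr.iter r (c.run I) σ k).reg r = k := by
      intro k; cases k <;> simp [Pr.iter]
    have hBdd : ∀ k ≤ 2 * n + 2, (Pr.iter r (c.run I) σ k).Bdd (4 * n + 8) := by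
      intro k
      induction k with
      | zero => exact fun _ => hσ.set r (by omega)
      | succ k ih => exact fun hk => (hc hw.1 _ (ih (by omega))).1.set r (by omega)
    have hcond : ∀ k ≤ 2 * n + 2, cond.Safe (mach I) (Pr.iter r (c.run I) σ k).enc ∧
        cond.val (mach I) (Pr.iter r (c.run I) σ k).enc = if k < 2 * n + 2 then 1 else 0 := by
      intro k hk
      have hs := sizeE_safe I (V := Fintype.card ρ) (K := Fintype.card α)
        (σ := (Pr.iter r (c.run I) σ k).enc)
      have hv := sizeE_val I (V := Fintype.card ρ) (K := Fintype.card α)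
        (σ := (Pr.iter r (c.run I) σ k).enc)
      have hval : (Expr.op .add (.op .add sizeE sizeE) (.const 2) :
          Expr (Fintype.card ρ) (Fintype.card α)).val (mach I)
          (Pr.iter r (c.run I) σ k).enc = 2 * n + 2 := by
        simp only [Expr.val, Op.eval, hv]; ring
      refine ⟨⟨trivial, ⟨⟨hs, hs, ?_⟩, ?_, ?_⟩, ?_⟩, ?_⟩
      · simp only [Op.eval, hv]; omega
      · change 2 < _; omega
      · simp only [Expr.val, Op.eval, hv]; omega
      · simp only [Op.eval]; split_ifs <;> omega
      · have hr : (Expr.reg ix : Expr (Fintype.card ρ) (Fintype.card α)).val (mach I)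
            (Pr.iter r (c.run I) σ k).enc = k := by
          simp only [Expr.val, St.enc, ix, Equiv.symm_apply_apply]
          exact hreg k
        change Op.lt.eval (Expr.val _ _ _) (Expr.val _ _ _) = _
        rw [hr, hval]
        rfl
    -- Induction on the number `j` of rounds that remain. Besides the body a round takes 14 steps,
    -- namely 10 for the test and 4 for the increment; the last test takes 10.
    have hloop : ∀ j ≤ 2 * n + 2, ∃ t ≤ j * (T + 18) + 10,
        Exec (mach I) (.loop cond body) (Pr.iter r (c.run I) σ (2 * n + 2 - j)).enc t
          (Pr.iter r (c.run I) σ (2 * n + 2)).enc := by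
      intro j
      induction j with
      | zero =>
        intro _
        obtain ⟨h1, h2⟩ := hcond (2 * n + 2) le_rfl
        refine ⟨_, ?_, Exec.loop_false _ _ _ h1 (by simp [h2])⟩
        simp [cond, Expr.cost, sizeE]
      | succ j ih =>
        intro hj
        obtain ⟨s, hs, hexec⟩ := ih (by omega)
        obtain ⟨h1, h2⟩ := hcond (2 * n + 2 - (j + 1)) (by omega)
        obtain ⟨g1, t, g2, g3⟩ := hc hw.1 _ (hBdd (2 * n + 2 - (j + 1)) (by omega))
        have hk : 2 * n + 2 - j = 2 * n + 2 - (j + 1) + 1 := by omega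
        have hrk : (c.run I (Pr.iter r (c.run I) σ (2 * n + 2 - (j + 1)))).reg r =
            2 * n + 2 - (j + 1) := by
          rw [(run_agree I c _).reg r hw.2, hreg]
        have hval : (Expr.op .add (.reg ix) (.const 1) :
            Expr (Fintype.card ρ) (Fintype.card α)).val (mach I)
            (c.run I (Pr.iter r (c.run I) σ (2 * n + 2 - (j + 1)))).enc =
            2 * n + 2 - (j + 1) + 1 := by
          simp only [Expr.val, Op.eval, St.enc, ix, Equiv.symm_apply_apply]
          rw [hrk]
        have hset := Exec.setReg (M := mach I)
          (c.run I (Pr.iter r (c.run I) σ (2 * n + 2 - (j + 1)))).enc ix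
          (Expr.op .add (.reg ix) (.const 1)) ⟨trivial, by change 1 < _; omega, by
            change Expr.val (mach I) _ (Expr.op .add (.reg ix) (.const 1)) < _
            rw [hval]; omega⟩
        rw [hval, ← enc_set] at hset
        have hfin := Exec.loop_true _ _ _ cond body _ _ h1 (by
          rw [h2, if_pos (by omega)]; exact one_ne_zero) (Exec.seq _ _ _ _ _ _ _ g3 hset)
          (by rw [hk] at hexec; exact hexec)
        refine ⟨_, ?_, hfin⟩
        have hTt : t ≤ T := g2
        simp [cond, Expr.cost, sizeE]
        rw [add_mul]
        omega
    obtain ⟨t, h1, h2⟩ := hloop (2 * n + 2) le_rfl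
    rw [Nat.sub_self] at h2
    have h0 := Exec.setReg (M := mach I) σ.enc ix (Expr.const 0) (by change 0 < _; omega)
    have h0v : (Expr.const 0 : Expr (Fintype.card ρ) (Fintype.card α)).val (mach I) σ.enc = 0 := rfl
    rw [h0v, ← enc_set] at h0
    refine ⟨hBdd _ le_rfl, _, ?_, Exec.seq _ _ _ _ _ _ _ h0 h2⟩
    have hpos : 1 ≤ (2 * n + 3) ^ c.depth := Nat.one_le_pow _ _ (by omega)
    -- Rewriting one factor `2 * n + 3` as `2 * n + 2` rounds plus one leaves a multiple of 20 that
    -- pays for all tests and increments.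
    have e1 : (c.size + 20) * (2 * n + 3) ^ (c.depth + 1) =
        (2 * n + 2) * T + T + 20 * ((2 * n + 3) ^ c.depth * (2 * n + 3)) := by
      simp only [T]; ring
    have e2 : 2 * n + 3 ≤ (2 * n + 3) ^ c.depth * (2 * n + 3) := Nat.le_mul_of_pos_left _ hpos
    simp only [Pr.size, Pr.depth, Expr.cost]
    rw [e1]
    have e3 : (2 * n + 2) * (T + 18) = (2 * n + 2) * T + 18 * (2 * n + 2) := by ring
    omega

end correctness
end BoundaryLabeling

/-! ### The program -/

namespace BoundaryLabeling

/-- The registers of the program. -/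
inductive Rg where
  | s | i | j | k | x | y | y1 | z | b | u | yb | acc | acc2 | best | d | v | found | xs | ys
  | bt | xx | r | kk | o | p | cnt
  deriving DecidableEq

/-- The arrays of the program. -/
inductive Ar where
  | X | Y | XM | P | PM | SD | SDM | RC | LC | TC | RCM | LCM | TCM | M | M2 | W | GL | HT | F | FM
  | FT | FTM | OT | OTM | ON | OL | OR | PT | PTM | PL | PR | OUT
  deriving DecidableEq

instance : Fintype Rg := .ofList [.s, .i, .j, .k, .x, .y, .y1, .z, .b, .u, .yb, .acc, .acc2,
    .best, .d, .v, .found, .xs, .ys, .bt, .xx, .r, .kk, .o, .p, .cnt]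
  (by intro c; cases c <;> decide)

instance : Fintype Ar := .ofList [.X, .Y, .XM, .P, .PM, .SD, .SDM, .RC, .LC, .TC, .RCM, .LCM,
    .TCM, .M, .M2, .W, .GL, .HT, .F, .FM, .FT, .FTM, .OT, .OTM, .ON, .OL, .OR, .PT, .PTM, .PL, .PR,
    .OUT]
  (by intro c; cases c <;> decide)

namespace Code

/-- Expressions of the program. -/
abbrev E := Ex Rg Ar

/-- Commands of the program. -/
abbrev C := Pr Rg Ar

instance : Coe Rg E := ⟨Ex.reg⟩

instance : Add E := ⟨Ex.add⟩

instance : Sub E := ⟨Ex.sub⟩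

/-- Constants. -/
abbrev num (k : Fin 8) : E := Ex.const k

/-- The value of `2 * n`. -/
abbrev twoN : E := Ex.size + Ex.size

/-- A value larger than all columns. -/
abbrev inf : E := twoN + num 1

infixr:35 " ;; " => Pr.seq

/-- Execute a command if all conditions are satisfied. -/
def when {ρ α : Type} (es : List (Ex ρ α)) (c : Pr ρ α) : Pr ρ α :=
  es.foldr (fun e d => Pr.ite e d .skip) c

/-- Count the loop indices with the given properties. -/
def count (ri ra : Rg) (es : List E) : C :=
  .set ra (num 0) ;; .rep ri (when es (.set ra (ra + num 1)))

/-- The rank of an abscissa. -/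
def rkX : C :=
  count .i .acc2 [.lt Rg.i .size, .ltR Rg.i Rg.v] ;;
  count .i .acc [.lt Rg.i .size, .ltR (Rg.i + twoN) Rg.v] ;;
  .set .acc (Rg.acc + Rg.acc2)

/-- The rank of an ordinate. -/
def rkY : C :=
  count .i .acc2 [.lt Rg.i .size, .ltR Rg.v (Rg.i + .size)] ;;
  count .i .acc [.lt Rg.i .size, .ltR Rg.v (Rg.i + (twoN + .size))] ;;
  .set .acc (Rg.acc + Rg.acc2)

/-- Compute the ranks of all coordinates. -/
def ranks : C :=
  .rep .s (when [.lt Rg.s .size] (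
    .set .v Rg.s ;; rkX ;; .put .X Rg.s Rg.acc ;; .put .XM Rg.s (twoN - num 1 - Rg.acc) ;;
    .set .v (Rg.s + .size) ;; rkY ;; .put .Y Rg.s Rg.acc ;;
    .set .d (.word (Rg.s + num 1)) ;; .put .SD Rg.s Rg.d ;; .put .SDM Rg.s (num 2 - Rg.d) ;;
    .ite (.eq Rg.d (num 1))
      (.set .v (Rg.s + twoN) ;; rkX ;; .put .P Rg.s Rg.acc ;;
        .put .PM Rg.s (twoN - num 1 - Rg.acc))
      (.set .v (Rg.s + (twoN + .size)) ;; rkY ;; .put .P Rg.s Rg.acc ;; .put .PM Rg.s Rg.acc)))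

/-- The arrays for the left part and for the mirrored right part. -/
def aX : Bool → Ar | false => .X | true => .XM
def aP : Bool → Ar | false => .P | true => .PM
def aSD : Bool → Ar | false => .SD | true => .SDM
def aRC : Bool → Ar | false => .RC | true => .RCM
def aLC : Bool → Ar | false => .LC | true => .LCM
def aTC : Bool → Ar | false => .TC | true => .TCM
def aF : Bool → Ar | false => .F | true => .FM
def aFT : Bool → Ar | false => .FT | true => .FTM

/-- The sites by rows, and the numbers of left and top ports. -/
def prep (m : Bool) : C :=
  .rep .s (when [.lt Rg.s .size] (.put (aRC m) (.arr .Y Rg.s) (.arr (aX m) Rg.s + num 1))) ;;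
  .rep .x (
    count .j .acc [.lt Rg.j .size, .eq (.arr (aSD m) Rg.j) (num 0), .lt (.arr (aP m) Rg.j) Rg.x] ;;
    .put (aLC m) Rg.x Rg.acc ;;
    count .j .acc [.lt Rg.j .size, .eq (.arr (aSD m) Rg.j) (num 1), .lt (.arr (aP m) Rg.j) Rg.x] ;;
    .put (aTC m) Rg.x Rg.acc)

/-- One step of `tabRow`. -/
def tabBody (m : Bool) (yr : Rg) : C :=
  when [.eq Rg.z yr] (.put .W Rg.x Rg.acc) ;;
  when [.lt yr (Rg.z + num 1)] (.set .v (Rg.acc + .size - .arr (aLC m) Rg.z) ;;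
    when [.lt Rg.best Rg.v] (.set .best Rg.v)) ;;
  when [.lt (num 0) (.arr (aRC m) Rg.z), .lt (.arr (aRC m) Rg.z) (Rg.x + num 1)]
    (.set .acc (Rg.acc + num 1))

/-- Compute the entries of `tab` in column `x`. -/
def tabRow (m : Bool) (yr : Rg) : C :=
  .set .acc (num 0) ;; .set .best (num 0) ;; .rep .z (tabBody m yr)

/-- The numbers of sites above row `yr`, and the possible surplus over the left ports. -/
def tab (m : Bool) (yr : Rg) : C :=
  .rep .x (tabRow m yr ;; .put .GL Rg.x Rg.best)

/-- Compute the entry of `ht` in column `x`. -/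
def htRow (m : Bool) : C :=
  .set .best (num 0) ;;
  .rep .z (when [.lt Rg.x (Rg.z + num 1), .lt Rg.z (Rg.u + num 1)]
    (.set .v (.arr .W Rg.z + .size - .arr (aTC m) Rg.z) ;;
      when [.lt Rg.best Rg.v] (.set .best Rg.v)))

/-- The possible surplus over the top ports. -/
def ht (m : Bool) : C :=
  .rep .x (htRow m ;; .put .HT Rg.x Rg.best)

/-- Check whether a path can end in row `y`. -/
def chk (m : Bool) : C :=
  .put (aF m) Rg.y (num 0) ;;
  when [.lt (.arr (aTC m) Rg.u) (.arr .W Rg.u + num 1)] (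
    .set .b (.arr .W Rg.u - .arr (aTC m) Rg.u) ;;
    when [.lt (.arr .M Rg.b) (Rg.u + num 1),
        .lt (.arr .W Rg.u + .size) (.arr .GL Rg.u + Rg.b + num 1)]
      (.put (aF m) Rg.y (num 1)))

/-- Test whether column `x` can be reached with `b` sites on the left. -/
def stepCell (m : Bool) : C :=
  .set .d (num 0) ;;
  when [.lt (num 0) (.arr (aRC m) Rg.y), .lt (.arr (aRC m) Rg.y) (Rg.x + num 1)]
    (.set .d (num 1)) ;;
  when [.lt Rg.d (Rg.b + num 1), .lt (.arr .M (Rg.b - Rg.d)) (Rg.x + num 1),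
      .lt (Rg.b - Rg.d + .size) (.arr .HT Rg.x + num 1),
      .lt (.arr .W Rg.x + .size) (.arr .GL Rg.x + Rg.b + num 1)]
    (.put .M2 Rg.b Rg.x)

/-- Find the leftmost column that can be reached with `b` sites on the left. -/
def stepRow (m : Bool) : C :=
  .put .M2 Rg.b inf ;;
  .rep .x (when [.eq (.arr .M2 Rg.b) inf, .lt Rg.x (Rg.u + num 1)] (stepCell m))

/-- The transition from row `y` to the next one. -/
def step (m : Bool) : C :=
  .rep .b (stepRow m) ;; .rep .b (.put .M Rg.b (.arr .M2 Rg.b))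

/-- The computations in row `y`. -/
def dpRow (m : Bool) : C :=
  tab m .y ;; chk m ;; ht m ;; .set .y1 (Rg.y + num 1) ;; tab m .y1 ;; step m

/-- The dynamic program for the paths left of column `u` through the rows above `yb`. -/
def dp (m : Bool) : C :=
  .rep .b (.put .M Rg.b inf) ;; .put .M (num 0) (num 0) ;;
  .rep .y (when [.lt Rg.y Rg.yb] (dpRow m))

/-- Run both dynamic programs. -/
def dps : C :=
  .set .yb (twoN + num 1) ;; .set .u Rg.k ;; dp false ;; .set .u (twoN - Rg.k) ;; dp true

/-- Search for a common end point in column `k`. -/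
def pick : C :=
  .rep .j (when [.eq Rg.found (num 0), .lt Rg.j (twoN + num 1),
      .eq (.arr .F Rg.j) (num 1), .eq (.arr .FM Rg.j) (num 1)]
    (.set .found (num 1) ;; .set .xs Rg.k ;; .set .ys Rg.j))

/-- Search for a common end point of a left and a right path. -/
def search : C :=
  .set .found (num 0) ;;
  .rep .k (when [.eq Rg.found (num 0), .lt Rg.k (twoN + num 1)] (dps ;; pick))

/-- Move to the left end of the path in row `r`, and mark the row if it has a site above the
path. -/
def mark (m : Bool) : C :=
  .set .xx (.arr .M Rg.bt) ;; .set .r (Rg.yb - num 1) ;;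
  when [.lt (num 0) (.arr (aRC m) Rg.r)] (
    .ite (.lt (.arr (aRC m) Rg.r) (Rg.xx + num 1)) (.set .bt (Rg.bt - num 1))
      (when [.lt (.arr (aRC m) Rg.r) (Rg.u + num 1)] (.put (aFT m) Rg.r (num 1))))

/-- Follow a path backwards and mark the rows with a site above it. -/
def trace (m : Bool) : C :=
  count .z .acc [.lt Rg.z Rg.ys, .lt (num 0) (.arr (aRC m) Rg.z),
    .lt (.arr (aRC m) Rg.z) (Rg.u + num 1)] ;;
  .set .bt (Rg.acc - .arr (aTC m) Rg.u) ;;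
  .rep .k (when [.lt Rg.k Rg.ys] (.set .yb (Rg.ys - Rg.k) ;; dp m ;; mark m))

/-- Distribute the sites into classes. -/
def classes : C :=
  .rep .s (when [.lt Rg.s .size] (
    .ite (.eq (.arr .FT (.arr .Y Rg.s)) (num 1)) (.put .OT (.arr .Y Rg.s) (Rg.s + num 1))
      (.ite (.eq (.arr .FTM (.arr .Y Rg.s)) (num 1)) (.put .OTM (.arr .Y Rg.s) (Rg.s + num 1))
        (.put .ON (.arr .X Rg.s) (Rg.s + num 1)))))

/-- The leftmost sites that do not belong to top ports are connected to the left side. -/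
def halves : C :=
  .set .cnt (num 0) ;;
  .rep .x (when [.lt (num 0) (.arr .ON Rg.x)] (
    .ite (.lt Rg.cnt (.arr .LC twoN))
      (.put .OL Rg.x (.arr .ON Rg.x) ;; .set .cnt (Rg.cnt + num 1))
      (.put .OR (twoN - num 1 - Rg.x) (.arr .ON Rg.x))))

/-- Distribute the ports into classes. -/
def ports : C :=
  .rep .j (when [.lt Rg.j .size] (
    .ite (.eq (.arr .SD Rg.j) (num 0)) (.put .PL (.arr .P Rg.j) (Rg.j + num 1))
      (.ite (.eq (.arr .SD Rg.j) (num 1))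
        (.ite (.lt (.arr .P Rg.j) Rg.xs) (.put .PT (.arr .P Rg.j) (Rg.j + num 1))
          (.put .PTM (.arr .PM Rg.j) (Rg.j + num 1)))
        (.put .PR (.arr .P Rg.j) (Rg.j + num 1)))))

/-- Find the port in the array `Q` that a site at position `kk` prefers. -/
def choice (Q : Ar) : C :=
  .set .best inf ;;
  .rep .p (when [.lt (num 0) (.arr Q Rg.p)] (
    .ite (.lt Rg.p Rg.kk) (.set .best Rg.p) (when [.eq Rg.best inf] (.set .best Rg.p))))

/-- Connect the sites in the array `O` one after the other to ports in the array `Q`. -/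
def greedy (O K Q : Ar) : C :=
  .rep .o (when [.lt (num 0) (.arr O Rg.o)] (
    .set .s (.arr O Rg.o - num 1) ;; .set .kk (.arr K Rg.s) ;; choice Q ;;
    .put .OUT Rg.s (.arr Q Rg.best - num 1) ;; .put Q Rg.best (num 0)))

/-- The program. -/
def main : C :=
  ranks ;; prep false ;; prep true ;; search ;;
  when [Rg.found] (
    .set .u Rg.xs ;; trace false ;; .set .u (twoN - Rg.xs) ;; trace true ;;
    classes ;; halves ;; ports ;;
    greedy .OT .X .PT ;; greedy .OTM .XM .PTM ;; greedy .OL .Y .PL ;; greedy .OR .Y .PR)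

theorem main_wf : main.wf = true := by decide +kernel

/-- The deepest loops run over the cut or the row of the backward trace, the row of the dynamic
program, the number of sites on the left, and the column. The depth becomes the exponent of the time
bound. -/
theorem main_depth : main.depth = 4 := by decide +kernel

end Code

end BoundaryLabeling

/-! ### Frame rules, counting loops and the computation of ranks -/

namespace BoundaryLabeling

open Finset

section machine

variable {ρ α : Type} [DecidableEq ρ] [DecidableEq α] {n : ℕ} (I : Instance n)

theorem run_reg {c : Pr ρ α} {r : ρ} (h : c.writesR r = false) (σ : St ρ α) :
    (c.run I σ).reg r = σ.reg r := (run_agree I c σ).reg r h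

theorem run_arr {c : Pr ρ α} {a : α} (h : c.writesA a = false) (σ : St ρ α) :
    (c.run I σ).arr a = σ.arr a := (run_agree I c σ).arr a h

theorem run_seq (c d : Pr ρ α) (σ : St ρ α) : (Pr.seq c d).run I σ = d.run I (c.run I σ) := rfl

theorem run_set (r : ρ) (e : Ex ρ α) (σ : St ρ α) :
    (Pr.set r e).run I σ = σ.set r (e.ev I σ) := rfl

theorem run_put (a : α) (e f : Ex ρ α) (σ : St ρ α) :
    (Pr.put a e f).run I σ = σ.put a (e.ev I σ) (f.ev I σ) := rfl

open Classical in
theorem run_when (es : List (Ex ρ α)) (c : Pr ρ α) (σ : St ρ α) :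
    (Code.when es c).run I σ = if ∀ e ∈ es, e.ev I σ ≠ 0 then c.run I σ else σ := by
  induction es with
  | nil => simp [Code.when]
  | cons e es ih =>
    have : (Code.when (e :: es) c).run I σ =
        if e.ev I σ ≠ 0 then (Code.when es c).run I σ else σ := rfl
    rw [this, ih]
    by_cases h : e.ev I σ = 0 <;> simp [h]

theorem run_when_pos {es : List (Ex ρ α)} {c : Pr ρ α} {σ : St ρ α}
    (h : ∀ e ∈ es, e.ev I σ ≠ 0) : (Code.when es c).run I σ = c.run I σ := by
  rw [run_when, if_pos h]

theorem run_when_neg {es : List (Ex ρ α)} {c : Pr ρ α} {σ : St ρ α}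
    (h : ¬ ∀ e ∈ es, e.ev I σ ≠ 0) : (Code.when es c).run I σ = σ := by
  rw [run_when, if_neg h]

end machine

theorem card_filter_range {n N : ℕ} (hN : n ≤ N) {p : ℕ → Prop} [DecidablePred p]
    {q : Fin n → Prop} [DecidablePred q] (h : ∀ k < N, p k ↔ ∃ hk : k < n, q ⟨k, hk⟩) :
    ((range N).filter p).card = (univ.filter q).card := by
  symm
  apply card_bij (fun (k : Fin n) _ => (k : ℕ))
  · intro k hk
    rw [mem_filter] at hk ⊢
    exact ⟨mem_range.2 (k.2.trans_le hN), (h k (k.2.trans_le hN)).2 ⟨k.2, hk.2⟩⟩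
  · intro a _ b _ hab
    exact Fin.ext hab
  · intro k hk
    rw [mem_filter, mem_range] at hk
    obtain ⟨h1, h2⟩ := (h k hk.1).1 hk.2
    exact ⟨⟨k, h1⟩, by simpa using h2, rfl⟩

namespace Code

variable {n : ℕ} (I : Instance n)

/-- The conditions may depend on everything but the accumulator, which is why `hp` quantifies over
all stores that agree with `σ` elsewhere. The count stays below the modulus, so the reduced sum is
the true one. -/
theorem run_count {ri ra : Rg} (hne : ri ≠ ra) (es : List E) (σ : St Rg Ar) (p : ℕ → Prop)
    [DecidablePred p] (hp : ∀ k < 2 * n + 2, ∀ τ : St Rg Ar, τ.reg ri = k →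
      (∀ r', r' ≠ ri → r' ≠ ra → τ.reg r' = σ.reg r') → τ.arr = σ.arr →
      ((∀ e ∈ es, e.ev I τ ≠ 0) ↔ p k)) :
    ((count ri ra es).run I σ).reg ra = ((range (2 * n + 2)).filter p).card := by
  change ((Pr.rep ri _).run I (σ.set ra 0)).reg ra = _
  refine (run_for I (σ := σ.set ra 0) (fun k τ => τ.reg ra = ((range k).filter p).card ∧
      (∀ r', r' ≠ ri → r' ≠ ra → τ.reg r' = σ.reg r') ∧ τ.arr = σ.arr)
    ⟨?_, fun r' h1 h2 => ?_, rfl⟩ fun k τ hk _ hr ⟨h1, h2, h3⟩ => ?_).1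
  · simp [hne.symm]
  · simp [h1, h2]
  · have h4 : ((range k).filter p).card ≤ k := by
      simpa using card_filter_le (range k) p
    rw [run_when, range_add_one, filter_insert]
    have h5 := hp k hk τ hr h2 h3
    by_cases h : p k
    · rw [if_pos (h5.2 h), if_pos h, card_insert_of_notMem (by simp)]
      refine ⟨?_, fun r' hr1 hr2 => ?_, h3⟩
      · simp only [Pr.run, St.set_reg, hne.symm, if_false, if_true]
        change (τ.reg ra + 1) % (4 * n + 8) = _
        rw [h1, Nat.mod_eq_of_lt (by omega)]
      · simp only [Pr.run, St.set_reg, hr1, hr2, if_false]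
        exact h2 r' hr1 hr2
    · rw [if_neg (fun hh => h (h5.1 hh)), if_neg h]
      refine ⟨?_, fun r' hr1 hr2 => ?_, h3⟩
      · simp only [St.set_reg, hne.symm, if_false]; exact h1
      · simp only [St.set_reg, hr1, if_false]; exact h2 r' hr1 hr2

theorem run_count_fin {ri ra : Rg} (hne : ri ≠ ra) (es : List E) (σ : St Rg Ar)
    (q : Fin n → Prop) [DecidablePred q] (hp : ∀ k < 2 * n + 2, ∀ τ : St Rg Ar, τ.reg ri = k →
      (∀ r', r' ≠ ri → r' ≠ ra → τ.reg r' = σ.reg r') → τ.arr = σ.arr →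
      ((∀ e ∈ es, e.ev I τ ≠ 0) ↔ ∃ hk : k < n, q ⟨k, hk⟩)) :
    ((count ri ra es).run I σ).reg ra = (univ.filter q).card := by
  classical
  rw [run_count I hne es σ _ hp]
  exact card_filter_range (by omega) fun k _ => Iff.rfl

theorem ev_zero (σ : St Rg Ar) : (num 0 : E).ev I σ = 0 := rfl

theorem ev_one (σ : St Rg Ar) : (num 1 : E).ev I σ = 1 := rfl

theorem ev_sub (e f : E) (σ : St Rg Ar) : (e - f).ev I σ = e.ev I σ - f.ev I σ := rfl

theorem card_filter_le_fin (p : Fin n → Prop) [DecidablePred p] : (univ.filter p).card ≤ n :=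
  (card_le_univ _).trans (by simp)

/-- The real number with index `q` in the input. -/
noncomputable def rl (q : ℕ) : ℝ := I.input.reals.getD q 0

theorem rl_siteX (s : Fin n) : rl I s = (I.site s).1 := by
  unfold rl Instance.input
  simp only [List.append_assoc]
  rw [List.getD_append _ _ _ _ (by simp)]
  simp [List.getD_eq_getElem?_getD]

theorem rl_siteY (s : Fin n) : rl I (s + n) = (I.site s).2 := by
  unfold rl Instance.input
  simp only [List.append_assoc]
  rw [List.getD_append_right _ _ _ _ (by simp), List.getD_append _ _ _ _ (by simp)]
  simp [List.getD_eq_getElem?_getD]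

theorem rl_portX (s : Fin n) : rl I (s + 2 * n) = (I.port s).1 := by
  unfold rl Instance.input
  simp only [List.append_assoc]
  rw [List.getD_append_right _ _ _ _ (by simp; omega),
    List.getD_append_right _ _ _ _ (by simp; omega), List.getD_append _ _ _ _ (by simp; omega)]
  simp only [List.length_ofFn]
  rw [show (s : ℕ) + 2 * n - n - n = s by omega]
  simp [List.getD_eq_getElem?_getD]

theorem rl_portY (s : Fin n) : rl I (s + 3 * n) = (I.port s).2 := by
  unfold rl Instance.input
  simp only [List.append_assoc]
  rw [List.getD_append_right _ _ _ _ (by simp; omega),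
    List.getD_append_right _ _ _ _ (by simp; omega),
    List.getD_append_right _ _ _ _ (by simp; omega), List.getD_append _ _ _ _ (by simp; omega)]
  simp only [List.length_ofFn]
  rw [show (s : ℕ) + 3 * n - n - n - n = s by omega]
  simp [List.getD_eq_getElem?_getD]

theorem word_side (j : Fin n) : I.input.words.getD (j + 1) 0 = (I.side j).code := by
  simp [Instance.input, List.getD_eq_getElem?_getD]

theorem rank_sum {g : Fin n ⊕ Fin n → ℝ} {v : ℝ} : by
    classical exact rank g v = (univ.filter fun s => g (.inl s) < v).card +
      (univ.filter fun j => g (.inr j) < v).card := by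
  classical
  unfold rank
  simp only [card_filter, Fintype.sum_sum_type]

theorem run_rkX {σ : St Rg Ar} (hv : σ.reg .v < 4 * n + 2) :
    (rkX.run I σ).reg .acc = rank I.gx (rl I (σ.reg .v)) := by
  classical
  generalize hq : σ.reg .v = q at hv ⊢
  rw [rank_sum]
  simp only [rkX, Pr.run, Ex.ev, St.set_reg, if_true]
  rw [run_count_fin I (by decide) _ _ (fun s => I.gx (.inr s) < rl I q),
    run_reg I (by decide), run_count_fin I (by decide) _ _ (fun s => I.gx (.inl s) < rl I q),
    add_comm, Nat.mod_eq_of_lt]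
  · have := card_filter_le_fin (fun s => I.gx (.inl s) < rl I q)
    have := card_filter_le_fin (fun s => I.gx (.inr s) < rl I q)
    omega
  · intro k hk τ h1 h2 h3
    have h4 := h2 .v (by decide) (by decide)
    by_cases h : k < n
    · simp (disch := omega) [Ex.ev, h1, h4, hq, Nat.mod_eq_of_lt, h, rl, I.gx_inl, ← rl_siteX]
    · simp [Ex.ev, h1, h]
  · intro k hk τ h1 h2 h3
    have h4 := h2 .v (by decide) (by decide)
    rw [run_reg I (by decide), hq] at h4
    by_cases h : k < n
    · simp (disch := omega) [Ex.ev, h1, h4, Nat.mod_eq_of_lt, h, rl, I.gx_inr, ← rl_portX, ← two_mul]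
    · simp [Ex.ev, h1, h]

/-- Rows are counted from the top, so the program looks for larger ordinates; this is the order of
the negated ordinates. -/
theorem run_rkY {σ : St Rg Ar} (hv : σ.reg .v < 4 * n + 2) :
    (rkY.run I σ).reg .acc = rank I.gy (-rl I (σ.reg .v)) := by
  classical
  generalize hq : σ.reg .v = q at hv ⊢
  rw [rank_sum]
  simp only [rkY, Pr.run, Ex.ev, St.set_reg, if_true]
  rw [run_count_fin I (by decide) _ _ (fun s => I.gy (.inr s) < -rl I q),
    run_reg I (by decide), run_count_fin I (by decide) _ _ (fun s => I.gy (.inl s) < -rl I q),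
    add_comm, Nat.mod_eq_of_lt]
  · have := card_filter_le_fin (fun s => I.gy (.inl s) < -rl I q)
    have := card_filter_le_fin (fun s => I.gy (.inr s) < -rl I q)
    omega
  · intro k hk τ h1 h2 h3
    have h4 := h2 .v (by decide) (by decide)
    by_cases h : k < n
    · simp (disch := omega) [Ex.ev, h1, h4, hq, Nat.mod_eq_of_lt, h, rl, I.gy_inl, ← rl_siteY]
    · simp [Ex.ev, h1, h]
  · intro k hk τ h1 h2 h3
    have h4 := h2 .v (by decide) (by decide)
    rw [run_reg I (by decide), hq] at h4
    by_cases h : k < n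
    · simp (disch := omega) [Ex.ev, h1, h4, Nat.mod_eq_of_lt, h, rl, I.gy_inr, ← rl_portY,
        show n + n + n = 3 * n by omega]
    · simp [Ex.ev, h1, h]

end Code

end BoundaryLabeling

/-! ### Coordinates and port counts in memory -/

namespace BoundaryLabeling

open Finset

namespace Code

variable {n : ℕ} (I : Instance n)

/-- The ranks of the coordinates of site `s` and port `s` are in the memory. -/
structure RankAt (σ : St Rg Ar) (s : Fin n) : Prop where
  X : σ.arr .X s = I.disc.X s
  XM : σ.arr .XM s = I.disc.mirror.X s
  Y : σ.arr .Y s = I.disc.Y s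
  P : σ.arr .P s = I.disc.P s
  PM : σ.arr .PM s = I.disc.mirror.P s
  SD : σ.arr .SD s = (I.disc.side s).code
  SDM : σ.arr .SDM s = (I.disc.mirror.side s).code

theorem code_mirror (e : Side) : e.mirror.code = 2 - e.code := by cases e <;> rfl

theorem code_lt (e : Side) : e.code < 3 := by cases e <;> decide

theorem code_eq_zero (e : Side) : e.code = 0 ↔ e = .left := by cases e <;> simp [Side.code]

theorem code_eq_one (e : Side) : e.code = 1 ↔ e = .top := by cases e <;> simp [Side.code]

theorem run_ranks (σ : St Rg Ar) : ∀ s, RankAt I (ranks.run I σ) s := by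
  suffices h : ∀ s : Fin n, (s : ℕ) < 2 * n + 2 → RankAt I (ranks.run I σ) s from
    fun s => h s (by omega)
  unfold ranks
  refine run_for I (σ := σ) (fun k τ => ∀ s : Fin n, (s : ℕ) < k → RankAt I τ s)
    (fun s h => absurd h (by omega)) (fun k τ hk _ hs h => ?_)
  rw [run_when]
  by_cases hkn : k < n
  swap
  · rw [if_neg (by simp [Ex.ev, hs, hkn])]
    intro s hs'
    have := h s (by omega)
    exact ⟨this.X, this.XM, this.Y, this.P, this.PM, this.SD, this.SDM⟩
  rw [if_pos (by simp [Ex.ev, hs, hkn])]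
  obtain ⟨j, rfl⟩ : ∃ j : Fin n, k = j := ⟨⟨k, hkn⟩, rfl⟩
  have e1 : I.input.words[(j : ℕ) + 1]?.getD 0 = (I.side j).code := by
    simpa using word_side I j
  have x1 : rank I.gx (rl I j) = I.disc.X j := by rw [rl_siteX]; rfl
  have x2 : rank I.gy (-rl I (j + n)) = I.disc.Y j := by rw [rl_siteY]; rfl
  have hj : I.disc.side j = I.side j := rfl
  have hX := I.disc.X_lt j
  have hP := I.disc.P_lt j
  have hC := code_lt (I.side j)
  intro s hs'
  by_cases htop : I.side j = .top
  · have x3 : rank I.gx (rl I (j + 2 * n)) = I.disc.P j := by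
      rw [rl_portX, I.disc_P_top htop]; rfl
    have m3 := I.disc.P_mirror_top (hj.trans htop)
    have hc : (I.side j).code = 1 := by rw [htop]; rfl
    simp (disch := first | decide | omega | (simp; omega)) [Pr.run, Ex.ev, ev_sub,
      run_reg, run_rkX, run_rkY, hs, e1, x1, x2, x3, hc, ← two_mul, Nat.mod_eq_of_lt]
    by_cases hsj : s = j
    · subst hsj
      constructor <;>
      simp (disch := decide) [run_arr, m3, Disc.X_mirror, Disc.side_mirror, code_mirror, hj, hc]
    · have := h s (by omega)
      have hne : (s : ℕ) ≠ j := fun hh => hsj (Fin.ext hh)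
      constructor <;>
      simp (disch := decide) [run_arr, hne, this.X, this.XM, this.Y, this.P, this.PM, this.SD,
        this.SDM]
  · have x3 : rank I.gy (-rl I (j + 3 * n)) = I.disc.P j := by
      rw [rl_portY]
      cases h : I.side j
      · rw [I.disc_P_left h]; rfl
      · exact absurd h htop
      · rw [I.disc_P_right h]; rfl
    have m3 : I.disc.mirror.P j = I.disc.P j := by
      cases h : I.side j
      · exact I.disc.P_mirror_left (hj.trans h)
      · exact absurd h htop
      · exact I.disc.P_mirror_right (hj.trans h)
    have hc : (I.side j).code ≠ 1 := fun h => htop ((code_eq_one _).1 h)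
    simp (disch := first | decide | omega | (simp; omega)) [Pr.run, Ex.ev, ev_sub,
      run_reg, run_rkX, run_rkY, hs, e1, x1, x2, x3, hc, ← two_mul,
      show 2 * n + n = 3 * n by omega, Nat.mod_eq_of_lt]
    by_cases hsj : s = j
    · subst hsj
      constructor <;>
      simp (disch := decide) [run_arr, m3, Disc.X_mirror, Disc.side_mirror, code_mirror, hj]
    · have := h s (by omega)
      have hne : (s : ℕ) ≠ j := fun hh => hsj (Fin.ext hh)
      constructor <;>
      simp (disch := decide) [run_arr, hne, this.X, this.XM, this.Y, this.P, this.PM, this.SD,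
        this.SDM]

/-- The coordinates of `D` are in the memory. -/
structure Coords (D : Disc n) (m : Bool) (σ : St Rg Ar) : Prop where
  X : ∀ s : Fin n, σ.arr (aX m) s = D.X s
  Y : ∀ s : Fin n, σ.arr .Y s = D.Y s
  P : ∀ s : Fin n, σ.arr (aP m) s = D.P s
  SD : ∀ s : Fin n, σ.arr (aSD m) s = (D.side s).code

/-- The rows of the sites and the numbers of ports of `D` are in the memory. -/
structure Tables (D : Disc n) (m : Bool) (σ : St Rg Ar) : Prop where
  rc : ∀ s : Fin n, σ.arr (aRC m) (D.Y s) = D.X s + 1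
  rc_zero : ∀ y, (∀ s, D.Y s ≠ y) → σ.arr (aRC m) y = 0
  lc : ∀ y < 2 * n + 2, σ.arr (aLC m) y = D.lp y
  tc : ∀ x < 2 * n + 2, σ.arr (aTC m) x = D.tp x

/-- A row stores the column of its site plus one, so that the initial value 0 stands for a row
without a site; therefore the array has to be zero at the start. -/
theorem run_prep {D : Disc n} {m : Bool} {σ : St Rg Ar} (h : Coords D m σ)
    (h0 : ∀ i, σ.arr (aRC m) i = 0) : Tables D m ((prep m).run I σ) := by
  classical
  unfold prep
  rw [Pr.run]
  set c := Pr.rep Rg.s _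
  have h1 : (∀ s : Fin n, (s : ℕ) < 2 * n + 2 → (c.run I σ).arr (aRC m) (D.Y s) = D.X s + 1) ∧
      ∀ y, (∀ s : Fin n, (s : ℕ) < 2 * n + 2 → D.Y s ≠ y) → (c.run I σ).arr (aRC m) y = 0 := by
    refine run_for I (σ := σ) (fun k τ => (∀ s : Fin n, (s : ℕ) < k →
      τ.arr (aRC m) (D.Y s) = D.X s + 1) ∧ ∀ y, (∀ s : Fin n, (s : ℕ) < k → D.Y s ≠ y) →
        τ.arr (aRC m) y = 0) ⟨fun s h => absurd h (by omega), fun y _ => h0 y⟩ ?_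
    rintro k τ hk hA hs ⟨h2, h3⟩
    rw [run_when]
    by_cases hkn : k < n
    swap
    · rw [if_neg (by simp [Ex.ev, hs, hkn])]
      exact ⟨fun s hs' => h2 s (by omega), fun y hy => h3 y fun s hs' => hy s (by omega)⟩
    rw [if_pos (by simp [Ex.ev, hs, hkn])]
    obtain ⟨j, rfl⟩ : ∃ j : Fin n, k = j := ⟨⟨k, hkn⟩, rfl⟩
    have hX := D.X_lt j
    have e1 : τ.arr .Y j = D.Y j := by rw [← h.Y j, hA.arr .Y (by cases m <;> decide)]
    have e2 : τ.arr (aX m) j = D.X j := by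
      rw [← h.X j, hA.arr (aX m) (by cases m <;> decide)]
    simp (disch := omega) only [Pr.run, Ex.ev, hs, e1, e2, St.set_arr, St.put_arr, true_and,
      Nat.mod_eq_of_lt]
    refine ⟨fun s hs' => ?_, fun y hy => ?_⟩
    · by_cases hsj : s = j
      · simp [hsj]
      · rw [if_neg (fun hh => hsj (D.injY hh))]
        exact h2 s (by have : (s : ℕ) ≠ j := fun hh => hsj (Fin.ext hh)
                       omega)
    · rw [if_neg (fun hh => hy j (by omega) hh.symm)]
      exact h3 y fun s hs' => hy s (by omega)
  have h2 : ∀ j : Fin n, (c.run I σ).arr (aP m) j = D.P j := fun j => by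
    rw [← h.P j, run_arr I (by cases m <;> decide)]
  have h3 : ∀ j : Fin n, (c.run I σ).arr (aSD m) j = (D.side j).code := fun j => by
    rw [← h.SD j, run_arr I (by cases m <;> decide)]
  obtain ⟨h1, h1'⟩ := h1
  generalize c.run I σ = σ at h1 h1' h2 h3
  set d := Pr.rep Rg.x _
  have h4 : ∀ x < 2 * n + 2, (d.run I σ).arr (aLC m) x = D.lp x ∧
      (d.run I σ).arr (aTC m) x = D.tp x := by
    refine run_for I (σ := σ) (fun k τ => ∀ x < k, τ.arr (aLC m) x = D.lp x ∧
      τ.arr (aTC m) x = D.tp x) (fun s h => absurd h (by omega)) ?_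
    intro k τ hk hA hs h4 x hx
    have e2 : ∀ j : Fin n, τ.arr (aP m) j = D.P j := fun j => by
      rw [← h2 j, hA.arr (aP m) (by cases m <;> decide)]
    have e3 : ∀ j : Fin n, τ.arr (aSD m) j = (D.side j).code := fun j => by
      rw [← h3 j, hA.arr (aSD m) (by cases m <;> decide)]
    have c1 : ∀ (i : Fin 8) (e : Side) (he : ∀ e' : Side, e'.code = i ↔ e' = e) (υ : St Rg Ar),
        υ.reg .x = k → (∀ j : Fin n, υ.arr (aP m) j = D.P j) →
        (∀ j : Fin n, υ.arr (aSD m) j = (D.side j).code) →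
        ((count .j .acc [.lt Rg.j .size, .eq (.arr (aSD m) Rg.j) (num i),
          .lt (.arr (aP m) Rg.j) Rg.x]).run I υ).reg .acc =
          (univ.filter fun j => D.side j = e ∧ D.P j < k).card := by
      intro i e he υ hx hP hS
      apply run_count_fin I (by decide)
      intro k' hk' τ' r1 r2 r3
      have r4 := r2 .x (by decide) (by decide)
      by_cases hkn : k' < n
      · obtain ⟨j, rfl⟩ : ∃ j : Fin n, k' = j := ⟨⟨k', hkn⟩, rfl⟩
        simp [Ex.ev, r1, r3, r4, hx, hP, hS, he]
      · simp [Ex.ev, r1, hkn]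
    have l1 := c1 0 .left code_eq_zero τ hs e2 e3
    have l2 := c1 1 .top code_eq_one
    simp only [Pr.run, Ex.ev]
    set τ' := ((count .j .acc _).run I τ).put _ _ _ with hτ
    have r1 : τ'.reg .x = k := by rw [hτ, St.put_reg, run_reg I (by cases m <;> decide), hs]
    have l3 := l2 τ' r1 (fun j => by
        rw [← e2 j, hτ, St.put_arr, if_neg (by cases m <;> simp [aP, aLC]), run_arr I (by cases m <;> decide)])
      (fun j => by
        rw [← e3 j, hτ, St.put_arr, if_neg (by cases m <;> simp [aSD, aLC]), run_arr I (by cases m <;> decide)])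
    rw [run_reg I (by cases m <;> decide), r1, l3]
    simp only [St.set_arr, St.put_arr, true_and]
    rw [run_arr I (by cases m <;> decide), hτ, l1, run_reg I (by cases m <;> decide), hs]
    have n1 : aLC m ≠ aTC m := by cases m <;> decide
    simp only [n1, false_and, if_false, St.put_arr, true_and]
    rw [run_arr I (by cases m <;> decide)]
    by_cases hxk : x = k
    · simp [hxk, Disc.lp, Disc.tp]
    · have := h4 x (by omega)
      simp only [hxk, if_false, this, true_and]
      rw [run_arr I (by cases m <;> decide), St.put_arr, if_neg (by simp [n1.symm]),
        run_arr I (by cases m <;> decide), this.2]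
  have h5 : (d.run I σ).arr (aRC m) = σ.arr (aRC m) := run_arr I (by cases m <;> decide) _
  exact ⟨fun s => by rw [h5]; exact h1 s (by omega),
    fun y hy => by rw [h5]; exact h1' y fun s _ => hy s, fun y hy => (h4 y hy).1,
    fun y hy => (h4 y hy).2⟩

end Code

end BoundaryLabeling

/-! ### Tables for the two counting conditions -/

namespace BoundaryLabeling

open Finset

namespace Disc

variable {n : ℕ} (D : Disc n)

theorem hit_eq_one {y x : ℕ} : D.hit y x = 1 ↔ ∃ s, D.Y s = y ∧ D.X s < x := by
  unfold hit; split_ifs with h <;> simp [h]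

theorem hit_eq_zero {y x : ℕ} : D.hit y x = 0 ↔ ¬ ∃ s, D.Y s = y ∧ D.X s < x := by
  unfold hit; split_ifs with h <;> simp [h]

/-- For fixed `x` and `y` the best witness maximizes `D.nw x z - D.lp z`. The shift by `n`, which
bounds `D.lp`, keeps this difference nonnegative under truncated subtraction. The hypothesis
characterizes `G` as the maximum by the numbers below it, and `G ≤ 2 * n` keeps later sums below the
modulus. -/
theorem LG_iff {x y b G : ℕ} (hy : y ≤ 2 * n + 1) (hG : ∀ v, v ≤ G ↔ v = 0 ∨
    ∃ z < 2 * n + 2, y ≤ z ∧ v + D.lp z ≤ D.nw x z + n) :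
    (D.LG x y b ↔ n + D.nw x y ≤ G + b) ∧ G ≤ 2 * n := by
  refine ⟨?_, ?_⟩
  swap
  · rcases (hG G).1 le_rfl with h | ⟨z, h1, h2, h3⟩
    · omega
    · have := D.nw_le x z
      omega
  have h1 : n + D.nw x y ≤ G + b ↔ n + D.nw x y - b ≤ G := by omega
  rw [h1, hG]
  constructor
  · rintro ⟨y', h2, h3, h4⟩
    have := D.lp_le y'
    by_cases h : n + D.nw x y - b = 0
    · exact Or.inl h
    · exact Or.inr ⟨y', by omega, h2, by omega⟩
  · rintro (h | ⟨y', h2, h3, h4⟩)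
    · have := D.lp_le y
      exact ⟨y, le_rfl, hy, by omega⟩
    · exact ⟨y', h3, by omega, by omega⟩

theorem TG_iff {xt x y b G : ℕ} (hx : x ≤ xt) (hxt : xt < 2 * n + 2) (hG : ∀ v, v ≤ G ↔ v = 0 ∨
    ∃ z < 2 * n + 2, x ≤ z ∧ z ≤ xt ∧ v + D.tp z ≤ D.nw z y + n) :
    (D.TG xt x y b ↔ b + n ≤ G) ∧ G ≤ 2 * n := by
  refine ⟨?_, ?_⟩
  swap
  · rcases (hG G).1 le_rfl with h | ⟨z, h1, h2, h3, h4⟩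
    · omega
    · have := D.nw_le z y
      omega
  rw [hG]
  constructor
  · rintro ⟨x', h1, h2, h3⟩
    exact Or.inr ⟨x', by omega, h1, h2, by omega⟩
  · rintro (h | ⟨x', h1, h2, h3, h4⟩)
    · have := D.tp_le x
      exact ⟨x, le_rfl, hx, by omega⟩
    · exact ⟨x', h2, h3, by omega⟩

end Disc

/-- The update of a running maximum that is described by the set of its lower bounds; the default 0
stands for an empty range. -/
theorem le_max_iff_exists {B v : ℕ} {p : ℕ → ℕ → Prop} {k : ℕ}
    (hB : ∀ w, w ≤ B ↔ w = 0 ∨ ∃ z < k, p z w) (hv : ∀ w, w ≤ v ↔ p k w) (w : ℕ) :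
    w ≤ max B v ↔ w = 0 ∨ ∃ z < k + 1, p z w := by
  rw [le_max_iff, hB, hv]
  constructor
  · rintro ((h | ⟨z, h1, h2⟩) | h)
    · exact Or.inl h
    · exact Or.inr ⟨z, by omega, h2⟩
    · exact Or.inr ⟨k, by omega, h⟩
  · rintro (h | ⟨z, h1, h2⟩)
    · exact Or.inl (Or.inl h)
    · by_cases hz : z = k
      · exact Or.inr (hz ▸ h2)
      · exact Or.inl (Or.inr ⟨z, by omega, h2⟩)

namespace Code

variable {n : ℕ} (I : Instance n)

theorem Tables.hit {D : Disc n} {m : Bool} {σ : St Rg Ar} (h : Tables D m σ) (y x : ℕ) :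
    D.hit y x = if 0 < σ.arr (aRC m) y ∧ σ.arr (aRC m) y < x + 1 then 1 else 0 := by
  by_cases hs : ∃ s, D.Y s = y
  · obtain ⟨s, rfl⟩ := hs
    rw [h.rc]
    by_cases hx : D.X s < x
    · rw [if_pos (by omega), Disc.hit_eq_one]; exact ⟨s, rfl, hx⟩
    · rw [if_neg (by omega), Disc.hit_eq_zero]
      rintro ⟨s', h1, h2⟩
      rw [D.injY h1] at h2
      exact hx h2
  · rw [h.rc_zero y fun s hs' => hs ⟨s, hs'⟩, if_neg (by omega), Disc.hit_eq_zero]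
    rintro ⟨s', h1, h2⟩
    exact hs ⟨s', h1⟩

theorem Tables.congr {D : Disc n} {m : Bool} {σ τ : St Rg Ar} (h : Tables D m σ)
    (h1 : τ.arr (aRC m) = σ.arr (aRC m)) (h2 : τ.arr (aLC m) = σ.arr (aLC m))
    (h3 : τ.arr (aTC m) = σ.arr (aTC m)) : Tables D m τ := by
  constructor
  · rw [h1]; exact h.rc
  · rw [h1]; exact h.rc_zero
  · rw [h2]; exact h.lc
  · rw [h3]; exact h.tc

theorem run_best (e : E) (σ : St Rg Ar) :
    ((Pr.set .v e ;; when [.lt Rg.best Rg.v] (.set .best Rg.v)).run I σ).reg .best =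
      max (σ.reg .best) (e.ev I σ) := by
  simp only [run_seq, run_set, run_when]
  by_cases h : σ.reg .best < e.ev I σ
  · rw [if_pos (by simp [Ex.ev, h])]
    simp [Ex.ev, h.le]
  · rw [if_neg (by simp [Ex.ev, h])]
    simp at h
    simp [h]

/-- The accumulator is used before the site of row `z` is added to it, since `D.nw x z` counts only
the rows strictly above `z`. -/
theorem run_tabBody {D : Disc n} {m : Bool} {σ : St Rg Ar} {yr : Rg}
    {x y : ℕ} (h : Tables D m σ) (hy : σ.reg yr = y) (hx : σ.reg .x = x) (hx' : x < 2 * n + 2)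
    {z : ℕ} (hz : σ.reg .z = z) (hz' : z < 2 * n + 2) (ha : σ.reg .acc = D.nw x z) :
    ((tabBody m yr).run I σ).reg .acc = D.nw x (z + 1) ∧
    ((tabBody m yr).run I σ).reg .best =
      (if y ≤ z then max (σ.reg .best) (D.nw x z + n - D.lp z) else σ.reg .best) ∧
    ∀ x', ((tabBody m yr).run I σ).arr .W x' =
      if y = z ∧ x' = x then D.nw x z else σ.arr .W x' := by
  have hn := D.nw_le x z
  set c1 : C := when [.eq Rg.z yr] (.put .W Rg.x Rg.acc) with hc1
  set c2 : C := when [.lt yr (Rg.z + num 1)] (.set .v (Rg.acc + .size - .arr (aLC m) Rg.z) ;;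
    when [.lt Rg.best Rg.v] (.set .best Rg.v)) with hc2
  set c3 : C := when [.lt (num 0) (.arr (aRC m) Rg.z), .lt (.arr (aRC m) Rg.z) (Rg.x + num 1)]
    (.set .acc (Rg.acc + num 1)) with hc3
  change (c3.run I (c2.run I (c1.run I σ))).reg .acc = _ ∧
    (c3.run I (c2.run I (c1.run I σ))).reg .best = _ ∧
    ∀ x', (c3.run I (c2.run I (c1.run I σ))).arr .W x' = _
  have r1 : ∀ r', (c1.run I σ).reg r' = σ.reg r' := fun _ => run_reg I rfl σ
  have a1 : (c1.run I σ).arr (aLC m) = σ.arr (aLC m) := run_arr I (by cases m <;> rfl) σ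
  have w1 : ∀ x', (c1.run I σ).arr .W x' = if y = z ∧ x' = x then D.nw x z else σ.arr .W x' := by
    intro x'
    rw [hc1, run_when]
    by_cases hh : z = y
    · rw [if_pos (by simp [Ex.ev, hy, hz, hh])]
      simp [Pr.run, Ex.ev, hx, hh, ha]
    · rw [if_neg (by simp [Ex.ev, hy, hz, hh]), if_neg (fun h' => hh h'.1.symm)]
  have t1 : Tables D m (c1.run I σ) := h.congr (run_arr I (by cases m <;> rfl) σ)
    (run_arr I (by cases m <;> rfl) σ) (run_arr I (by cases m <;> rfl) σ)
  generalize c1.run I σ = τ at r1 a1 w1 t1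
  have w2 : (c2.run I τ).arr .W = τ.arr .W := run_arr I rfl τ
  have t2 : Tables D m (c2.run I τ) := t1.congr (run_arr I (by cases m <;> rfl) τ)
    (run_arr I (by cases m <;> rfl) τ) (run_arr I (by cases m <;> rfl) τ)
  have x2 : (c2.run I τ).reg .x = x := by rw [run_reg I rfl, r1, hx]
  have z2 : (c2.run I τ).reg .z = z := by rw [run_reg I rfl, r1, hz]
  have k2 : (c2.run I τ).reg .acc = D.nw x z := by rw [run_reg I rfl, r1, ha]
  have b2 : (c2.run I τ).reg .best =
      (if y ≤ z then max (σ.reg .best) (D.nw x z + n - D.lp z) else σ.reg .best) := by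
    rw [hc2, run_when]
    by_cases hh : y ≤ z
    · rw [if_pos, run_best, if_pos hh, r1]
      · simp (disch := omega) [Ex.ev, ev_sub, r1, hz, ha, Nat.mod_eq_of_lt, t1.lc]
      · simp (disch := omega) [Ex.ev, r1, hz, hy, Nat.mod_eq_of_lt]; omega
    · rw [if_neg, if_neg hh, r1]
      simp (disch := omega) [Ex.ev, r1, hz, hy, Nat.mod_eq_of_lt]; omega
  generalize c2.run I τ = υ at w2 t2 x2 z2 k2 b2
  refine ⟨?_, by rw [run_reg I rfl, b2], fun x' => by rw [run_arr I rfl, w2, w1]⟩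
  rw [D.nw_succ, t2.hit, hc3, run_when]
  by_cases hh : 0 < υ.arr (aRC m) z ∧ υ.arr (aRC m) z < x + 1
  · rw [if_pos, if_pos hh]
    · simp (disch := omega) [Pr.run, Ex.ev, k2, Nat.mod_eq_of_lt]
    · simp (disch := omega) [Ex.ev, x2, z2, Nat.mod_eq_of_lt]
      omega
  · rw [if_neg, if_neg hh, k2, add_zero]
    simp (disch := omega) [Ex.ev, x2, z2, Nat.mod_eq_of_lt]
    omega

theorem run_tabRow {D : Disc n} {m : Bool} {σ : St Rg Ar} {yr : Rg} (hyr : yr = .y ∨ yr = .y1)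
    {x y : ℕ} (h : Tables D m σ) (hy : σ.reg yr = y) (hx : σ.reg .x = x) (hx' : x < 2 * n + 2) :
    (∀ v, v ≤ ((tabRow m yr).run I σ).reg .best ↔ v = 0 ∨
      ∃ z < 2 * n + 2, y ≤ z ∧ v + D.lp z ≤ D.nw x z + n) ∧
    (y < 2 * n + 2 → ((tabRow m yr).run I σ).arr .W x = D.nw x y) ∧
      ∀ x' ≠ x, ((tabRow m yr).run I σ).arr .W x' = σ.arr .W x' := by
  simp only [tabRow, run_seq, run_set, ev_zero]
  have hl := run_for I (c := tabBody m yr) (r := .z) (σ := (σ.set .acc 0).set .best 0)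
    (fun z υ => υ.reg .acc = D.nw x z ∧ (∀ v, v ≤ υ.reg .best ↔ v = 0 ∨
      ∃ z' < z, y ≤ z' ∧ v + D.lp z' ≤ D.nw x z' + n) ∧ (y < z → υ.arr .W x = D.nw x y) ∧
      ∀ x' ≠ x, υ.arr .W x' = σ.arr .W x') ?_ ?_
  · exact hl.2
  · simp [D.nw_zero]
  · rintro z υ hz hB hzr ⟨h1, h2, h3, h4⟩
    have hxυ : υ.reg .x = x := by rw [hB.reg .x rfl]; simp [hx]
    have hyυ : υ.reg yr = y := by
      rw [hB.reg yr (by rcases hyr with rfl | rfl <;> rfl)]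
      rcases hyr with rfl | rfl <;> simp [hy]
    have tυ : Tables D m υ := h.congr (hB.arr _ (by cases m <;> rfl))
      (hB.arr _ (by cases m <;> rfl)) (hB.arr _ (by cases m <;> rfl))
    obtain ⟨g1, g2, g3⟩ := run_tabBody I tυ hyυ hxυ hx' hzr hz h1
    simp only [St.set_reg, reduceCtorEq, if_false, St.set_arr]
    refine ⟨g1, fun v => ?_, fun hyz => ?_, fun x' hx' => ?_⟩
    · rw [g2]
      by_cases hyz : y ≤ z
      · rw [if_pos hyz]
        exact le_max_iff_exists (p := fun z' v => y ≤ z' ∧ v + D.lp z' ≤ D.nw x z' + n) h2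
          (fun w => by have := D.lp_le z; simp only [hyz, true_and]; omega) v
      · rw [if_neg hyz, h2]
        refine or_congr_right ⟨fun ⟨z', h5, h6⟩ => ⟨z', by omega, h6⟩,
          fun ⟨z', h5, h6⟩ => ⟨z', by omega, h6⟩⟩
    · rw [g3]
      by_cases hyz' : y = z
      · rw [if_pos ⟨hyz', rfl⟩, hyz']
      · rw [if_neg (fun hh => hyz' hh.1), h3 (by omega)]
    · rw [g3, if_neg (fun hh => hx' hh.2), h4 x' hx']

theorem run_tab {D : Disc n} {m : Bool} {σ : St Rg Ar} {yr : Rg} (hyr : yr = .y ∨ yr = .y1)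
    {y : ℕ} (h : Tables D m σ) (hy : σ.reg yr = y) (hy' : y < 2 * n + 2) :
    ∀ x < 2 * n + 2, ((tab m yr).run I σ).arr .W x = D.nw x y ∧
    ∀ b, (D.LG x y b ↔ n + D.nw x y ≤ ((tab m yr).run I σ).arr .GL x + b) ∧
      ((tab m yr).run I σ).arr .GL x ≤ 2 * n := by
  unfold tab
  refine run_for I (c := tabRow m yr ;; .put .GL Rg.x Rg.best) (r := .x) (σ := σ)
    (fun k τ => ∀ x < k, τ.arr .W x = D.nw x y ∧
    ∀ b, (D.LG x y b ↔ n + D.nw x y ≤ τ.arr .GL x + b) ∧ τ.arr .GL x ≤ 2 * n) (fun x h => absurd h (by omega)) ?_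
  intro k τ hk hA hs ih x hx
  have hy0 : τ.reg yr = y := by
    rw [← hy, hA.reg yr (by rcases hyr with rfl | rfl <;> rfl)]
  have t0 : Tables D m τ := h.congr (hA.arr _ (by cases m <;> rfl))
    (hA.arr _ (by cases m <;> rfl)) (hA.arr _ (by cases m <;> rfl))
  obtain ⟨h1, h2, h3⟩ := run_tabRow I hyr t0 hy0 hs hk
  have hux : ((tabRow m yr).run I τ).reg .x = k := by rw [run_reg I rfl, hs]
  have hg : ((tabRow m yr).run I τ).arr .GL = τ.arr .GL := run_arr I rfl _
  simp only [run_seq, run_put, Ex.ev, hux, St.set_arr, St.put_arr, true_and, reduceCtorEq, false_and,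
    if_false]
  by_cases hxk : x = k
  · subst hxk
    simp only [if_true]
    exact ⟨h2 hy', fun b => D.LG_iff (by omega) h1⟩
  · rw [h3 x hxk, if_neg hxk, hg]
    exact ih x (by omega)

/-- The same maximum for the transposed condition. Here the witness column is limited to `xt`,
because the top ports beyond it belong to the other half. -/
theorem run_htRow {D : Disc n} {m : Bool} {σ : St Rg Ar} {xt x y : ℕ} (h : Tables D m σ)
    (hu : σ.reg .u = xt) (hW : ∀ x < 2 * n + 2, σ.arr .W x = D.nw x y)
    (hxt : xt ≤ 2 * n) (hx : σ.reg .x = x) (v : ℕ) :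
    v ≤ ((htRow m).run I σ).reg .best ↔ v = 0 ∨
      ∃ z < 2 * n + 2, x ≤ z ∧ z ≤ xt ∧ v + D.tp z ≤ D.nw z y + n := by
  revert v
  simp only [htRow, run_seq, run_set, ev_zero]
  refine run_for I (σ := σ.set .best 0) (fun z υ => ∀ v, v ≤ υ.reg .best ↔ v = 0 ∨
      ∃ z' < z, x ≤ z' ∧ z' ≤ xt ∧ v + D.tp z' ≤ D.nw z' y + n) (by simp) ?_
  intro z υ hz hB hzr h2 v
  have hxυ : υ.reg .x = x := by rw [hB.reg .x rfl]; simp [hx]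
  have huυ : υ.reg .u = xt := by rw [hB.reg .u rfl]; simp [hu]
  have hwυ : υ.arr .W z = D.nw z y := by rw [hB.arr .W rfl, St.set_arr, hW z hz]
  have tυ : Tables D m υ := h.congr (hB.arr _ (by cases m <;> rfl))
    (hB.arr _ (by cases m <;> rfl)) (hB.arr _ (by cases m <;> rfl))
  have n1 := D.nw_le z y
  have n2 := D.tp_le z
  rw [St.set_reg, if_neg (by decide), run_when]
  by_cases hh : x ≤ z ∧ z ≤ xt
  · rw [if_pos, run_best]
    · have e1 : Ex.ev I υ (.arr .W Rg.z + .size - .arr (aTC m) Rg.z : E) =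
          D.nw z y + n - D.tp z := by
        simp (disch := omega) [Ex.ev, ev_sub, hzr, hwυ, Nat.mod_eq_of_lt, tυ.tc]
      rw [e1]
      exact le_max_iff_exists
        (p := fun z' v => x ≤ z' ∧ z' ≤ xt ∧ v + D.tp z' ≤ D.nw z' y + n) h2
        (fun w => by simp only [hh, true_and]; omega) v
    · simp (disch := omega) [Ex.ev, hzr, hxυ, huυ, Nat.mod_eq_of_lt]; omega
  · rw [if_neg, h2]
    · refine or_congr_right ⟨fun ⟨z', h5, h6⟩ => ⟨z', by omega, h6⟩,
        fun ⟨z', h5, h6, h7, h8⟩ => ⟨z', ?_, h6, h7, h8⟩⟩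
      have : z' ≠ z := fun hz' => hh ⟨hz' ▸ h6, hz' ▸ h7⟩
      omega
    · simp (disch := omega) [Ex.ev, hzr, hxυ, huυ, Nat.mod_eq_of_lt]; omega

theorem run_ht {D : Disc n} {m : Bool} {σ : St Rg Ar} {xt y : ℕ} (h : Tables D m σ)
    (hu : σ.reg .u = xt) (hxt : xt ≤ 2 * n) (hW : ∀ x < 2 * n + 2, σ.arr .W x = D.nw x y) {x : ℕ}
    (hx : x ≤ xt) (b : ℕ) :
    (D.TG xt x y b ↔ b + n ≤ ((ht m).run I σ).arr .HT x) ∧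
      ((ht m).run I σ).arr .HT x ≤ 2 * n := by
  suffices hh : ∀ x < 2 * n + 2, ∀ v, v ≤ ((ht m).run I σ).arr .HT x ↔ v = 0 ∨
      ∃ z < 2 * n + 2, x ≤ z ∧ z ≤ xt ∧ v + D.tp z ≤ D.nw z y + n from
    D.TG_iff hx (by omega) (hh x (by omega))
  unfold ht
  refine run_for I (σ := σ) (fun k τ => ∀ x < k, ∀ v, v ≤ τ.arr .HT x ↔ v = 0 ∨
      ∃ z < 2 * n + 2, x ≤ z ∧ z ≤ xt ∧ v + D.tp z ≤ D.nw z y + n)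
      (fun x h => absurd h (by omega)) ?_
  intro k τ hk hA hs ih x hx v
  have t0 : Tables D m τ := h.congr (hA.arr _ (by cases m <;> rfl))
    (hA.arr _ (by cases m <;> rfl)) (hA.arr _ (by cases m <;> rfl))
  have h1 := run_htRow I t0 ((hA.reg .u rfl).trans hu) (by rw [hA.arr .W rfl]; exact hW) hxt hs
  have hux : ((htRow m).run I τ).reg .x = k := by rw [run_reg I rfl, hs]
  have hg : ((htRow m).run I τ).arr .HT = τ.arr .HT := run_arr I rfl _
  simp only [run_seq, run_put, Ex.ev, hux, St.set_arr, St.put_arr, true_and]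
  by_cases hxk : x = k
  · subst hxk
    simp only [if_true]
    exact h1 v
  · rw [if_neg hxk, hg]
    exact ih x (by omega) v

end Code

end BoundaryLabeling

/-! ### Correctness of the dynamic program -/

namespace BoundaryLabeling

open Finset

namespace Code

variable {n : ℕ} (I : Instance n)

/-- The array `M` holds the leftmost columns in which paths can arrive in row `y`. -/
def Leftmost (D : Disc n) (xt y : ℕ) (M : ℕ → ℕ) : Prop :=
  ∀ b < 2 * n + 2, ∀ x ≤ xt, M b ≤ x ↔ D.Reach xt y x b

/-- The array `F` says which rows below `y` can be the end of a path. -/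
def Ends (D : Disc n) (xt y : ℕ) (F : ℕ → ℕ) : Prop :=
  ∀ y' < y, F y' < 2 ∧ (F y' = 1 ↔ ∃ e, D.Full xt y' e)

theorem ev_twoN (σ : St Rg Ar) : Ex.ev I σ twoN = 2 * n := by
  change (n + n) % (4 * n + 8) = _
  rw [Nat.mod_eq_of_lt (by omega)]; omega

theorem ev_inf (σ : St Rg Ar) : Ex.ev I σ inf = 2 * n + 1 := by
  change (Ex.ev I σ twoN + 1) % (4 * n + 8) = _
  rw [ev_twoN, Nat.mod_eq_of_lt (by omega)]

/-- By `exists_full_iff` the entry of `M` for the prescribed number of sites on the left decides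
whether a path can end here; no other state has to be searched. -/
theorem run_chk {D : Disc n} {m : Bool} {σ : St Rg Ar} {xt y : ℕ} (h : Tables D m σ)
    (hu : σ.reg .u = xt) (hxt : xt ≤ 2 * n) (hy : σ.reg .y = y)
    (hW : σ.arr .W xt = D.nw xt y)
    (hG : ∀ b, D.LG xt y b ↔ n + D.nw xt y ≤ σ.arr .GL xt + b)
    (hGle : σ.arr .GL xt ≤ 2 * n)
    (hM : Leftmost D xt y (σ.arr .M)) (hF : Ends D xt y (σ.arr (aF m))) :
    Ends D xt (y + 1) (((chk m).run I σ).arr (aF m)) := by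
  have n1 := D.nw_le xt y
  have n2 := D.tp_le xt
  have a1 : aF m ≠ .M ∧ aF m ≠ .W ∧ aF m ≠ .GL ∧ aF m ≠ aTC m := by cases m <;> decide
  obtain ⟨a1, a2, a3, a4⟩ := a1
  have hc : ∀ y', ((chk m).run I σ).arr (aF m) y' = if y' = y then
      (if D.tp xt ≤ D.nw xt y ∧ σ.arr .M (D.nw xt y - D.tp xt) ≤ xt ∧
        n + D.nw xt y ≤ σ.arr .GL xt + (D.nw xt y - D.tp xt) then 1 else 0)
      else σ.arr (aF m) y' := by
    intro y'
    have b1 := h.tc xt (by omega)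
    simp only [chk, run_seq, run_put]
    by_cases c1 : D.tp xt ≤ D.nw xt y
    · rw [run_when_pos]
      · simp only [run_seq, run_set]
        by_cases c2 : σ.arr .M (D.nw xt y - D.tp xt) ≤ xt ∧
          n + D.nw xt y ≤ σ.arr .GL xt + (D.nw xt y - D.tp xt)
        · rw [run_when_pos]
          · by_cases hyy : y' = y <;> simp [run_put, Ex.ev, hy, c1, c2, hyy]
          · simp (disch := omega) [Ex.ev, ev_sub, hu, b1, a1.symm, a2.symm, a3.symm, a4.symm, hW,
              Nat.mod_eq_of_lt]
            omega
        · rw [run_when_neg]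
          · simp [Ex.ev, hy, c2]
          · simp (disch := omega) [Ex.ev, ev_sub, hu, b1, a1.symm, a2.symm, a3.symm, a4.symm, hW,
              Nat.mod_eq_of_lt]
            omega
      · simp (disch := omega) [Ex.ev, hu, b1, a2.symm, a4.symm, hW, Nat.mod_eq_of_lt]
        omega
    · rw [run_when_neg]
      · simp [Ex.ev, hy, c1]
      · simp (disch := omega) [Ex.ev, hu, b1, a2.symm, a4.symm, hW, Nat.mod_eq_of_lt]
        omega
  intro y' hy'
  rw [hc]
  by_cases hyy : y' = y
  · subst hyy
    rw [if_pos rfl, D.exists_full_iff, hG, ← hM _ (by omega) _ le_rfl]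
    split_ifs with h1 <;> simp [h1]
  · rw [if_neg hyy]
    exact hF y' (by omega)

theorem run_stepCell {D : Disc n} {m : Bool} {σ : St Rg Ar} {xt x y b : ℕ} (h : Tables D m σ)
    (hy : σ.reg .y = y) (hx : σ.reg .x = x) (hb : σ.reg .b = b)
    (hxt : xt ≤ 2 * n) (hxx : x ≤ xt) (hb' : b < 2 * n + 2)
    (hM : Leftmost D xt y (σ.arr .M))
    (hT : ∀ b, D.TG xt x y b ↔ b + n ≤ σ.arr .HT x)
    (hW : σ.arr .W x = D.nw x (y + 1)) (hGle : σ.arr .GL x ≤ 2 * n) (hTle : σ.arr .HT x ≤ 2 * n)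
    (hG : ∀ b, D.LG x (y + 1) b ↔ n + D.nw x (y + 1) ≤ σ.arr .GL x + b) :
    (∀ b', b' ≠ b → ((stepCell m).run I σ).arr .M2 b' = σ.arr .M2 b') ∧
    (D.hit y x ≤ b ∧ D.Reach xt y x (b - D.hit y x) ∧ D.TG xt x y (b - D.hit y x) ∧
      D.LG x (y + 1) b → ((stepCell m).run I σ).arr .M2 b = x) ∧
    (¬ (D.hit y x ≤ b ∧ D.Reach xt y x (b - D.hit y x) ∧ D.TG xt x y (b - D.hit y x) ∧
      D.LG x (y + 1) b) → ((stepCell m).run I σ).arr .M2 b = σ.arr .M2 b) := by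
  set c1 : C := .set .d (num 0) ;;
    when [.lt (num 0) (.arr (aRC m) Rg.y), .lt (.arr (aRC m) Rg.y) (Rg.x + num 1)]
      (.set .d (num 1)) with hc1
  set c2 : C := when [.lt Rg.d (Rg.b + num 1), .lt (.arr .M (Rg.b - Rg.d)) (Rg.x + num 1),
      .lt (Rg.b - Rg.d + .size) (.arr .HT Rg.x + num 1),
      .lt (.arr .W Rg.x + .size) (.arr .GL Rg.x + Rg.b + num 1)]
    (.put .M2 Rg.b Rg.x) with hc2
  have hs : (stepCell m).run I σ = c2.run I (c1.run I σ) := rfl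
  have hn := D.nw_le x (y + 1)
  have hd : (c1.run I σ).reg .d = D.hit y x := by
    rw [h.hit, hc1, run_seq, run_set, run_when]
    by_cases hh : 0 < σ.arr (aRC m) y ∧ σ.arr (aRC m) y < x + 1
    · rw [if_pos, if_pos hh, run_set]
      · simp [ev_one]
      · simp (disch := omega) [Ex.ev, hy, hx, Nat.mod_eq_of_lt]; omega
    · rw [if_neg, if_neg hh]
      · simp [ev_zero]
      · simp (disch := omega) [Ex.ev, hy, hx, Nat.mod_eq_of_lt]; omega
  rw [hs]
  have r1 : ∀ r', r' ≠ .d → (c1.run I σ).reg r' = σ.reg r' := fun r' hr =>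
    run_reg I (by revert r'; cases m <;> decide) σ
  have a1 : (c1.run I σ).arr = σ.arr := funext fun a => run_arr I rfl σ
  generalize c1.run I σ = τ at hd r1 a1
  have hiff : (D.hit y x ≤ b ∧ D.Reach xt y x (b - D.hit y x) ∧ D.TG xt x y (b - D.hit y x) ∧
      D.LG x (y + 1) b) ↔ ∀ e ∈ ([.lt Rg.d (Rg.b + num 1), .lt (.arr .M (Rg.b - Rg.d))
        (Rg.x + num 1), .lt (Rg.b - Rg.d + .size) (.arr .HT Rg.x + num 1),
        .lt (.arr .W Rg.x + .size) (.arr .GL Rg.x + Rg.b + num 1)] : List E), e.ev I τ ≠ 0 := by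
    rw [hT, hG, ← hM (b - D.hit y x) (by omega) x hxx]
    simp (disch := first | decide | omega) [Ex.ev, ev_sub, hd, r1, a1, hx, hb, hW,
      Nat.mod_eq_of_lt]
    omega
  rw [hiff, hc2, run_when]
  refine ⟨fun b' hb' => ?_, fun hh => ?_, fun hh => ?_⟩
  · split_ifs
    · rw [run_put, St.put_arr, if_neg, a1]
      simp [Ex.ev, r1, hb, hb']
    · rw [a1]
  · rw [if_pos hh, run_put, St.put_arr]
    simp [Ex.ev, r1, hb, hx]
  · rw [if_neg hh, a1]

/-- The columns are tried in increasing order, and the cell keeps the value `2 * n + 1` until the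
first admissible column is stored. So it holds the least `x₀` in `reach_succ`, and comparing it with
`x` decides the existence of some `x₀ ≤ x`. -/
theorem run_stepRow {D : Disc n} {m : Bool} {σ : St Rg Ar} {xt y b : ℕ} (h : Tables D m σ)
    (hu : σ.reg .u = xt) (hy : σ.reg .y = y) (hb : σ.reg .b = b)
    (hxt : xt ≤ 2 * n) (hb' : b < 2 * n + 2) (hM : Leftmost D xt y (σ.arr .M))
    (hT : ∀ x ≤ xt, ∀ b, D.TG xt x y b ↔ b + n ≤ σ.arr .HT x)
    (hW : ∀ x ≤ xt, σ.arr .W x = D.nw x (y + 1)) (hGle : ∀ x ≤ xt, σ.arr .GL x ≤ 2 * n)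
    (hTle : ∀ x ≤ xt, σ.arr .HT x ≤ 2 * n)
    (hG : ∀ x ≤ xt, ∀ b, D.LG x (y + 1) b ↔ n + D.nw x (y + 1) ≤ σ.arr .GL x + b) :
    (∀ x ≤ xt, ((stepRow m).run I σ).arr .M2 b ≤ x ↔ D.Reach xt (y + 1) x b) ∧
    ∀ b' ≠ b, ((stepRow m).run I σ).arr .M2 b' = σ.arr .M2 b' := by
  simp only [stepRow, run_seq, run_put, ev_inf]
  have e1 : Ex.ev I σ (Rg.b : E) = b := hb
  rw [e1]
  set c : C := when [.eq (.arr .M2 Rg.b) inf, .lt Rg.x (Rg.u + num 1)] (stepCell m) with hc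
  have hl := run_for I (c := c) (r := .x) (σ := σ.put .M2 b (2 * n + 1))
    (fun k τ => (∀ x ≤ 2 * n, τ.arr .M2 b ≤ x ↔ ∃ x₀ ≤ x, x₀ < k ∧ x₀ ≤ xt ∧
      D.hit y x₀ ≤ b ∧ D.Reach xt y x₀ (b - D.hit y x₀) ∧ D.TG xt x₀ y (b - D.hit y x₀) ∧
      D.LG x₀ (y + 1) b) ∧ τ.arr .M2 b ≤ 2 * n + 1 ∧ ∀ b' ≠ b, τ.arr .M2 b' = σ.arr .M2 b') ?_ ?_
  · refine ⟨fun x hx => ?_, hl.2.2⟩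
    rw [hl.1 x (by omega), D.reach_succ]
    exact ⟨fun ⟨x₀, h1, h2, h3⟩ => ⟨x₀, h1, h3⟩, fun ⟨x₀, h1, h3⟩ => ⟨x₀, h1, by omega, h3⟩⟩
  · simp
    exact fun b' h1 h2 => absurd h2 h1
  · intro k τ hk hA hkr ⟨h1, h2, h3⟩
    have hub : τ.reg .u = xt := by rw [hA.reg .u (by cases m <;> rfl)]; exact hu
    have hbb : τ.reg .b = b := by rw [hA.reg .b (by cases m <;> rfl)]; exact hb
    have hyb : τ.reg .y = y := by rw [hA.reg .y (by cases m <;> rfl)]; exact hy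
    have ha : ∀ a, a ≠ .M2 → τ.arr a = σ.arr a := fun a ha => by
      rw [hA.arr a (by revert a; cases m <;> decide)]
      funext i
      simp [ha]
    have t0 : Tables D m τ := h.congr (ha _ (by cases m <;> decide)) (ha _ (by cases m <;> decide))
      (ha _ (by cases m <;> decide))
    simp only [St.set_arr]
    rw [hc, run_when]
    have hif : (∀ e ∈ ([.eq (.arr .M2 Rg.b) inf, .lt Rg.x (Rg.u + num 1)] : List E),
        e.ev I τ ≠ 0) ↔ τ.arr .M2 b = 2 * n + 1 ∧ k ≤ xt := by
      rw [List.forall_mem_cons, Ex.ev, ev_inf]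
      simp (disch := omega) [Ex.ev, hkr, hbb, hub, Nat.mod_eq_of_lt]
    by_cases hh : τ.arr .M2 b = 2 * n + 1 ∧ k ≤ xt
    · rw [if_pos (hif.2 hh)]
      obtain ⟨g1, g2, g3⟩ := run_stepCell I t0 hyb hkr hbb hxt hh.2 hb' (by rwa [ha .M (by decide)])
        (by rw [ha .HT (by decide)]; exact hT k hh.2) (by rw [ha .W (by decide)]; exact hW k hh.2)
        (by rw [ha .GL (by decide)]; exact hGle k hh.2)
        (by rw [ha .HT (by decide)]; exact hTle k hh.2)
        (by rw [ha .GL (by decide)]; exact hG k hh.2)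
      refine ⟨fun x hx => ?_, ?_, fun b' hb' => by rw [g1 b' hb', h3 b' hb']⟩
      · by_cases hC : D.hit y k ≤ b ∧ D.Reach xt y k (b - D.hit y k) ∧
          D.TG xt k y (b - D.hit y k) ∧ D.LG k (y + 1) b
        · rw [g2 hC]
          constructor
          · exact fun hkx => ⟨k, hkx, by omega, hh.2, hC⟩
          · rintro ⟨x₀, i1, i2, i3, i4⟩
            by_contra hlt
            have := (h1 x₀ (by omega)).2 ⟨x₀, le_rfl, by omega, i3, i4⟩
            omega
        · rw [g3 hC, h1 x hx]
          constructor
          · rintro ⟨x₀, i1, i2, i3⟩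
            exact ⟨x₀, i1, by omega, i3⟩
          · rintro ⟨x₀, i1, i2, i3⟩
            refine ⟨x₀, i1, ?_, i3⟩
            have : x₀ ≠ k := fun hx0 => hC (hx0 ▸ i3.2)
            omega
      · by_cases hC : D.hit y k ≤ b ∧ D.Reach xt y k (b - D.hit y k) ∧
          D.TG xt k y (b - D.hit y k) ∧ D.LG k (y + 1) b
        · rw [g2 hC]; omega
        · rw [g3 hC]; exact h2
    · rw [if_neg (fun h' => hh (hif.1 h'))]
      refine ⟨fun x hx => ?_, h2, h3⟩
      rw [h1 x hx]
      constructor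
      · rintro ⟨x₀, i1, i2, i3⟩
        exact ⟨x₀, i1, by omega, i3⟩
      · rintro ⟨x₀, i1, i2, i3, i4⟩
        by_cases hx0 : x₀ = k
        · subst hx0
          have hlt : τ.arr .M2 b ≤ 2 * n := by
            have : τ.arr .M2 b ≠ 2 * n + 1 := fun h' => hh ⟨h', i3⟩
            omega
          obtain ⟨x₁, j1, j2, j3⟩ := (h1 _ hlt).1 le_rfl
          exact ⟨x₁, by omega, j2, j3⟩
        · exact ⟨x₀, i1, by omega, i3, i4⟩

/-- The new row is collected in `M2`, because the entry for `b` depends on an old entry of `M` whose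
index may be smaller than `b`. It is copied only when all entries are known. -/
theorem run_step {D : Disc n} {m : Bool} {σ : St Rg Ar} {xt y : ℕ} (h : Tables D m σ)
    (hu : σ.reg .u = xt) (hy : σ.reg .y = y) (hxt : xt ≤ 2 * n) (hM : Leftmost D xt y (σ.arr .M))
    (hT : ∀ x ≤ xt, ∀ b, D.TG xt x y b ↔ b + n ≤ σ.arr .HT x)
    (hW : ∀ x ≤ xt, σ.arr .W x = D.nw x (y + 1)) (hGle : ∀ x ≤ xt, σ.arr .GL x ≤ 2 * n)
    (hTle : ∀ x ≤ xt, σ.arr .HT x ≤ 2 * n)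
    (hG : ∀ x ≤ xt, ∀ b, D.LG x (y + 1) b ↔ n + D.nw x (y + 1) ≤ σ.arr .GL x + b) :
    Leftmost D xt (y + 1) (((step m).run I σ).arr .M) := by
  simp only [step, run_seq]
  have h1 := run_for I (c := stepRow m) (r := .b) (σ := σ) (fun k τ => ∀ b < k, ∀ x ≤ xt,
    τ.arr .M2 b ≤ x ↔ D.Reach xt (y + 1) x b) (fun b hb => absurd hb (by omega)) ?_
  · generalize (Pr.rep Rg.b (stepRow m)).run I σ = τ at h1 ⊢
    have h2 := run_for I (c := .put .M Rg.b (.arr .M2 Rg.b)) (r := .b) (σ := τ)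
      (fun k υ => ∀ b < k, υ.arr .M b = τ.arr .M2 b) (fun b hb => absurd hb (by omega)) ?_
    · intro b hb x hx
      rw [h2 b hb, h1 b hb x hx]
    · intro k υ hk hA hs ih b hb
      simp only [run_put, Ex.ev, hs, St.set_arr, St.put_arr, true_and]
      rw [hA.arr .M2 rfl]
      by_cases hbk : b = k
      · simp [hbk]
      · rw [if_neg hbk, ih b (by omega)]
  · intro k τ hk hA hs ih b hb
    have ha : ∀ a, a ≠ .M2 → τ.arr a = σ.arr a := fun a ha => by
      rw [hA.arr a (by revert a; cases m <;> decide)]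
    have t0 : Tables D m τ := h.congr (ha _ (by cases m <;> decide)) (ha _ (by cases m <;> decide))
      (ha _ (by cases m <;> decide))
    obtain ⟨g1, g2⟩ := run_stepRow I t0 (by rw [hA.reg .u (by cases m <;> rfl), hu])
      (by rw [hA.reg .y (by cases m <;> rfl), hy]) hs hxt hk (by rwa [ha .M (by decide)])
      (by rwa [ha .HT (by decide)]) (by rwa [ha .W (by decide)]) (by rwa [ha .GL (by decide)])
      (by rwa [ha .HT (by decide)]) (by rwa [ha .GL (by decide)])
    rw [St.set_arr]
    by_cases hbk : b = k
    · subst hbk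
      exact g1
    · rw [g2 b hbk]
      exact ih b (by omega)

theorem Tables.run {D : Disc n} {m : Bool} {σ : St Rg Ar} (h : Tables D m σ) {c : C}
    (hc : (c.writesA (aRC m) || c.writesA (aLC m) || c.writesA (aTC m)) = false) :
    Tables D m (c.run I σ) := by
  simp only [Bool.or_eq_false_iff] at hc
  exact h.congr (run_arr I hc.1.1 σ) (run_arr I hc.1.2 σ) (run_arr I hc.2 σ)

/-- The left condition is needed in row `y` for paths that end there and in row `y + 1` for the
transition. The top condition refers to row `y`, so its table is computed before the second call of
`tab` overwrites the site counts. -/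
theorem run_dpRow {D : Disc n} {m : Bool} {σ : St Rg Ar} {xt y : ℕ} (h : Tables D m σ)
    (hu : σ.reg .u = xt) (hy : σ.reg .y = y) (hxt : xt ≤ 2 * n) (hy' : y ≤ 2 * n)
    (hM : Leftmost D xt y (σ.arr .M)) (hF : Ends D xt y (σ.arr (aF m))) :
    Leftmost D xt (y + 1) (((dpRow m).run I σ).arr .M) ∧
      Ends D xt (y + 1) (((dpRow m).run I σ).arr (aF m)) := by
  simp only [dpRow, run_seq]
  have h1 := run_tab I (Or.inl rfl) h hy (by omega)
  have M1 : ((tab m .y).run I σ).arr .M = σ.arr .M := run_arr I (by cases m <;> rfl) σ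
  have F1 : ((tab m .y).run I σ).arr (aF m) = σ.arr (aF m) := run_arr I (by cases m <;> rfl) σ
  have u1 : ((tab m .y).run I σ).reg .u = xt := by rw [run_reg I (by cases m <;> rfl), hu]
  have y1 : ((tab m .y).run I σ).reg .y = y := by rw [run_reg I (by cases m <;> rfl), hy]
  have t1 : Tables D m ((tab m .y).run I σ) := h.run I (by cases m <;> rfl)
  generalize (tab m .y).run I σ = τ at *
  have F2 := run_chk I t1 u1 hxt y1 (h1 xt (by omega)).1 (fun b => ((h1 xt (by omega)).2 b).1)
    ((h1 xt (by omega)).2 0).2 (by rwa [M1]) (by rwa [F1])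
  have M2 : ((chk m).run I τ).arr .M = τ.arr .M := run_arr I (by cases m <;> rfl) τ
  have W2 : ((chk m).run I τ).arr .W = τ.arr .W := run_arr I (by cases m <;> rfl) τ
  have u2 : ((chk m).run I τ).reg .u = xt := by rw [run_reg I (by cases m <;> rfl), u1]
  have y2 : ((chk m).run I τ).reg .y = y := by rw [run_reg I (by cases m <;> rfl), y1]
  have t2 : Tables D m ((chk m).run I τ) := t1.run I (by cases m <;> rfl)
  rw [M1] at M2
  generalize (chk m).run I τ = υ at *
  have h3 := fun x hx b => run_ht I t2 u2 hxt (fun x hx => by rw [W2]; exact (h1 x hx).1)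
    (x := x) hx b
  have M3 : ((ht m).run I υ).arr .M = υ.arr .M := run_arr I (by cases m <;> rfl) υ
  have F3 : ((ht m).run I υ).arr (aF m) = υ.arr (aF m) := run_arr I (by cases m <;> rfl) υ
  have u3 : ((ht m).run I υ).reg .u = xt := by rw [run_reg I (by cases m <;> rfl), u2]
  have y3 : ((ht m).run I υ).reg .y = y := by rw [run_reg I (by cases m <;> rfl), y2]
  have t3 : Tables D m ((ht m).run I υ) := t2.run I (by cases m <;> rfl)
  rw [M2] at M3
  generalize (ht m).run I υ = φ at *
  have e4 : (φ.reg .y + 1) % (4 * n + 8) = y + 1 := by rw [y3, Nat.mod_eq_of_lt (by omega)]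
  simp only [run_set, Ex.ev]
  change Leftmost D xt (y + 1) (((step m).run I ((tab m .y1).run I
    (φ.set .y1 ((φ.reg .y + 1) % (4 * n + 8))))).arr .M) ∧
    Ends D xt (y + 1) (((step m).run I ((tab m .y1).run I
    (φ.set .y1 ((φ.reg .y + 1) % (4 * n + 8))))).arr (aF m))
  rw [e4]
  set ψ := φ.set .y1 (y + 1) with hψ
  have t4 : Tables D m ψ := t3.congr rfl rfl rfl
  have h5 := run_tab I (Or.inr rfl) t4 (y := y + 1) (by simp [hψ]) (by omega)
  have M5 : ((tab m .y1).run I ψ).arr .M = ψ.arr .M := run_arr I (by cases m <;> rfl) ψ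
  have F5 : ((tab m .y1).run I ψ).arr (aF m) = ψ.arr (aF m) := run_arr I (by cases m <;> rfl) ψ
  have H5 : ((tab m .y1).run I ψ).arr .HT = ψ.arr .HT := run_arr I (by cases m <;> rfl) ψ
  have u5 : ((tab m .y1).run I ψ).reg .u = xt := by
    rw [run_reg I (by cases m <;> rfl), hψ, St.set_reg, if_neg (by decide), u3]
  have y5 : ((tab m .y1).run I ψ).reg .y = y := by
    rw [run_reg I (by cases m <;> rfl), hψ, St.set_reg, if_neg (by decide), y3]
  have t5 : Tables D m ((tab m .y1).run I ψ) := t4.run I (by cases m <;> rfl)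
  rw [hψ, St.set_arr] at M5 F5 H5
  generalize (tab m .y1).run I ψ = χ at *
  refine ⟨run_step I t5 u5 y5 hxt (by rwa [M5, M3])
    (fun x hx b => by rw [H5]; exact (h3 x hx b).1) (fun x hx => (h5 x (by omega)).1)
    (fun x hx => ((h5 x (by omega)).2 0).2) (fun x hx => by rw [H5]; exact (h3 x hx 0).2)
    (fun x hx b => ((h5 x (by omega)).2 b).1), ?_⟩
  rwa [run_arr I (by cases m <;> rfl), F5, F3]

theorem run_dp {D : Disc n} {m : Bool} {σ : St Rg Ar} {xt yb : ℕ} (h : Tables D m σ)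
    (hu : σ.reg .u = xt) (hxt : xt ≤ 2 * n) (hy : σ.reg .yb = yb) (hyb : yb ≤ 2 * n + 1) :
    Leftmost D xt yb (((dp m).run I σ).arr .M) ∧ Ends D xt yb (((dp m).run I σ).arr (aF m)) := by
  simp only [dp, run_seq]
  have h1 := run_for I (c := .put .M Rg.b inf) (r := .b) (σ := σ)
    (fun k υ => ∀ b < k, υ.arr .M b = 2 * n + 1) (fun b hb => absurd hb (by omega)) ?_
  swap
  · intro k τ hk hA hs ih b hb
    rw [run_put, ev_inf]
    simp only [Ex.ev, hs, St.set_arr, St.put_arr, true_and]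
    by_cases hbk : b = k
    · simp [hbk]
    · rw [if_neg hbk, ih b (by omega)]
  have u1 := (run_reg I (c := .rep .b (.put .M Rg.b inf)) (r := .u) rfl σ).trans hu
  have y1 := (run_reg I (c := .rep .b (.put .M Rg.b inf)) (r := .yb) rfl σ).trans hy
  have t1 : Tables D m ((Pr.rep .b (.put .M Rg.b inf)).run I σ) := h.run I (by cases m <;> rfl)
  generalize (Pr.rep .b (.put .M Rg.b inf)).run I σ = τ at *
  rw [run_put, ev_zero]
  have t2 : Tables D m (τ.put .M 0 0) := t1.congr
    (by funext i; simp [show aRC m ≠ .M by cases m <;> decide])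
    (by funext i; simp [show aLC m ≠ .M by cases m <;> decide])
    (by funext i; simp [show aTC m ≠ .M by cases m <;> decide])
  -- Above the first row only `b = 0` is possible, and every column is reachable; the value `2 * n +
  -- 1` exceeds all columns up to `xt`.
  have M2 : ∀ b < 2 * n + 2, (τ.put .M 0 0).arr .M b = if b = 0 then 0 else 2 * n + 1 := by
    intro b hb
    simp [h1 b hb]
  have u2 : (τ.put .M 0 0).reg .u = xt := u1
  have y2 : (τ.put .M 0 0).reg .yb = yb := y1
  generalize τ.put .M 0 0 = υ at *
  have h3 := run_for I (c := when [.lt Rg.y Rg.yb] (dpRow m)) (r := .y) (σ := υ)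
    (fun k φ => Leftmost D xt (min k yb) (φ.arr .M) ∧ Ends D xt (min k yb) (φ.arr (aF m))) ?_ ?_
  · rwa [min_eq_right (by omega)] at h3
  · refine ⟨fun b hb x hx => ?_, fun y' hy' => absurd hy' (by omega)⟩
    rw [Nat.zero_min, D.reach_zero, St.set_arr, M2 b hb]
    split_ifs <;> simp_all; omega
  · rintro k φ hk hA hs ⟨g1, g2⟩
    have u4 : φ.reg .u = xt := by rw [hA.reg .u (by cases m <;> rfl), u2]
    have y4 : φ.reg .yb = yb := by rw [hA.reg .yb (by cases m <;> rfl), y2]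
    have t4 : Tables D m φ := t2.congr (hA.arr _ (by cases m <;> rfl))
      (hA.arr _ (by cases m <;> rfl)) (hA.arr _ (by cases m <;> rfl))
    simp only [St.set_arr]
    by_cases hky : k < yb
    · rw [run_when_pos I (by simp [Ex.ev, hs, y4, hky]), min_eq_left (by omega)]
      rw [min_eq_left (by omega)] at g1 g2
      exact run_dpRow I t4 u4 hs hxt (by omega) g1 g2
    · rw [run_when_neg I (by simp [Ex.ev, hs, y4]; omega), min_eq_right (by omega)]
      rw [min_eq_right (by omega)] at g1 g2
      exact ⟨g1, g2⟩

end Code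

end BoundaryLabeling

/-! ### The search for a cut point and the backward trace -/

namespace BoundaryLabeling

open Finset

namespace Disc

variable {n : ℕ} (D : Disc n)

/-- There are a left path and a right path that end in the point `xt`, `y`. -/
def Good (xt y : ℕ) : Prop := (∃ e, D.Full xt y e) ∧ ∃ e, D.mirror.Full (2 * n - xt) y e

/-- A row contains at most one site, so sites may be counted by rows. -/
theorem nw_eq_card (x y : ℕ) : D.nw x y = ((range y).filter fun z => D.hit z x = 1).card := by
  induction y with
  | zero => simp [nw_zero]
  | succ y ih =>
    rw [nw_succ, ih, range_add_one, filter_insert]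
    by_cases h : ∃ s, D.Y s = y ∧ D.X s < x
    · rw [if_pos (D.hit_eq_one.2 h), card_insert_of_notMem (by simp), D.hit_eq_one.2 h]
    · rw [if_neg (by rw [D.hit_eq_one]; exact h), D.hit_eq_zero.2 h, add_zero]

end Disc

namespace Code

variable {n : ℕ} (I : Instance n)

theorem run_dps {D : Disc n} {σ : St Rg Ar} {k : ℕ} (h : Tables D false σ)
    (h' : Tables D.mirror true σ) (hk : σ.reg .k = k) (hkn : k ≤ 2 * n) :
    Ends D k (2 * n + 1) ((dps.run I σ).arr .F) ∧
      Ends D.mirror (2 * n - k) (2 * n + 1) ((dps.run I σ).arr .FM) := by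
  have e0 : ∀ τ : St Rg Ar, Ex.ev I τ (twoN + num 1) = 2 * n + 1 := ev_inf I
  simp only [dps, run_seq, run_set, e0]
  set τ := (σ.set .yb (2 * n + 1)).set .u (Ex.ev I (σ.set .yb (2 * n + 1)) (Rg.k : E)) with hτ
  have tτ : Tables D false τ := h.congr rfl rfl rfl
  have tτ' : Tables D.mirror true τ := h'.congr rfl rfl rfl
  have h1 := (run_dp I tτ (xt := k) (yb := 2 * n + 1) (by simp [hτ, Ex.ev, hk]) hkn
    (by simp [hτ]) le_rfl).2
  have k1 : ((dp false).run I τ).reg .k = k := by rw [run_reg I rfl]; simp [hτ, hk]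
  have y1 : ((dp false).run I τ).reg .yb = 2 * n + 1 := by rw [run_reg I rfl]; simp [hτ]
  have t1 := tτ'.run I (c := dp false) rfl
  generalize (dp false).run I τ = υ at *
  have e2 : Ex.ev I υ (twoN - Rg.k : E) = 2 * n - k := by
    rw [ev_sub, ev_twoN]; simp [Ex.ev, k1]
  rw [e2]
  have t2 : Tables D.mirror true (υ.set .u (2 * n - k)) := t1.congr rfl rfl rfl
  have h2 := (run_dp I t2 (xt := 2 * n - k) (yb := 2 * n + 1) (by simp) (by omega)
    (by simp [y1]) le_rfl).2
  refine ⟨?_, h2⟩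
  rw [run_arr I rfl, St.set_arr]
  exact h1

theorem run_pick {D : Disc n} {σ : St Rg Ar} {k : ℕ} (hk : σ.reg .k = k)
    (hf : σ.reg .found = 0) (hF : Ends D k (2 * n + 1) (σ.arr .F))
    (hF' : Ends D.mirror (2 * n - k) (2 * n + 1) (σ.arr .FM)) :
    ((pick.run I σ).reg .found = 1 ∧ (pick.run I σ).reg .xs = k ∧
      (pick.run I σ).reg .ys ≤ 2 * n ∧ D.Good k ((pick.run I σ).reg .ys)) ∨
    ((pick.run I σ).reg .found = 0 ∧ ∀ y ≤ 2 * n, ¬ D.Good k y) := by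
  have hl := run_for I (c := when [.eq Rg.found (num 0), .lt Rg.j (twoN + num 1),
      .eq (.arr .F Rg.j) (num 1), .eq (.arr .FM Rg.j) (num 1)]
    (.set .found (num 1) ;; .set .xs Rg.k ;; .set .ys Rg.j)) (r := .j) (σ := σ)
    (fun j τ => (τ.reg .found = 1 ∧ τ.reg .xs = k ∧ τ.reg .ys ≤ 2 * n ∧ D.Good k (τ.reg .ys)) ∨
      (τ.reg .found = 0 ∧ ∀ y < j, y ≤ 2 * n → ¬ D.Good k y)) (by simp [hf]) ?_
  · rcases hl with h | ⟨h1, h2⟩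
    · exact Or.inl h
    · exact Or.inr ⟨h1, fun y hy => h2 y (by omega) hy⟩
  · intro j τ hj hA hs ih
    have e0 : Ex.ev I τ (twoN + num 1) = 2 * n + 1 := ev_inf I τ
    have kτ : τ.reg .k = k := by rw [hA.reg .k rfl, hk]
    have Fτ : τ.arr .F = σ.arr .F := hA.arr .F rfl
    have Fτ' : τ.arr .FM = σ.arr .FM := hA.arr .FM rfl
    have hif : (∀ e ∈ ([.eq Rg.found (num 0), .lt Rg.j (twoN + num 1),
      .eq (.arr .F Rg.j) (num 1), .eq (.arr .FM Rg.j) (num 1)] : List E), e.ev I τ ≠ 0) ↔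
        τ.reg .found = 0 ∧ j ≤ 2 * n ∧ σ.arr .F j = 1 ∧ σ.arr .FM j = 1 := by
      rw [List.forall_mem_cons, List.forall_mem_cons, Ex.ev, Ex.ev, e0]
      simp only [Ex.ev, hs]
      by_cases hf : τ.reg .found = 0 <;> simp [Ex.ev, hf, hs, Fτ, Fτ']
    by_cases hc : τ.reg .found = 0 ∧ j ≤ 2 * n ∧ σ.arr .F j = 1 ∧ σ.arr .FM j = 1
    · rw [run_when_pos I (hif.2 hc)]
      left
      have hg : D.Good k j := ⟨(hF j (by omega)).2.1 hc.2.2.1, (hF' j (by omega)).2.1 hc.2.2.2⟩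
      simp [run_seq, run_set, Ex.ev, hs, kτ, hc.2.1, hg]
    · rw [run_when_neg I (fun h => hc (hif.1 h))]
      simp only [St.set_reg, reduceCtorEq, if_false]
      rcases ih with h | ⟨h1, h2⟩
      · exact Or.inl h
      · refine Or.inr ⟨h1, fun y hy hy' hg => ?_⟩
        by_cases hyj : y = j
        · subst hyj
          exact hc ⟨h1, hy', (hF y (by omega)).2.2 hg.1, (hF' y (by omega)).2.2 hg.2⟩
        · exact h2 y (by omega) hy' hg

theorem run_search {D : Disc n} {σ : St Rg Ar} (h : Tables D false σ)
    (h' : Tables D.mirror true σ) :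
    ((search.run I σ).reg .found = 1 ∧ (search.run I σ).reg .xs ≤ 2 * n ∧
      (search.run I σ).reg .ys ≤ 2 * n ∧
      D.Good ((search.run I σ).reg .xs) ((search.run I σ).reg .ys)) ∨
    ((search.run I σ).reg .found = 0 ∧ ∀ x ≤ 2 * n, ∀ y ≤ 2 * n, ¬ D.Good x y) := by
  simp only [search, run_seq, run_set, ev_zero]
  have hl := run_for I (c := when [.eq Rg.found (num 0), .lt Rg.k (twoN + num 1)] (dps ;; pick))
    (r := .k) (σ := σ.set .found 0)
    (fun k τ => (τ.reg .found = 1 ∧ τ.reg .xs ≤ 2 * n ∧ τ.reg .ys ≤ 2 * n ∧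
      D.Good (τ.reg .xs) (τ.reg .ys)) ∨
      (τ.reg .found = 0 ∧ ∀ x < k, x ≤ 2 * n → ∀ y ≤ 2 * n, ¬ D.Good x y)) (by simp) ?_
  · rcases hl with h | ⟨h1, h2⟩
    · exact Or.inl h
    · exact Or.inr ⟨h1, fun x hx => h2 x (by omega) hx⟩
  · intro k τ hk hA hs ih
    have e0 : Ex.ev I τ (twoN + num 1) = 2 * n + 1 := ev_inf I τ
    have tτ : Tables D false τ := h.congr (hA.arr _ rfl) (hA.arr _ rfl) (hA.arr _ rfl)
    have tτ' : Tables D.mirror true τ := h'.congr (hA.arr _ rfl) (hA.arr _ rfl) (hA.arr _ rfl)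
    have hif : (∀ e ∈ ([.eq Rg.found (num 0), .lt Rg.k (twoN + num 1)] : List E), e.ev I τ ≠ 0) ↔
        τ.reg .found = 0 ∧ k ≤ 2 * n := by
      rw [List.forall_mem_cons, List.forall_mem_cons, Ex.ev, Ex.ev, e0]
      simp only [Ex.ev, hs]
      by_cases hf : τ.reg .found = 0 <;> simp [hf]
    by_cases hc : τ.reg .found = 0 ∧ k ≤ 2 * n
    · rw [run_when_pos I (hif.2 hc), run_seq]
      obtain ⟨h1, h2⟩ := run_dps I tτ tτ' hs hc.2
      have h3 := run_pick I (σ := dps.run I τ) (k := k) (by rw [run_reg I rfl, hs])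
        (by rw [run_reg I rfl, hc.1]) h1 h2
      simp only [St.set_reg, reduceCtorEq, if_false]
      rcases h3 with ⟨g1, g2, g3, g4⟩ | ⟨g1, g2⟩
      · left
        rw [g2]
        exact ⟨g1, hc.2, g3, g4⟩
      · right
        refine ⟨g1, fun x hx hx' => ?_⟩
        by_cases hxk : x = k
        · subst hxk
          exact g2
        · rcases ih with ih | ih
          · exact absurd (ih.1.symm.trans hc.1) (by decide)
          · exact ih.2 x (by omega) hx'
    · rw [run_when_neg I (fun h => hc (hif.1 h))]
      simp only [St.set_reg, reduceCtorEq, if_false]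
      rcases ih with h | ⟨h1, h2⟩
      · exact Or.inl h
      · exact Or.inr ⟨h1, fun x hx hx' => h2 x (by
          have : x ≠ k := fun hh => hc ⟨h1, hh ▸ hx'⟩
          omega) hx'⟩

theorem run_mark {D : Disc n} {m : Bool} {σ : St Rg Ar} {xt y xx b : ℕ} (h : Tables D m σ)
    (hu : σ.reg .u = xt) (hxt : xt ≤ 2 * n) (hb : σ.reg .bt = b) (hM : σ.arr .M b = xx)
    (hx : xx ≤ xt) (hy : σ.reg .yb = y + 1) :
    ((mark m).run I σ).reg .bt = b - D.hit y xx ∧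
    (∀ r, r ≠ y → ((mark m).run I σ).arr (aFT m) r = σ.arr (aFT m) r) ∧
    ((∃ s, D.Y s = y ∧ xx ≤ D.X s ∧ D.X s < xt) → ((mark m).run I σ).arr (aFT m) y = 1) ∧
    ((¬ ∃ s, D.Y s = y ∧ xx ≤ D.X s ∧ D.X s < xt) →
      ((mark m).run I σ).arr (aFT m) y = σ.arr (aFT m) y) := by
  have e1 : Ex.ev I σ (.arr .M Rg.bt : E) = xx := by simp [Ex.ev, hb, hM]
  have e2 : ∀ τ : St Rg Ar, Ex.ev I τ (Rg.yb - num 1 : E) = τ.reg .yb - 1 := fun _ => rfl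
  simp only [mark, run_seq, run_set, e1, e2]
  set τ := (σ.set .xx xx).set .r ((σ.set .xx xx).reg .yb - 1) with hτ
  have rτ : τ.reg .r = y := by simp [hτ, hy]
  have xτ : τ.reg .xx = xx := by simp [hτ]
  have uτ : τ.reg .u = xt := by simp [hτ, hu]
  have bτ : τ.reg .bt = b := by simp [hτ, hb]
  have aτ : τ.arr = σ.arr := rfl
  have tτ : Tables D m τ := h.congr rfl rfl rfl
  rw [← aτ]
  clear_value τ
  by_cases hs : ∃ s, D.Y s = y
  · obtain ⟨s, rfl⟩ := hs
    have hrc := tτ.rc s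
    have hX := D.X_lt s
    have hex : (∃ s', D.Y s' = D.Y s ∧ xx ≤ D.X s' ∧ D.X s' < xt) ↔ xx ≤ D.X s ∧ D.X s < xt :=
      ⟨fun ⟨s', g1, g2⟩ => D.injY g1 ▸ g2, fun g => ⟨s, rfl, g⟩⟩
    have hhit := tτ.hit (D.Y s) xx
    rw [hrc] at hhit
    rw [hex, run_when_pos I (by simp [Ex.ev, rτ, hrc])]
    simp only [Pr.run]
    have e3 : Ex.ev I τ (.lt (.arr (aRC m) Rg.r) (Rg.xx + num 1) : E) ≠ 0 ↔ D.X s < xx := by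
      simp (disch := omega) [Ex.ev, rτ, hrc, xτ, Nat.mod_eq_of_lt]
    by_cases hc : D.X s < xx
    · rw [if_pos (e3.2 hc), hhit, if_pos (by omega)]
      refine ⟨by simp [Ex.ev, ev_sub, bτ], fun r' hr => rfl, fun g => absurd g.1 (by omega),
        fun _ => rfl⟩
    · rw [if_neg (fun g => hc (e3.1 g)), hhit, if_neg (by omega)]
      by_cases hc' : D.X s < xt
      · rw [run_when_pos I (by simp (disch := omega) [Ex.ev, rτ, hrc, uτ, Nat.mod_eq_of_lt, hc'])]
        simp [run_put, Ex.ev, rτ, bτ, hc']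
        refine ⟨fun r' h1 h2 => absurd h2 h1, fun h1 => absurd h1 hc⟩
      · rw [run_when_neg I (by simp (disch := omega) [Ex.ev, rτ, hrc, uτ, Nat.mod_eq_of_lt]; omega)]
        exact ⟨bτ, fun r' _ => rfl, fun g => absurd g.2 hc', fun _ => rfl⟩
  · have hrc := tτ.rc_zero y fun s hs' => hs ⟨s, hs'⟩
    rw [run_when_neg I (by simp [Ex.ev, rτ, hrc]), D.hit_eq_zero.2 fun ⟨s, g1, g2⟩ => hs ⟨s, g1⟩]
    exact ⟨bτ, fun r' _ => rfl, fun ⟨s, g1, g2⟩ => absurd ⟨s, g1⟩ hs, fun _ => rfl⟩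

/-- The path is never stored. The invariant says that some complete path agrees with the marks made
so far in the lower rows and has `bt` sites on the left in the rows above; this path may change from
round to round. -/
theorem run_trace {D : Disc n} {m : Bool} {σ : St Rg Ar} {xt y₀ : ℕ} (h : Tables D m σ)
    (hu : σ.reg .u = xt) (hxt : xt ≤ 2 * n) (hy : σ.reg .ys = y₀) (hy' : y₀ ≤ 2 * n)
    (hex : ∃ e, D.Full xt y₀ e) (h0 : ∀ r, σ.arr (aFT m) r = 0) :
    ∃ e, D.Full xt y₀ e ∧ ∀ r, ((trace m).run I σ).arr (aFT m) r = 1 ↔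
      ∃ s, D.Y s = r ∧ D.Above xt y₀ e s := by
  simp only [trace, run_seq, run_set]
  set c : C := count .z .acc [.lt Rg.z Rg.ys, .lt (num 0) (.arr (aRC m) Rg.z),
    .lt (.arr (aRC m) Rg.z) (Rg.u + num 1)] with hc
  have hacc : (c.run I σ).reg .acc = D.nw xt y₀ := by
    rw [run_count I (by decide) _ _ (fun z => z < y₀ ∧ D.hit z xt = 1), D.nw_eq_card]
    · congr 1
      ext z
      simp only [mem_filter, mem_range]
      constructor
      · exact fun hh => hh.2
      · exact fun hh => ⟨by omega, hh⟩
    · intro z hz τ h1 h2 h3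
      have hyτ := h2 .ys (by decide) (by decide)
      have huτ := h2 .u (by decide) (by decide)
      rw [h.hit]
      simp (disch := omega) [Ex.ev, h1, h3, hyτ, hy, huτ, hu, Nat.mod_eq_of_lt]
  have u1 : (c.run I σ).reg .u = xt := by rw [run_reg I (by cases m <;> rfl), hu]
  have y1 : (c.run I σ).reg .ys = y₀ := by rw [run_reg I (by cases m <;> rfl), hy]
  have t1 : Tables D m (c.run I σ) := h.run I (by cases m <;> rfl)
  have F1 : ∀ r, (c.run I σ).arr (aFT m) r = 0 := fun r' => by
    rw [run_arr I (by cases m <;> rfl), h0]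
  generalize c.run I σ = τ at *
  have e1 : Ex.ev I τ (Rg.acc - .arr (aTC m) Rg.u : E) = D.nw xt y₀ - D.tp xt := by
    simp [Ex.ev, ev_sub, hacc, u1, t1.tc xt (by omega)]
  rw [e1]
  obtain ⟨e₀, he₀⟩ := hex
  have hl := run_for I (c := when [.lt Rg.k Rg.ys] (.set .yb (Rg.ys - Rg.k : E) ;; dp m ;; mark m))
    (r := .k) (σ := τ.set .bt (D.nw xt y₀ - D.tp xt))
    (fun k υ => ∃ e, D.Full xt y₀ e ∧ υ.reg .bt = D.bb e (y₀ - k) ∧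
      ∀ r, υ.arr (aFT m) r = 1 ↔ y₀ - k ≤ r ∧ ∃ s, D.Y s = r ∧ D.Above xt y₀ e s) ?_ ?_
  · obtain ⟨e, g1, -, g2⟩ := hl
    refine ⟨e, g1, fun r' => ?_⟩
    rw [g2, and_iff_right (by omega)]
  · refine ⟨e₀, he₀, ?_, fun r' => ?_⟩
    · have := he₀.count
      simp only [St.set_reg, reduceCtorEq, if_false, if_true, Nat.sub_zero]
      omega
    · rw [St.set_arr, St.set_arr, F1]
      constructor
      · exact fun hh => absurd hh (by decide)
      · rintro ⟨g1, s, rfl, g2⟩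
        have := g2.1
        omega
  · rintro k υ hk hA hs ⟨e, g1, g2, g3⟩
    have uυ : υ.reg .u = xt := by rw [hA.reg .u (by cases m <;> rfl)]; simp [u1]
    have yυ : υ.reg .ys = y₀ := by rw [hA.reg .ys (by cases m <;> rfl)]; simp [y1]
    have tυ : Tables D m υ := t1.congr (hA.arr _ (by cases m <;> rfl))
      (hA.arr _ (by cases m <;> rfl)) (hA.arr _ (by cases m <;> rfl))
    simp only [St.set_reg, St.set_arr, reduceCtorEq, if_false]
    by_cases hky : k < y₀
    swap
    · rw [run_when_neg I (by simp [Ex.ev, hs, yυ]; omega)]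
      rw [show y₀ - k = y₀ - (k + 1) by omega] at g2 g3
      exact ⟨e, g1, g2, g3⟩
    rw [run_when_pos I (by simp [Ex.ev, hs, yυ, hky])]
    obtain ⟨y, hyk⟩ : ∃ y, y₀ - k = y + 1 := ⟨y₀ - k - 1, by omega⟩
    have hyk' : y₀ - (k + 1) = y := by omega
    have e2 : Ex.ev I υ (Rg.ys - Rg.k : E) = y + 1 := by simp [Ex.ev, ev_sub, hs, yυ, hyk]
    simp only [run_seq, run_set, e2]
    rw [hyk] at g2 g3
    rw [hyk']
    set φ := υ.set .yb (y + 1) with hφ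
    have tφ : Tables D m φ := tυ.congr rfl rfl rfl
    have uφ : φ.reg .u = xt := by simp [hφ, uυ]
    have bφ : φ.reg .bt = D.bb e (y + 1) := by simp [hφ, g2]
    have yφ : φ.reg .yb = y + 1 := by simp [hφ]
    have Fφ : φ.arr (aFT m) = υ.arr (aFT m) := rfl
    clear_value φ
    have hM := (run_dp I tφ uφ hxt yφ (by omega)).1
    have u3 : ((dp m).run I φ).reg .u = xt := by rw [run_reg I (by cases m <;> rfl), uφ]
    have b3 : ((dp m).run I φ).reg .bt = D.bb e (y + 1) := by
      rw [run_reg I (by cases m <;> rfl), bφ]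
    have y3 : ((dp m).run I φ).reg .yb = y + 1 := by rw [run_reg I (by cases m <;> rfl), yφ]
    have F3 : ((dp m).run I φ).arr (aFT m) = υ.arr (aFT m) := by
      rw [run_arr I (by cases m <;> rfl), Fφ]
    have t3 : Tables D m ((dp m).run I φ) := tφ.run I (by cases m <;> rfl)
    generalize (dp m).run I φ = ψ at *
    have hbn : D.bb e (y + 1) < 2 * n + 2 := by
      unfold Disc.bb
      have : ∀ p : Fin n → Prop, ∀ _ : DecidablePred p, (univ.filter p).card ≤ n :=
        fun p _ => card_filter_le_fin p
      exact (this _ _).trans_lt (by omega)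
    have hey := g1.le y (by omega)
    have hr : D.Reach xt (y + 1) (e y) (D.bb e (y + 1)) :=
      ⟨e, g1.toChain.of_le (by omega), rfl, fun r' hr => g1.mono r' y (by omega) (by omega)⟩
    have hle := (hM _ hbn _ hey).2 hr
    -- The repeated dynamic program yields the leftmost column for the current number of sites. The
    -- path is exchanged above so that it passes row `y` there, while the rows already marked keep
    -- their columns.
    obtain ⟨e', i1, i2, i3, i4⟩ := g1.exchange (y := y) (by omega)
      ((hM _ hbn _ (hle.trans hey)).1 le_rfl) hle
      (fun x' hx' hr' => absurd ((hM _ hbn x' (by omega)).2 hr') (by omega))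
    obtain ⟨j1, j2, j3, j4⟩ := run_mark I t3 u3 hxt b3 rfl (hle.trans hey) y3
    refine ⟨e', i1, ?_, fun r' => ?_⟩
    · have h6 := D.bb_succ e' y
      rw [i4, i2] at h6
      exact j1.trans (Nat.sub_eq_of_eq_add h6)
    · by_cases hry : r' = y
      · subst hry
        rw [and_iff_right le_rfl]
        have hiff : (∃ s, D.Y s = r' ∧ D.Above xt y₀ e' s) ↔
            ∃ s, D.Y s = r' ∧ ψ.arr .M (D.bb e (r' + 1)) ≤ D.X s ∧ D.X s < xt := by
          constructor
          · rintro ⟨s, rfl, k1, k2, k3⟩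
            exact ⟨s, rfl, by rwa [i2] at k2, k3⟩
          · rintro ⟨s, rfl, k2, k3⟩
            exact ⟨s, rfl, by omega, by rwa [i2], k3⟩
        rw [hiff]
        by_cases hq : ∃ s, D.Y s = r' ∧ ψ.arr .M (D.bb e (r' + 1)) ≤ D.X s ∧ D.X s < xt
        · simp only [j3 hq, hq]
        · rw [j4 hq, F3, g3]
          simp only [hq, iff_false, not_and]
          omega
      · rw [j2 r' hry, F3, g3]
        constructor
        · rintro ⟨k1, s, rfl, k2, k3, k4⟩
          exact ⟨by omega, s, rfl, k2, by rwa [i3 _ (by omega)], k4⟩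
        · rintro ⟨k1, s, rfl, k2, k3, k4⟩
          exact ⟨by omega, s, rfl, k2, by rwa [i3 _ (by omega)] at k3, k4⟩

end Code

end BoundaryLabeling

/-! ### The greedy assignment of ports -/

namespace BoundaryLabeling

open Finset

/-- The array `a` lists the elements of `A` (plus one) at their positions. -/
structure Encodes {n : ℕ} (A : Finset (Fin n)) (pos : Fin n → ℕ) (a : ℕ → ℕ) : Prop where
  eq : ∀ s ∈ A, a (pos s) = s + 1
  eq_zero : ∀ p, (∀ s ∈ A, pos s ≠ p) → a p = 0

namespace Encodes

variable {n : ℕ} {A : Finset (Fin n)} {pos : Fin n → ℕ} {a : ℕ → ℕ}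

theorem exists_of_pos (h : Encodes A pos a) {p : ℕ} (hp : 0 < a p) : ∃ s ∈ A, pos s = p := by
  by_contra hh
  push Not at hh
  have := h.eq_zero p hh
  omega

theorem inj (h : Encodes A pos a) {s s' : Fin n} (hs : s ∈ A) (hs' : s' ∈ A)
    (hp : pos s = pos s') : s = s' := by
  have h1 := h.eq s hs
  have h2 := h.eq s' hs'
  rw [hp] at h1
  exact Fin.ext (by omega)

theorem erase (h : Encodes A pos a) {j : Fin n} (hj : j ∈ A) :
    Encodes (A.erase j) pos (Function.update a (pos j) 0) := by
  constructor
  · intro s hs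
    rw [mem_erase] at hs
    rw [Function.update_of_ne (fun hh => hs.1 (h.inj hs.2 hj hh)), h.eq s hs.2]
  · intro p hp
    by_cases hpj : p = pos j
    · simp [hpj]
    · rw [Function.update_of_ne hpj]
      refine h.eq_zero p fun s hs => ?_
      by_cases hsj : s = j
      · exact fun hh => hpj (hsj ▸ hh.symm)
      · exact hp s (mem_erase.2 ⟨hsj, hs⟩)

theorem insert (h : Encodes A pos a) {j : Fin n} (hj : ∀ s ∈ A, pos s ≠ pos j) :
    Encodes (insert j A) pos (Function.update a (pos j) (j + 1)) := by
  constructor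
  · intro s hs
    by_cases hsj : s = j
    · simp [hsj]
    · have hs' := mem_of_mem_insert_of_ne hs hsj
      rw [Function.update_of_ne (hj s hs'), h.eq s hs']
  · intro p hp
    rw [Function.update_of_ne (hp j (mem_insert_self _ _)).symm]
    exact h.eq_zero p fun s hs => hp s (mem_insert_of_mem hs)

end Encodes

theorem St.put_arr_self {ρ α : Type} [DecidableEq α] (σ : St ρ α) (a : α) (i x : ℕ) :
    (σ.put a i x).arr a = Function.update (σ.arr a) i x := by
  simp [St.put]

theorem St.put_arr_of_ne {ρ α : Type} [DecidableEq α] (σ : St ρ α) {a a' : α} (h : a' ≠ a)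
    (i x : ℕ) : (σ.put a i x).arr a' = σ.arr a' := by
  simp [St.put, h]

namespace Code

variable {n : ℕ} (I : Instance n)

/-- Positions are scanned upwards. Each port before `kk` replaces the previous choice, so the
nearest one survives; a port after `kk` is taken only if nothing has been chosen yet. No port is at
`kk` itself. -/
theorem run_choice {Q : Ar} {σ : St Rg Ar} {kk : ℕ} (hk : σ.reg .kk = kk) (h0 : σ.arr Q kk = 0)
    (hlt : ∀ p, 0 < σ.arr Q p → p ≤ 2 * n) (hex : ∃ p, 0 < σ.arr Q p) :
    0 < σ.arr Q (((choice Q).run I σ).reg .best) ∧ ∀ p, 0 < σ.arr Q p →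
      p = ((choice Q).run I σ).reg .best ∨ Prefers kk (((choice Q).run I σ).reg .best) p := by
  simp only [choice, run_seq, run_set, ev_inf]
  have hl := run_for I (c := when [.lt (num 0) (.arr Q Rg.p)] (
    .ite (.lt Rg.p Rg.kk) (.set .best Rg.p) (when [.eq Rg.best inf] (.set .best Rg.p))))
    (r := .p) (σ := σ.set .best (2 * n + 1)) (fun k τ => ((∀ p < k, σ.arr Q p = 0) ∧
      τ.reg .best = 2 * n + 1) ∨ (τ.reg .best < k ∧ 0 < σ.arr Q (τ.reg .best) ∧
        ∀ p < k, 0 < σ.arr Q p → p = τ.reg .best ∨ Prefers kk (τ.reg .best) p)) ?_ ?_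
  · rcases hl with ⟨h1, -⟩ | ⟨h1, h2, h3⟩
    · obtain ⟨p, hp⟩ := hex
      have := h1 p (by have := hlt p hp; omega)
      omega
    · exact ⟨h2, fun p hp => h3 p (by have := hlt p hp; omega) hp⟩
  · simp
  · intro k τ hk' hA hs ih
    have kτ : τ.reg .kk = kk := by rw [hA.reg .kk rfl]; simp [hk]
    have Qτ : τ.arr Q = σ.arr Q := by rw [hA.arr Q rfl]; rfl
    by_cases hq : 0 < σ.arr Q k
    swap
    · rw [run_when_neg I (by simp [Ex.ev, hs, Qτ]; omega)]
      simp only [St.set_reg, reduceCtorEq, if_false]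
      have hq0 : σ.arr Q k = 0 := by omega
      rcases ih with ⟨h1, h2⟩ | ⟨h1, h2, h3⟩
      · refine Or.inl ⟨fun p hp => ?_, h2⟩
        by_cases hpk : p = k
        · rw [hpk, hq0]
        · exact h1 p (by omega)
      · refine Or.inr ⟨by omega, h2, fun p hp hp' => h3 p ?_ hp'⟩
        have : p ≠ k := fun hh => hq (hh ▸ hp')
        omega
    have hkn := hlt k hq
    have hkk : k ≠ kk := fun hh => by rw [hh] at hq; omega
    rw [run_when_pos I (by simp [Ex.ev, hs, Qτ, hq])]
    simp only [Pr.run]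
    by_cases hlk : k < kk
    · rw [if_pos (by simp [Ex.ev, hs, kτ, hlk])]
      simp only [Ex.ev, hs, St.set_reg, reduceCtorEq, if_false, if_true]
      refine Or.inr ⟨by omega, hq, fun p hp hp' => ?_⟩
      by_cases hpk : p = k
      · exact Or.inl hpk
      · exact Or.inr (Or.inl ⟨hlk, by omega⟩)
    · rw [if_neg (by simp [Ex.ev, hs, kτ]; omega)]
      have hif : (∀ e ∈ ([.eq Rg.best inf] : List E), e.ev I τ ≠ 0) ↔
          τ.reg .best = 2 * n + 1 := by
        rw [List.forall_mem_cons, Ex.ev, ev_inf]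
        by_cases hb : τ.reg .best = 2 * n + 1 <;> simp [Ex.ev, hb]
      rcases ih with ⟨h1, h2⟩ | ⟨h1, h2, h3⟩
      · rw [run_when_pos I (hif.2 h2)]
        simp only [run_set, Ex.ev, hs, St.set_reg, reduceCtorEq, if_false, if_true]
        refine Or.inr ⟨by omega, hq, fun p hp hp' => ?_⟩
        by_cases hpk : p = k
        · exact Or.inl hpk
        · have := h1 p (by omega)
          omega
      · rw [run_when_neg I (fun hh => by have := hif.1 hh; omega)]
        simp only [St.set_reg, reduceCtorEq, if_false]
        refine Or.inr ⟨by omega, h2, fun p hp hp' => ?_⟩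
        by_cases hpk : p = k
        · right
          have : τ.reg .best ≠ kk := fun hh => by rw [hh] at h2; omega
          unfold Prefers
          omega
        · exact h3 p (by omega) hp'

/-- The invariant keeps the set `B'` of unused ports, which is at least as large as the set of
untreated sites. Each treated site prefers its port to everything in `B'`; since later sites choose
from `B'`, the pairwise statement follows. -/
theorem run_greedy {O K Q : Ar} (hOQ : O ≠ Q) (hKQ : K ≠ Q) (hOO : O ≠ .OUT) (hKO : K ≠ .OUT)
    (hQO : Q ≠ .OUT) {σ : St Rg Ar} {A B : Finset (Fin n)} {ord key pos : Fin n → ℕ}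
    (hA : Encodes A ord (σ.arr O)) (hord : ∀ s ∈ A, ord s < 2 * n + 2)
    (hK : ∀ s ∈ A, σ.arr K s = key s) (hB : Encodes B pos (σ.arr Q))
    (hpos : ∀ j ∈ B, pos j ≤ 2 * n) (hcard : A.card ≤ B.card)
    (hne : ∀ s ∈ A, ∀ j ∈ B, pos j ≠ key s) :
    ∃ f : Fin n → Fin n, (∀ s ∈ A, f s ∈ B ∧ ((greedy O K Q).run I σ).arr .OUT s = f s) ∧
      (∀ s ∈ A, ∀ s' ∈ A, ord s < ord s' → f s ≠ f s' ∧
        Prefers (key s) (pos (f s)) (pos (f s'))) ∧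
      ∀ s ∉ A, ((greedy O K Q).run I σ).arr .OUT (s : ℕ) = σ.arr .OUT s := by
  classical
  unfold greedy
  set c : C := when [.lt (num 0) (.arr O Rg.o)] (
    .set .s (.arr O Rg.o - num 1) ;; .set .kk (.arr K Rg.s) ;; choice Q ;;
    .put .OUT Rg.s (.arr Q Rg.best - num 1) ;; .put Q Rg.best (num 0)) with hc
  have hl := run_for I (c := c) (r := .o) (σ := σ)
    (fun k τ => ∃ (f : Fin n → Fin n) (B' : Finset (Fin n)), B' ⊆ B ∧
      Encodes B' pos (τ.arr Q) ∧ (A.filter fun s => k ≤ ord s).card ≤ B'.card ∧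
      (∀ s ∈ A, ord s < k → f s ∈ B ∧ f s ∉ B' ∧ τ.arr .OUT s = f s ∧
        ∀ j ∈ B', Prefers (key s) (pos (f s)) (pos j)) ∧
      (∀ s ∈ A, ∀ s' ∈ A, ord s < ord s' → ord s' < k → f s ≠ f s' ∧
        Prefers (key s) (pos (f s)) (pos (f s'))) ∧
      ∀ s, (s ∈ A → k ≤ ord s) → τ.arr .OUT (s : ℕ) = σ.arr .OUT s) ?_ ?_
  · obtain ⟨f, B', -, -, -, h1, h2, h3⟩ := hl
    refine ⟨f, fun s hs => ?_, fun s hs s' hs' hlt => h2 s hs s' hs' hlt (hord s' hs'),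
      fun s hs => h3 s fun hh => absurd hh hs⟩
    obtain ⟨g1, -, g2, -⟩ := h1 s hs (hord s hs)
    exact ⟨g1, g2⟩
  · refine ⟨id, B, Subset.rfl, hB, ?_, by simp, by simp, by simp⟩
    exact (card_le_card (filter_subset _ _)).trans hcard
  · rintro k τ hk hT hs ⟨f, B', h1, h2, h3, h4, h5, h6⟩
    have hOτ : τ.arr O = σ.arr O := hT.arr O (by
      simp [hc, when, Pr.writesA, choice, hOO.symm, hOQ.symm])
    have hKτ : τ.arr K = σ.arr K := hT.arr K (by
      simp [hc, when, Pr.writesA, choice, hKO.symm, hKQ.symm])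
    simp only [St.set_arr]
    by_cases hex : ∃ s ∈ A, ord s = k
    swap
    · have h0 := hA.eq_zero k fun s hs' => fun hh => hex ⟨s, hs', hh⟩
      rw [hc, run_when_neg I (by simp [Ex.ev, hs, hOτ, h0])]
      have hk' : ∀ s ∈ A, ord s ≠ k := fun s hs' hh => hex ⟨s, hs', hh⟩
      refine ⟨f, B', h1, h2, ?_, fun s hs' hlt => h4 s hs' (by have := hk' s hs'; omega),
        fun s hs' s' hs'' hlt hlt' => h5 s hs' s' hs'' hlt (by have := hk' s' hs''; omega),
        fun s hs' => h6 s fun hh => by have := hs' hh; omega⟩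
      refine (card_le_card fun s hs' => ?_).trans h3
      rw [mem_filter] at hs' ⊢
      exact ⟨hs'.1, by omega⟩
    obtain ⟨s₀, hs₀, rfl⟩ := hex
    have hO0 := hA.eq s₀ hs₀
    rw [hc, run_when_pos I (by simp [Ex.ev, hs, hOτ, hO0])]
    have e1 : Ex.ev I τ (.arr O Rg.o - num 1 : E) = s₀ := by
      simp [Ex.ev, ev_sub, hs, hOτ, hO0]
    have e2 : Ex.ev I (τ.set .s s₀) (.arr K Rg.s : E) = key s₀ := by
      simp [Ex.ev, hKτ, hK s₀ hs₀]
    simp only [run_seq, run_set, e1, e2, run_put, ev_zero]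
    set υ := (τ.set .s s₀).set .kk (key s₀) with hυ
    have Qυ : υ.arr Q = τ.arr Q := rfl
    obtain ⟨j₁, hj₁⟩ : B'.Nonempty := by
      rw [← card_pos]
      refine lt_of_lt_of_le (card_pos.2 ⟨s₀, ?_⟩) h3
      rw [mem_filter]
      exact ⟨hs₀, le_rfl⟩
    obtain ⟨g1, g2⟩ := run_choice I (Q := Q) (σ := υ) (kk := key s₀) (by simp [hυ])
      (h2.eq_zero _ fun j hj => hne s₀ hs₀ j (h1 hj))
      (fun p hp => by
        obtain ⟨j, hj, rfl⟩ := h2.exists_of_pos hp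
        exact hpos j (h1 hj))
      ⟨pos j₁, by rw [Qυ, h2.eq j₁ hj₁]; omega⟩
    obtain ⟨j₀, hj₀, hj₀'⟩ := h2.exists_of_pos g1
    rw [← hj₀'] at g2
    have sφ : ((choice Q).run I υ).reg .s = s₀ := by rw [run_reg I rfl]; simp [hυ]
    have aφ : ((choice Q).run I υ).arr = τ.arr := funext fun a => run_arr I rfl υ
    generalize (choice Q).run I υ = φ at *
    have e3 : Ex.ev I φ (Rg.s : E) = s₀ := sφ
    have e4 : Ex.ev I φ (.arr Q Rg.best - num 1 : E) = j₀ := by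
      simp [Ex.ev, ev_sub, ← hj₀', aφ, h2.eq j₀ hj₀]
    have e5 : Ex.ev I (φ.put .OUT s₀ j₀) (Rg.best : E) = pos j₀ := hj₀'.symm
    rw [e3, e4, e5]
    have q1 : ((φ.put .OUT s₀ j₀).put Q (pos j₀) 0).arr Q =
        Function.update (τ.arr Q) (pos j₀) 0 := by
      rw [St.put_arr_self, St.put_arr_of_ne _ hQO, aφ]
    have q2 : ((φ.put .OUT s₀ j₀).put Q (pos j₀) 0).arr .OUT =
        Function.update (τ.arr .OUT) s₀ j₀ := by
      rw [St.put_arr_of_ne _ hQO.symm, St.put_arr_self, aφ]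
    rw [q1, q2]
    have hpref : ∀ j ∈ B'.erase j₀, Prefers (key s₀) (pos j₀) (pos j) := by
      intro j hj
      rw [mem_erase] at hj
      refine (g2 (pos j) (by rw [Qυ, h2.eq j hj.2]; omega)).resolve_left fun hh => ?_
      exact hj.1 (h2.inj hj.2 hj₀ hh)
    have hins : ∀ s ∈ A, s ≠ s₀ → ord s < ord s₀ + 1 → ord s < ord s₀ := fun s hs' hne' hlt => by
      have : ord s ≠ ord s₀ := fun hh => hne' (hA.inj hs' hs₀ hh)
      omega
    refine ⟨Function.update f s₀ j₀, B'.erase j₀, (erase_subset _ _).trans h1, h2.erase hj₀,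
      ?_, fun s hs' hlt => ?_, fun s hs' s' hs'' hlt hlt' => ?_, fun s hs' => ?_⟩
    · rw [card_erase_of_mem hj₀]
      have : (A.filter fun s => ord s₀ + 1 ≤ ord s).card <
          (A.filter fun s => ord s₀ ≤ ord s).card := by
        apply card_lt_card
        refine ⟨fun s hs' => ?_, fun hh => ?_⟩
        · rw [mem_filter] at hs' ⊢
          exact ⟨hs'.1, by omega⟩
        · have := hh (mem_filter.2 ⟨hs₀, le_rfl⟩)
          rw [mem_filter] at this
          omega
      omega
    · by_cases hss : s = s₀
      · subst hss
        simp only [Function.update_self]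
        exact ⟨h1 hj₀, notMem_erase _ _, trivial, hpref⟩
      · obtain ⟨k1, k2, k3, k4⟩ := h4 s hs' (hins s hs' hss hlt)
        rw [Function.update_of_ne hss, Function.update_of_ne (fun hh => hss (Fin.ext hh))]
        exact ⟨k1, fun hh => k2 (mem_of_mem_erase hh), k3, fun j hj => k4 j (mem_of_mem_erase hj)⟩
    · have hss : s ≠ s₀ := fun hh => by rw [hh] at hlt; omega
      have hlt0 : ord s < ord s₀ := by omega
      rw [Function.update_of_ne hss]
      by_cases hss' : s' = s₀
      · subst hss'
        obtain ⟨k1, k2, k3, k4⟩ := h4 s hs' hlt0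
        rw [Function.update_self]
        exact ⟨fun hh => k2 (hh ▸ hj₀), k4 j₀ hj₀⟩
      · rw [Function.update_of_ne hss']
        exact h5 s hs' s' hs'' hlt (hins s' hs'' hss' hlt')
    · rw [Function.update_of_ne]
      · exact h6 s fun hh => by have := hs' hh; omega
      · intro hh
        have := hs' (Fin.ext hh ▸ hs₀)
        rw [Fin.ext hh] at this
        omega

end Code

end BoundaryLabeling

/-! ### Distribution of sites and ports into classes -/

namespace BoundaryLabeling

open Finset

namespace Encodes

variable {n : ℕ} {pos : Fin n → ℕ} {a : ℕ → ℕ} {p : Fin n → Prop} [DecidablePred p]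

/-- `start`, `skip`, `step` and `finish` are the invariant of a loop over the indices: after `k`
rounds the array lists the indices below `k` that satisfy `p`. -/
theorem start (h : ∀ i, a i = 0) :
    Encodes (univ.filter fun s : Fin n => (s : ℕ) < 0 ∧ p s) pos a :=
  ⟨by simp, fun i _ => h i⟩

theorem finish {k : ℕ} (hk : n ≤ k)
    (h : Encodes (univ.filter fun s : Fin n => (s : ℕ) < k ∧ p s) pos a) :
    Encodes (univ.filter p) pos a := by
  convert h using 1
  ext s
  simp only [mem_filter, mem_univ, true_and]
  exact ⟨fun hs => ⟨by omega, hs⟩, fun hs => hs.2⟩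

theorem skip {k : ℕ} (hk : ∀ s : Fin n, s = k → ¬ p s)
    (h : Encodes (univ.filter fun s : Fin n => (s : ℕ) < k ∧ p s) pos a) :
    Encodes (univ.filter fun s : Fin n => (s : ℕ) < k + 1 ∧ p s) pos a := by
  convert h using 1
  ext s
  simp only [mem_filter, mem_univ, true_and]
  refine ⟨fun hs => ⟨?_, hs.2⟩, fun hs => ⟨by omega, hs.2⟩⟩
  have : (s : ℕ) ≠ k := fun hh => hk s hh hs.2
  omega

theorem step {j : Fin n} (hj : p j) (hinj : ∀ s, p s → pos s = pos j → s = j)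
    (h : Encodes (univ.filter fun s : Fin n => (s : ℕ) < j ∧ p s) pos a) :
    Encodes (univ.filter fun s : Fin n => (s : ℕ) < j + 1 ∧ p s) pos
      (Function.update a (pos j) (j + 1)) := by
  classical
  have h1 := h.insert (j := j) fun s hs hh => by
    rw [mem_filter] at hs
    have := hinj s hs.2.2 hh
    rw [this] at hs
    omega
  convert h1 using 1
  ext s
  simp only [mem_filter, mem_univ, true_and, mem_insert]
  constructor
  · intro hs
    by_cases hsj : s = j
    · exact Or.inl hsj
    · have : (s : ℕ) ≠ j := fun hh => hsj (Fin.ext hh)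
      exact Or.inr ⟨by omega, hs.2⟩
  · rintro (rfl | hs)
    · exact ⟨by omega, hj⟩
    · exact ⟨by omega, hs.2⟩

end Encodes

namespace Code

variable {n : ℕ} (I : Instance n)

theorem run_classes {σ : St Rg Ar} (h : ∀ s, RankAt I σ s) (h1 : ∀ i, σ.arr .OT i = 0)
    (h2 : ∀ i, σ.arr .OTM i = 0) (h3 : ∀ i, σ.arr .ON i = 0) {p q : Fin n → Prop}
    [DecidablePred p] [DecidablePred q] (hp : ∀ s, σ.arr .FT (I.disc.Y s) = 1 ↔ p s)
    (hq : ∀ s, σ.arr .FTM (I.disc.Y s) = 1 ↔ q s) :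
    Encodes (univ.filter p) I.disc.Y ((classes.run I σ).arr .OT) ∧
    Encodes (univ.filter fun s => ¬ p s ∧ q s) I.disc.Y ((classes.run I σ).arr .OTM) ∧
    Encodes (univ.filter fun s => ¬ p s ∧ ¬ q s) I.disc.X ((classes.run I σ).arr .ON) := by
  have hl := run_for I (c := when [.lt Rg.s .size] (
    .ite (.eq (.arr .FT (.arr .Y Rg.s)) (num 1)) (.put .OT (.arr .Y Rg.s) (Rg.s + num 1))
      (.ite (.eq (.arr .FTM (.arr .Y Rg.s)) (num 1)) (.put .OTM (.arr .Y Rg.s) (Rg.s + num 1))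
        (.put .ON (.arr .X Rg.s) (Rg.s + num 1))))) (r := .s) (σ := σ)
    (fun k τ => Encodes (univ.filter fun s : Fin n => (s : ℕ) < k ∧ p s) I.disc.Y (τ.arr .OT) ∧
      Encodes (univ.filter fun s : Fin n => (s : ℕ) < k ∧ ¬ p s ∧ q s) I.disc.Y (τ.arr .OTM) ∧
      Encodes (univ.filter fun s : Fin n => (s : ℕ) < k ∧ ¬ p s ∧ ¬ q s) I.disc.X (τ.arr .ON))
    ⟨.start h1, .start h2, .start h3⟩ ?_
  · exact ⟨hl.1.finish (by omega), hl.2.1.finish (by omega), hl.2.2.finish (by omega)⟩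
  · rintro k τ hk hA hs ⟨g1, g2, g3⟩
    simp only [St.set_arr]
    by_cases hkn : k < n
    swap
    · rw [run_when_neg I (by simp [Ex.ev, hs, hkn])]
      exact ⟨g1.skip fun s hh => by omega, g2.skip fun s hh => by omega,
        g3.skip fun s hh => by omega⟩
    rw [run_when_pos I (by simp [Ex.ev, hs, hkn])]
    obtain ⟨j, rfl⟩ : ∃ j : Fin n, k = j := ⟨⟨k, hkn⟩, rfl⟩
    have e1 : τ.arr .Y j = I.disc.Y j := by rw [hA.arr .Y rfl, (h j).Y]
    have e2 : τ.arr .X j = I.disc.X j := by rw [hA.arr .X rfl, (h j).X]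
    have e3 := hp j
    have e4 := hq j
    rw [← hA.arr .FT rfl] at e3
    rw [← hA.arr .FTM rfl] at e4
    have e5 : ((j : ℕ) + 1) % (4 * n + 8) = j + 1 := Nat.mod_eq_of_lt (by omega)
    by_cases hpj : p j
    · simp only [Pr.run, Ex.ev, hs, e1, e3.2 hpj, St.put_arr_self, ne_eq, not_false_eq_true,
        St.put_arr_of_ne, reduceCtorEq, Fin.val_one, if_true, one_ne_zero, e5]
      exact ⟨g1.step hpj fun s _ hh => I.disc.injY hh,
        g2.skip fun s hh => by rw [Fin.ext hh]; tauto,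
        g3.skip fun s hh => by rw [Fin.ext hh]; tauto⟩
    by_cases hqj : q j
    · simp only [Pr.run, Ex.ev, hs, e1, e3, e4, hpj, hqj, St.put_arr_self, ne_eq,
        not_false_eq_true, St.put_arr_of_ne, reduceCtorEq, Fin.val_one, if_true, if_false,
        one_ne_zero, not_true_eq_false, e5]
      exact ⟨g1.skip fun s hh => by rw [Fin.ext hh]; tauto,
        g2.step ⟨hpj, hqj⟩ fun s _ hh => I.disc.injY hh,
        g3.skip fun s hh => by rw [Fin.ext hh]; tauto⟩
    · simp only [Pr.run, Ex.ev, hs, e1, e2, e3, e4, hpj, hqj, St.put_arr_self, ne_eq,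
        not_false_eq_true, St.put_arr_of_ne, reduceCtorEq, Fin.val_one, if_false,
        not_true_eq_false, e5]
      exact ⟨g1.skip fun s hh => by rw [Fin.ext hh]; tauto,
        g2.skip fun s hh => by rw [Fin.ext hh]; tauto,
        g3.step ⟨hpj, hqj⟩ fun s _ hh => I.disc.injX hh⟩

open scoped Classical in
theorem run_ports {σ : St Rg Ar} (h : ∀ s, RankAt I σ s) (h1 : ∀ i, σ.arr .PL i = 0)
    (h2 : ∀ i, σ.arr .PT i = 0) (h3 : ∀ i, σ.arr .PTM i = 0) (h4 : ∀ i, σ.arr .PR i = 0)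
    {xt : ℕ} (hx : σ.reg .xs = xt) :
    Encodes (univ.filter fun j => I.disc.side j = .left) I.disc.P
      ((ports.run I σ).arr .PL) ∧
    Encodes (univ.filter fun j => I.disc.side j = .top ∧ I.disc.P j < xt) I.disc.P
      ((ports.run I σ).arr .PT) ∧
    Encodes (univ.filter fun j => I.disc.side j = .top ∧ xt ≤ I.disc.P j) I.disc.mirror.P
      ((ports.run I σ).arr .PTM) ∧
    Encodes (univ.filter fun j => I.disc.side j = .right) I.disc.mirror.P
      ((ports.run I σ).arr .PR) := by
  have hl := run_for I (c := when [.lt Rg.j .size] (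
    .ite (.eq (.arr .SD Rg.j) (num 0)) (.put .PL (.arr .P Rg.j) (Rg.j + num 1))
      (.ite (.eq (.arr .SD Rg.j) (num 1))
        (.ite (.lt (.arr .P Rg.j) Rg.xs) (.put .PT (.arr .P Rg.j) (Rg.j + num 1))
          (.put .PTM (.arr .PM Rg.j) (Rg.j + num 1)))
        (.put .PR (.arr .P Rg.j) (Rg.j + num 1))))) (r := .j) (σ := σ)
    (fun k τ => Encodes (univ.filter fun j : Fin n => (j : ℕ) < k ∧ I.disc.side j = .left)
        I.disc.P (τ.arr .PL) ∧
      Encodes (univ.filter fun j : Fin n => (j : ℕ) < k ∧ I.disc.side j = .top ∧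
        I.disc.P j < xt) I.disc.P (τ.arr .PT) ∧
      Encodes (univ.filter fun j : Fin n => (j : ℕ) < k ∧ I.disc.side j = .top ∧
        xt ≤ I.disc.P j) I.disc.mirror.P (τ.arr .PTM) ∧
      Encodes (univ.filter fun j : Fin n => (j : ℕ) < k ∧ I.disc.side j = .right)
        I.disc.mirror.P (τ.arr .PR))
    ⟨.start h1, .start h2, .start h3, .start h4⟩ ?_
  · exact ⟨hl.1.finish (by omega), hl.2.1.finish (by omega), hl.2.2.1.finish (by omega),
      hl.2.2.2.finish (by omega)⟩
  · rintro k τ hk hA hs ⟨g1, g2, g3, g4⟩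
    simp only [St.set_arr]
    by_cases hkn : k < n
    swap
    · rw [run_when_neg I (by simp [Ex.ev, hs, hkn])]
      exact ⟨g1.skip fun s hh => by omega, g2.skip fun s hh => by omega,
        g3.skip fun s hh => by omega, g4.skip fun s hh => by omega⟩
    rw [run_when_pos I (by simp [Ex.ev, hs, hkn])]
    obtain ⟨j, rfl⟩ : ∃ j : Fin n, k = j := ⟨⟨k, hkn⟩, rfl⟩
    have e1 : τ.arr .P j = I.disc.P j := by rw [hA.arr .P rfl, (h j).P]
    have e2 : τ.arr .PM j = I.disc.mirror.P j := by rw [hA.arr .PM rfl, (h j).PM]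
    have e3 : τ.arr .SD j = (I.disc.side j).code := by rw [hA.arr .SD rfl, (h j).SD]
    have e4 : τ.reg .xs = xt := by rw [hA.reg .xs rfl]; exact hx
    have e5 : ((j : ℕ) + 1) % (4 * n + 8) = j + 1 := Nat.mod_eq_of_lt (by omega)
    cases hj : I.disc.side j
    · simp [-Order.lt_add_one_iff, Pr.run, Ex.ev, hs, e1, e3, hj, Side.code, e5, St.put_arr_self, St.put_arr_of_ne]
      exact ⟨g1.step hj fun s hh => I.disc.P_inj s j (hh.trans hj.symm),
        g2.skip fun s hh => by rw [Fin.ext hh, hj]; simp,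
        g3.skip fun s hh => by rw [Fin.ext hh, hj]; simp,
        g4.skip fun s hh => by rw [Fin.ext hh, hj]; simp⟩
    · by_cases hlt : I.disc.P j < xt
      · simp [-Order.lt_add_one_iff, Pr.run, Ex.ev, hs, e1, e3, e4, hj, hlt, Side.code, e5, St.put_arr_self,
          St.put_arr_of_ne]
        exact ⟨g1.skip fun s hh => by rw [Fin.ext hh, hj]; simp,
          g2.step ⟨hj, hlt⟩ fun s hh => I.disc.P_inj s j (hh.1.trans hj.symm),
          g3.skip fun s hh => by rw [Fin.ext hh, hj]; simp [hlt],
          g4.skip fun s hh => by rw [Fin.ext hh, hj]; simp⟩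
      · simp [-Order.lt_add_one_iff, Pr.run, Ex.ev, hs, e1, e2, e3, e4, hj, hlt, Side.code, e5, St.put_arr_self,
          St.put_arr_of_ne]
        exact ⟨g1.skip fun s hh => by rw [Fin.ext hh, hj]; simp,
          g2.skip fun s hh => by rw [Fin.ext hh, hj]; simp [hlt],
          g3.step ⟨hj, by omega⟩ fun s hh => I.disc.mirror.P_inj s j
            ((I.disc.mirror_eq_top.2 hh.1).trans (I.disc.mirror_eq_top.2 hj).symm),
          g4.skip fun s hh => by rw [Fin.ext hh, hj]; simp⟩
    · simp [-Order.lt_add_one_iff, Pr.run, Ex.ev, hs, e1, e3, hj, Side.code, e5, St.put_arr_self, St.put_arr_of_ne]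
      refine ⟨g1.skip fun s hh => by rw [Fin.ext hh, hj]; simp,
        g2.skip fun s hh => by rw [Fin.ext hh, hj]; simp,
        g3.skip fun s hh => by rw [Fin.ext hh, hj]; simp, ?_⟩
      rw [← I.disc.P_mirror_right hj]
      exact g4.step hj fun s hh => I.disc.mirror.P_inj s j
        ((I.disc.mirror_eq_left.2 hh).trans (I.disc.mirror_eq_left.2 hj).symm)

/-- The sites come in the order of their columns, so those in `L` lie left of those in `R`, and
nothing enters `R` before all left ports are provided for. -/
theorem run_halves {σ : St Rg Ar} {N : Finset (Fin n)} {c : ℕ}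
    (hN : Encodes N I.disc.X (σ.arr .ON)) (hc : σ.arr .LC (2 * n) = c)
    (h1 : ∀ i, σ.arr .OL i = 0) (h2 : ∀ i, σ.arr .OR i = 0) :
    ∃ L R : Finset (Fin n), Encodes L I.disc.X ((halves.run I σ).arr .OL) ∧
      Encodes R I.disc.mirror.X ((halves.run I σ).arr .OR) ∧ (∀ s, s ∈ N ↔ s ∈ L ∨ s ∈ R) ∧
      (∀ s ∈ L, ∀ s' ∈ R, I.disc.X s < I.disc.X s') ∧ L.card ≤ c ∧ (L.card < c → R = ∅) := by
  classical
  simp only [halves, run_seq, run_set, ev_zero]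
  have hl := run_for I (c := when [.lt (num 0) (.arr .ON Rg.x)] (
    .ite (.lt Rg.cnt (.arr .LC twoN))
      (.put .OL Rg.x (.arr .ON Rg.x) ;; .set .cnt (Rg.cnt + num 1))
      (.put .OR (twoN - num 1 - Rg.x) (.arr .ON Rg.x)))) (r := .x) (σ := σ.set .cnt 0)
    (fun k τ => ∃ L R : Finset (Fin n), Encodes L I.disc.X (τ.arr .OL) ∧
      Encodes R I.disc.mirror.X (τ.arr .OR) ∧
      (∀ s, (s ∈ N ∧ I.disc.X s < k) ↔ s ∈ L ∨ s ∈ R) ∧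
      (∀ s ∈ L, ∀ s' ∈ R, I.disc.X s < I.disc.X s') ∧ L.card ≤ c ∧ (L.card < c → R = ∅) ∧
      τ.reg .cnt = L.card) ?_ ?_
  · obtain ⟨L, R, g1, g2, g3, g4, g5, g6, -⟩ := hl
    refine ⟨L, R, g1, g2, fun s => ?_, g4, g5, g6⟩
    have := I.disc.X_lt s
    rw [← g3, and_iff_left (by omega)]
  · refine ⟨∅, ∅, ⟨by simp, fun i _ => h1 i⟩, ⟨by simp, fun i _ => h2 i⟩, by simp, by simp,
      by simp, by simp, by simp⟩
  · rintro k τ hk hA hs ⟨L, R, g1, g2, g3, g4, g5, g6, g7⟩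
    have e1 : τ.arr .ON = σ.arr .ON := by rw [hA.arr .ON rfl]; rfl
    have e2 : τ.arr .LC = σ.arr .LC := by rw [hA.arr .LC rfl]; rfl
    simp only [St.set_arr, St.set_reg, reduceCtorEq, if_false]
    by_cases hex : ∃ s ∈ N, I.disc.X s = k
    swap
    · have h0 := hN.eq_zero k fun s hs' => fun hh => hex ⟨s, hs', hh⟩
      rw [run_when_neg I (by simp [Ex.ev, hs, e1, h0])]
      refine ⟨L, R, g1, g2, fun s => ?_, g4, g5, g6, g7⟩
      rw [← g3]
      refine and_congr_right fun hs' => ?_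
      have : I.disc.X s ≠ k := fun hh => hex ⟨s, hs', hh⟩
      omega
    obtain ⟨s₀, hs₀, rfl⟩ := hex
    have hX := I.disc.X_lt s₀
    have h0 := hN.eq s₀ hs₀
    have e3 : Ex.ev I τ twoN = 2 * n := ev_twoN I τ
    have hL : ∀ s ∈ L, I.disc.X s < I.disc.X s₀ := fun s hs' => ((g3 s).2 (Or.inl hs')).2
    have hR : ∀ s ∈ R, I.disc.X s < I.disc.X s₀ := fun s hs' => ((g3 s).2 (Or.inr hs')).2
    have hstep : ∀ s, (s ∈ N ∧ I.disc.X s < I.disc.X s₀ + 1) ↔ s = s₀ ∨ s ∈ L ∨ s ∈ R := by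
      intro s
      rw [← g3]
      constructor
      · rintro ⟨k1, k2⟩
        by_cases hss : s = s₀
        · exact Or.inl hss
        · have : I.disc.X s ≠ I.disc.X s₀ := fun hh => hss (I.disc.injX hh)
          exact Or.inr ⟨k1, by omega⟩
      · rintro (rfl | ⟨k1, k2⟩)
        · exact ⟨hs₀, by omega⟩
        · exact ⟨k1, by omega⟩
    rw [run_when_pos I (by simp [Ex.ev, hs, e1, h0])]
    by_cases hlt : L.card < c
    · have hcond : Ex.ev I τ (.lt Rg.cnt (.arr .LC twoN) : E) ≠ 0 := by
        rw [Ex.ev, Ex.ev, Ex.ev, e3, e2, hc, g7, if_pos hlt]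
        decide
      have hcn : L.card ≤ n := (card_le_univ _).trans (by simp)
      have e5 : (L.card + 1) % (4 * n + 8) = L.card + 1 := Nat.mod_eq_of_lt (by omega)
      have hRe := g6 hlt
      subst hRe
      simp only [Pr.run, if_pos hcond]
      simp only [Ex.ev, hs, e1, h0, St.set_arr, St.set_reg, St.put_reg, if_true,
        St.put_arr_self, ne_eq, reduceCtorEq, not_false_eq_true, St.put_arr_of_ne, g7, Fin.val_one,
        e5]
      refine ⟨insert s₀ L, ∅, g1.insert fun s hs' => (hL s hs').ne, g2, fun s => ?_, by simp, ?_,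
        fun _ => rfl, ?_⟩
      · rw [hstep, mem_insert, or_assoc]
      all_goals
        rw [card_insert_of_notMem fun hh => by have := hL _ hh; omega]
      omega
    · have hcond : Ex.ev I τ (.lt Rg.cnt (.arr .LC twoN) : E) = 0 := by
        rw [Ex.ev, Ex.ev, Ex.ev, e3, e2, hc, g7, if_neg hlt]
      have e6 : Ex.ev I τ (twoN - num 1 - Rg.x : E) = I.disc.mirror.X s₀ := by
        rw [ev_sub, ev_sub, e3, ev_one, Ex.ev, hs, Disc.X_mirror]
      simp only [Pr.run, hcond, ne_eq, not_true_eq_false, if_false, e6]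
      simp only [Ex.ev, hs, e1, h0, St.put_reg, St.put_arr_self, ne_eq, reduceCtorEq,
        not_false_eq_true, St.put_arr_of_ne]
      refine ⟨L, insert s₀ R, g1, g2.insert fun s hs' => ?_, fun s => ?_, fun s hs' s' hs'' => ?_,
        g5, fun hh => absurd hh hlt, g7⟩
      · have := hR s hs'
        rw [Disc.X_mirror, Disc.X_mirror]
        omega
      · rw [hstep, mem_insert]
        tauto
      · rw [mem_insert] at hs''
        rcases hs'' with rfl | hs''
        · exact hL s hs'
        · exact g4 s hs' s' hs''

end Code

end BoundaryLabeling

/-! ### Assembling the labeling -/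

namespace BoundaryLabeling

open Finset

namespace Disc

variable {n : ℕ} {D : Disc n} {xt y₀ : ℕ} {e e' : ℕ → ℕ}

open scoped Classical in
theorem Full.card_above (he : D.Full xt y₀ e) :
    (univ.filter (D.Above xt y₀ e)).card = D.tp xt := by
  have h1 := he.count
  have h2 : D.nw xt y₀ = D.bb e y₀ + (univ.filter (D.Above xt y₀ e)).card := by
    unfold nw bb boxSites
    rw [← card_union_of_disjoint]
    · congr 1
      ext s
      simp only [mem_filter, mem_univ, true_and, mem_union, Above, and_true]
      have := he.le (D.Y s)
      omega
    · rw [disjoint_filter]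
      rintro s - h3 h4
      have := h4.2.1
      omega
  omega

theorem Above.not_mirror {s : Fin n} (h : D.Above xt y₀ e s) :
    ¬ D.mirror.Above (2 * n - xt) y₀ e' s := fun h' => by
  have h1 := h.2.2
  have h2 := h'.2.2
  have h3 := D.X_lt s
  rw [X_mirror] at h2
  omega

theorem Above.mirror_le (hx : xt ≤ 2 * n) {s : Fin n}
    (h : D.mirror.Above (2 * n - xt) y₀ e' s) : xt ≤ D.X s := by
  have h2 := h.2.2
  have h3 := D.X_lt s
  rw [X_mirror] at h2
  omega

/-- The classes cover all sites and determine the sides of their ports. Hence a site with a given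
kind of port must belong to the corresponding class. -/
theorem greedyLeft_of_classes {m : Fin n ≃ Fin n} {B L R : Fin n → Prop}
    (hA : ∀ s, D.Above xt y₀ e s → D.side (m s) = .top ∧ D.P (m s) < xt)
    (hB : ∀ s, B s → D.side (m s) = .top ∧ xt ≤ D.P (m s) ∧ xt ≤ D.X s)
    (hL : ∀ s, L s → D.side (m s) = .left) (hR : ∀ s, R s → D.side (m s) = .right)
    (hc : ∀ s, D.Above xt y₀ e s ∨ B s ∨ L s ∨ R s)
    (hLR : ∀ s s', L s → R s' → D.X s < D.X s')
    (gA : ∀ s s', D.Above xt y₀ e s → D.Above xt y₀ e s' → D.Y s < D.Y s' →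
      Prefers (D.X s) (D.P (m s)) (D.P (m s')))
    (gL : ∀ s s', L s → L s' → D.X s < D.X s' → Prefers (D.Y s) (D.P (m s)) (D.P (m s'))) :
    D.GreedyLeft xt y₀ e m := by
  have hl : ∀ s, D.side (m s) = .left → L s := fun s hs => by
    rcases hc s with h | h | h | h
    · have := (hA s h).1.symm.trans hs; cases this
    · have := (hB s h).1.symm.trans hs; cases this
    · exact h
    · have := (hR s h).symm.trans hs; cases this
  have hr : ∀ s, D.side (m s) = .right → R s := fun s hs => by
    rcases hc s with h | h | h | h
    · have := (hA s h).1.symm.trans hs; cases this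
    · have := (hB s h).1.symm.trans hs; cases this
    · have := (hL s h).symm.trans hs; cases this
    · exact h
  refine ⟨fun s hs => ?_, fun s hs => (hA s hs).1, gA,
    fun s s' hs hs' => gL s s' (hl s hs) (hl s' hs'),
    fun s s' hs hs' => hLR s s' (hl s hs) (hr s' hs')⟩
  rcases hc s with h | h | h | h
  · exact Or.inl ⟨(hA s h).2, h⟩
  · exact Or.inr (hB s h).2
  · have := (hL s h).symm.trans hs; cases this
  · have := (hR s h).symm.trans hs; cases this

/-- Ports of different classes differ in their side or lie on different sides of `xt`, and within a
class they differ by the greedy choice. So `f` is injective, hence a bijection, and both halves are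
greedy. -/
theorem planar_of_classes (hx : xt ≤ 2 * n) (he : D.Full xt y₀ e)
    (he' : D.mirror.Full (2 * n - xt) y₀ e') {f : Fin n → Fin n} {L R : Fin n → Prop}
    (hA : ∀ s, D.Above xt y₀ e s → D.side (f s) = .top ∧ D.P (f s) < xt)
    (hB : ∀ s, D.mirror.Above (2 * n - xt) y₀ e' s → D.side (f s) = .top ∧ xt ≤ D.P (f s))
    (hL : ∀ s, L s → D.side (f s) = .left) (hR : ∀ s, R s → D.side (f s) = .right)
    (hc : ∀ s, D.Above xt y₀ e s ∨ D.mirror.Above (2 * n - xt) y₀ e' s ∨ L s ∨ R s)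
    (hLR : ∀ s s', L s → R s' → D.X s < D.X s')
    (gA : ∀ s s', D.Above xt y₀ e s → D.Above xt y₀ e s' → D.Y s < D.Y s' →
      f s ≠ f s' ∧ Prefers (D.X s) (D.P (f s)) (D.P (f s')))
    (gB : ∀ s s', D.mirror.Above (2 * n - xt) y₀ e' s → D.mirror.Above (2 * n - xt) y₀ e' s' →
      D.Y s < D.Y s' →
      f s ≠ f s' ∧ Prefers (D.mirror.X s) (D.mirror.P (f s)) (D.mirror.P (f s')))
    (gL : ∀ s s', L s → L s' → D.X s < D.X s' →
      f s ≠ f s' ∧ Prefers (D.Y s) (D.P (f s)) (D.P (f s')))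
    (gR : ∀ s s', R s → R s' → D.mirror.X s < D.mirror.X s' →
      f s ≠ f s' ∧ Prefers (D.Y s) (D.mirror.P (f s)) (D.mirror.P (f s'))) :
    ∃ m : Fin n ≃ Fin n, (∀ s, m s = f s) ∧ D.Planar m := by
  have hinj : Function.Injective f := by
    intro s s' hss
    by_contra hne
    have hs : D.side (f s) = D.side (f s') := by rw [hss]
    have hP : D.P (f s) = D.P (f s') := by rw [hss]
    have hX : D.X s < D.X s' ∨ D.X s' < D.X s :=
      Nat.lt_or_gt_of_ne fun hh => hne (D.injX hh)
    have hX' : D.mirror.X s < D.mirror.X s' ∨ D.mirror.X s' < D.mirror.X s :=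
      Nat.lt_or_gt_of_ne fun hh => hne (D.mirror.injX hh)
    have hY : D.Y s < D.Y s' ∨ D.Y s' < D.Y s :=
      Nat.lt_or_gt_of_ne fun hh => hne (D.injY hh)
    rcases hc s with h | h | h | h <;> rcases hc s' with h' | h' | h' | h'
    · rcases hY with hY | hY
      · exact (gA s s' h h' hY).1 hss
      · exact (gA s' s h' h hY).1 hss.symm
    · have := (hA s h).2; have := (hB s' h').2; omega
    · rw [(hA s h).1, hL s' h'] at hs; cases hs
    · rw [(hA s h).1, hR s' h'] at hs; cases hs
    · have := (hB s h).2; have := (hA s' h').2; omega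
    · rcases hY with hY | hY
      · exact (gB s s' h h' hY).1 hss
      · exact (gB s' s h' h hY).1 hss.symm
    · rw [(hB s h).1, hL s' h'] at hs; cases hs
    · rw [(hB s h).1, hR s' h'] at hs; cases hs
    · rw [hL s h, (hA s' h').1] at hs; cases hs
    · rw [hL s h, (hB s' h').1] at hs; cases hs
    · rcases hX with hX | hX
      · exact (gL s s' h h' hX).1 hss
      · exact (gL s' s h' h hX).1 hss.symm
    · rw [hL s h, hR s' h'] at hs; cases hs
    · rw [hR s h, (hA s' h').1] at hs; cases hs
    · rw [hR s h, (hB s' h').1] at hs; cases hs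
    · rw [hR s h, hL s' h'] at hs; cases hs
    · rcases hX' with hX | hX
      · exact (gR s s' h h' hX).1 hss
      · exact (gR s' s h' h hX).1 hss.symm
  obtain ⟨m, hm⟩ : ∃ m : Fin n ≃ Fin n, ∀ s, m s = f s :=
    ⟨Equiv.ofBijective f (Finite.injective_iff_bijective.1 hinj), fun s => rfl⟩
  refine ⟨m, hm, planar_of_greedy hx he he' ?_ ?_⟩
  · refine greedyLeft_of_classes (B := D.mirror.Above (2 * n - xt) y₀ e') (L := L) (R := R)
      ?_ ?_ ?_ ?_ hc hLR ?_ ?_ <;> try simp only [hm]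
    · exact hA
    · exact fun s hs => ⟨(hB s hs).1, (hB s hs).2, hs.mirror_le hx⟩
    · exact hL
    · exact hR
    · exact fun s s' h h' hlt => (gA s s' h h' hlt).2
    · exact fun s s' h h' hlt => (gL s s' h h' hlt).2
  · refine greedyLeft_of_classes (B := D.Above xt y₀ e) (L := R) (R := L) ?_ ?_ ?_ ?_ ?_ ?_ ?_ ?_
      <;> try simp only [hm]
    · intro s hs
      obtain ⟨h1, h2⟩ := hB s hs
      have h3 := D.P_lt (f s)
      refine ⟨D.mirror_eq_top.2 h1, ?_⟩
      rw [D.P_mirror_top h1]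
      omega
    · intro s hs
      obtain ⟨h1, h2⟩ := hA s hs
      have h3 := D.P_lt (f s)
      have h4 := hs.2.2
      refine ⟨D.mirror_eq_top.2 h1, ?_, ?_⟩
      · rw [D.P_mirror_top h1]
        omega
      · rw [X_mirror]
        omega
    · exact fun s hs => D.mirror_eq_left.2 (hR s hs)
    · exact fun s hs => D.mirror_eq_right.2 (hL s hs)
    · intro s
      have := hc s
      tauto
    · intro s s' hs hs'
      have h1 := hLR s' s hs' hs
      have h2 := D.X_lt s
      rw [X_mirror, X_mirror]
      omega
    · exact fun s s' h h' hlt => (gB s s' h h' hlt).2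
    · exact fun s s' h h' hlt => (gR s s' h h' hlt).2

end Disc

namespace Code

variable {n : ℕ} (I : Instance n)

theorem greedy_arr {O K Q a : Ar} (h1 : a ≠ .OUT) (h2 : a ≠ Q) (σ : St Rg Ar) :
    ((greedy O K Q).run I σ).arr a = σ.arr a :=
  run_arr I (by simp [greedy, when, Pr.writesA, choice, h1.symm, h2.symm]) σ

/-- The part of the program that constructs the labeling from the marked rows. -/
theorem run_labeling {σ : St Rg Ar} (h : ∀ s, RankAt I σ s)
    (h0 : ∀ a ∈ [Ar.OT, .OTM, .ON, .OL, .OR, .PT, .PTM, .PL, .PR], ∀ i, σ.arr a i = 0)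
    (hlc : σ.arr .LC (2 * n) = I.disc.lp (2 * n)) {xt y₀ : ℕ} (hx : σ.reg .xs = xt)
    (hx' : xt ≤ 2 * n) {e e' : ℕ → ℕ} (he : I.disc.Full xt y₀ e)
    (he' : I.disc.mirror.Full (2 * n - xt) y₀ e')
    (hp : ∀ s, σ.arr .FT (I.disc.Y s) = 1 ↔ I.disc.Above xt y₀ e s)
    (hq : ∀ s, σ.arr .FTM (I.disc.Y s) = 1 ↔ I.disc.mirror.Above (2 * n - xt) y₀ e' s) :
    ∃ m : Fin n ≃ Fin n, I.disc.Planar m ∧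
      ∀ s : Fin n, ((classes ;; halves ;; ports ;; greedy .OT .X .PT ;; greedy .OTM .XM .PTM ;;
        greedy .OL .Y .PL ;; greedy .OR .Y .PR : C).run I σ).arr .OUT s = m s := by
  classical
  set D := I.disc with hD
  simp only [run_seq]
  obtain ⟨a1, a2, a3⟩ := run_classes I h (h0 _ (by simp)) (h0 _ (by simp)) (h0 _ (by simp)) hp hq
  have b1 : ∀ {a : Ar}, classes.writesA a = false → (classes.run I σ).arr a = σ.arr a :=
    fun hh => run_arr I hh σ
  have b2 : (classes.run I σ).reg .xs = xt := by rw [run_reg I rfl, hx]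
  generalize classes.run I σ = τ at *
  obtain ⟨L, R, c1, c2, c3, c4, c5, c6⟩ := run_halves I a3 (c := D.lp (2 * n))
    (by rw [b1 rfl, hlc]) (by rw [b1 rfl]; exact h0 _ (by simp))
    (by rw [b1 rfl]; exact h0 _ (by simp))
  have d1 : ∀ {a : Ar}, halves.writesA a = false → (halves.run I τ).arr a = τ.arr a :=
    fun hh => run_arr I hh τ
  have d2 : (halves.run I τ).reg .xs = xt := by rw [run_reg I rfl, b2]
  rw [← d1 rfl] at a1 a2
  replace d1 : ∀ {a : Ar}, classes.writesA a = false → halves.writesA a = false →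
      (halves.run I τ).arr a = σ.arr a := fun h1 h2 => (d1 h2).trans (b1 h1)
  generalize halves.run I τ = υ at *
  have hυ : ∀ s, RankAt I υ s := fun s => ⟨by rw [d1 rfl rfl, (h s).X],
    by rw [d1 rfl rfl, (h s).XM], by rw [d1 rfl rfl, (h s).Y], by rw [d1 rfl rfl, (h s).P],
    by rw [d1 rfl rfl, (h s).PM], by rw [d1 rfl rfl, (h s).SD], by rw [d1 rfl rfl, (h s).SDM]⟩
  obtain ⟨p1, p2, p3, p4⟩ := run_ports I hυ (by rw [d1 rfl rfl]; exact h0 _ (by simp))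
    (by rw [d1 rfl rfl]; exact h0 _ (by simp)) (by rw [d1 rfl rfl]; exact h0 _ (by simp))
    (by rw [d1 rfl rfl]; exact h0 _ (by simp)) d2
  have f1 : ∀ {a : Ar}, ports.writesA a = false → (ports.run I υ).arr a = υ.arr a :=
    fun hh => run_arr I hh υ
  rw [← f1 rfl] at a1 a2 c1 c2
  have gX : ∀ s : Fin n, (ports.run I υ).arr .X s = D.X s := fun s => by rw [f1 rfl, (hυ s).X]
  have gXM : ∀ s : Fin n, (ports.run I υ).arr .XM s = D.mirror.X s :=
    fun s => by rw [f1 rfl, (hυ s).XM]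
  have gY : ∀ s : Fin n, (ports.run I υ).arr .Y s = D.Y s := fun s => by rw [f1 rfl, (hυ s).Y]
  generalize ports.run I υ = φ at *
  have e1 : (univ.filter fun s => ¬ D.Above xt y₀ e s ∧ D.mirror.Above (2 * n - xt) y₀ e' s) =
      univ.filter (D.mirror.Above (2 * n - xt) y₀ e') := by
    ext s
    simp only [mem_filter, mem_univ, true_and, and_iff_right_iff_imp]
    exact fun h1 h2 => h2.not_mirror h1
  rw [e1] at a2
  have n1 := he.card_above
  have n2 := he'.card_above
  have n3 : D.mirror.tp (2 * n - xt) =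
      (univ.filter fun j => D.side j = .top ∧ xt ≤ D.P j).card := by
    unfold Disc.tp
    congr 1
    ext j
    simp only [mem_filter, mem_univ, true_and, Disc.mirror_eq_top]
    refine and_congr_right fun hj => ?_
    have := D.P_lt j
    rw [D.P_mirror_top hj]
    omega
  have n4 : D.lp (2 * n) = (univ.filter fun j => D.side j = .left).card := by
    unfold Disc.lp
    congr 1
    ext j
    have := D.P_lt j
    simp only [mem_filter, mem_univ, true_and, this, and_true]
  have n5 : (univ.filter fun j => D.side j = .left).card + D.tp xt +
      (univ.filter fun j => D.side j = .top ∧ xt ≤ D.P j).card +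
      (univ.filter fun j => D.side j = .right).card = n := by
    unfold Disc.tp
    simp only [card_filter, ← sum_add_distrib]
    rw [sum_congr rfl (g := fun _ => 1)]
    · simp
    · intro j _
      by_cases hj : D.P j < xt
      · cases D.side j <;> simp [hj]
      · cases D.side j <;> simp [hj, not_lt.1 hj]
  have n6 : (univ.filter (D.Above xt y₀ e)).card +
      (univ.filter (D.mirror.Above (2 * n - xt) y₀ e')).card + L.card + R.card = n := by
    have hLR : ∀ A : Finset (Fin n), A.card = (univ.filter (· ∈ A)).card := fun A => by
      congr 1
      ext s
      simp
    rw [hLR L, hLR R]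
    simp only [card_filter, ← sum_add_distrib]
    rw [sum_congr rfl (g := fun _ => 1)]
    · simp
    · intro s _
      have hs := c3 s
      simp only [mem_filter, mem_univ, true_and] at hs
      by_cases h1 : D.Above xt y₀ e s
      · have h2 := h1.not_mirror (e' := e')
        simp [h1, h2] at hs ⊢
        simp [hs]
      · by_cases h2 : D.mirror.Above (2 * n - xt) y₀ e' s
        · simp [h1, h2] at hs ⊢
          simp [hs]
        · by_cases h3 : s ∈ L
          · have h4 : s ∉ R := fun h4 => lt_irrefl _ (c4 s h3 s h4)
            simp [h1, h2, h3, h4]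
          · simp [h1, h2, h3] at hs ⊢
            exact hs
  -- Either the left side is not filled and `R` is empty, or `L` uses all left ports; then the
  -- equality of the total numbers of sites and ports leaves for `R` exactly as many sites as there
  -- are right ports.
  have n7 : R.card ≤ (univ.filter fun j => D.side j = .right).card := by
    by_cases hlt : L.card < D.lp (2 * n)
    · simp [c6 hlt]
    · omega
  have hX := D.X_lt
  have hY := D.Y_lt
  have hP := D.P_lt
  have hX' := D.mirror.X_lt
  have hP' := D.mirror.P_lt
  obtain ⟨f₁, r1, s1, t1⟩ := run_greedy I (O := .OT) (K := .X) (Q := .PT) (by decide) (by decide)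
    (by decide) (by decide) (by decide) a1 (fun s _ => (hY s).trans (by omega))
    (fun s _ => gX s) p2 (fun j _ => (hP j).le) n1.le
    (fun s _ j hj => D.P_ne_X j (mem_filter.1 hj).2.1 s)
  rw [← greedy_arr I (O := .OT) (K := .X) (Q := .PT) (by decide) (by decide)] at a2 c1 c2 p3 p1 p4
  simp only [← greedy_arr I (O := .OT) (K := .X) (Q := .PT) (a := .XM) (by decide) (by decide) φ,
    ← greedy_arr I (O := .OT) (K := .X) (Q := .PT) (a := .Y) (by decide) (by decide) φ] at gXM gY
  generalize (greedy .OT .X .PT).run I φ = φ₁ at *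
  obtain ⟨f₂, r2, s2, t2⟩ := run_greedy I (O := .OTM) (K := .XM) (Q := .PTM) (by decide)
    (by decide) (by decide) (by decide) (by decide) a2 (fun s _ => (hY s).trans (by omega))
    (fun s _ => gXM s) p3 (fun j _ => (hP' j).le) (n2.trans n3).le
    (fun s _ j hj => D.mirror.P_ne_X j (D.mirror_eq_top.2 (mem_filter.1 hj).2.1) s)
  rw [← greedy_arr I (O := .OTM) (K := .XM) (Q := .PTM) (by decide) (by decide)] at c1 c2 p1 p4
  simp only [← greedy_arr I (O := .OTM) (K := .XM) (Q := .PTM) (a := .Y) (by decide) (by decide)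
    φ₁] at gY
  generalize (greedy .OTM .XM .PTM).run I φ₁ = φ₂ at *
  obtain ⟨f₃, r3, s3, t3⟩ := run_greedy I (O := .OL) (K := .Y) (Q := .PL) (by decide)
    (by decide) (by decide) (by decide) (by decide) c1 (fun s _ => (hX s).trans (by omega))
    (fun s _ => gY s) p1 (fun j _ => (hP j).le) (c5.trans n4.le)
    (fun s _ j hj => D.P_ne_Y j (by rw [(mem_filter.1 hj).2]; simp) s)
  rw [← greedy_arr I (O := .OL) (K := .Y) (Q := .PL) (by decide) (by decide)] at c2 p4
  simp only [← greedy_arr I (O := .OL) (K := .Y) (Q := .PL) (a := .Y) (by decide) (by decide)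
    φ₂] at gY
  generalize (greedy .OL .Y .PL).run I φ₂ = φ₃ at *
  obtain ⟨f₄, r4, s4, t4⟩ := run_greedy I (O := .OR) (K := .Y) (Q := .PR) (by decide)
    (by decide) (by decide) (by decide) (by decide) c2 (fun s _ => (hX' s).trans (by omega))
    (fun s _ => gY s) p4 (fun j _ => (hP' j).le) n7
    (fun s _ j hj => D.mirror.P_ne_Y j (by
      rw [Ne, D.mirror_eq_top, (mem_filter.1 hj).2]; simp) s)
  generalize (greedy .OR .Y .PR).run I φ₃ = φ₄ at *
  simp only [mem_filter, mem_univ, true_and] at r1 r2 r3 r4 s1 s2 t1 t2 c3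
  have hnL : ∀ s, D.Above xt y₀ e s ∨ D.mirror.Above (2 * n - xt) y₀ e' s → s ∉ L ∧ s ∉ R := by
    intro s hs
    have := c3 s
    tauto
  have o4 : ∀ s ∈ R, φ₄.arr .OUT s = f₄ s := fun s hs => (r4 s hs).2
  have o3 : ∀ s ∈ L, φ₄.arr .OUT s = f₃ s := fun s hs => by
    rw [t4 s fun hh => lt_irrefl _ (c4 s hs s hh), (r3 s hs).2]
  have o2 : ∀ s, D.mirror.Above (2 * n - xt) y₀ e' s → φ₄.arr .OUT s = f₂ s := fun s hs => by
    rw [t4 s (hnL s (Or.inr hs)).2, t3 s (hnL s (Or.inr hs)).1, (r2 s hs).2]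
  have o1 : ∀ s, D.Above xt y₀ e s → φ₄.arr .OUT s = f₁ s := fun s hs => by
    rw [t4 s (hnL s (Or.inl hs)).2, t3 s (hnL s (Or.inl hs)).1, t2 s hs.not_mirror, (r1 s hs).2]
  have hc : ∀ s, D.Above xt y₀ e s ∨ D.mirror.Above (2 * n - xt) y₀ e' s ∨ s ∈ L ∨ s ∈ R := by
    intro s
    have := c3 s
    tauto
  have hex : ∀ s : Fin n, ∃ j : Fin n, φ₄.arr .OUT s = j := fun s => by
    rcases hc s with hs | hs | hs | hs
    exacts [⟨_, o1 s hs⟩, ⟨_, o2 s hs⟩, ⟨_, o3 s hs⟩, ⟨_, o4 s hs⟩]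
  choose f hf using hex
  have f1 : ∀ s, D.Above xt y₀ e s → f s = f₁ s := fun s hs => Fin.ext ((hf s).symm.trans (o1 s hs))
  have f2 : ∀ s, D.mirror.Above (2 * n - xt) y₀ e' s → f s = f₂ s :=
    fun s hs => Fin.ext ((hf s).symm.trans (o2 s hs))
  have f3 : ∀ s ∈ L, f s = f₃ s := fun s hs => Fin.ext ((hf s).symm.trans (o3 s hs))
  have f4 : ∀ s ∈ R, f s = f₄ s := fun s hs => Fin.ext ((hf s).symm.trans (o4 s hs))
  obtain ⟨m, hm, hm'⟩ := Disc.planar_of_classes (f := f) (L := (· ∈ L)) (R := (· ∈ R)) hx' he he'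
    (fun s hs => by rw [f1 s hs]; exact (r1 s hs).1)
    (fun s hs => by rw [f2 s hs]; exact (r2 s hs).1)
    (fun s hs => by rw [f3 s hs]; exact (r3 s hs).1)
    (fun s hs => by rw [f4 s hs]; exact (r4 s hs).1) hc (fun s s' hs hs' => c4 s hs s' hs')
    (fun s s' hs hs' => by rw [f1 s hs, f1 s' hs']; exact s1 s hs s' hs')
    (fun s s' hs hs' => by rw [f2 s hs, f2 s' hs']; exact s2 s hs s' hs')
    (fun s s' hs hs' => by rw [f3 s hs, f3 s' hs']; exact s3 s hs s' hs')
    (fun s s' hs hs' => by rw [f4 s hs, f4 s' hs']; exact s4 s hs s' hs')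
  exact ⟨m, hm', fun s => by rw [hf, hm]⟩

variable {I} in
theorem RankAt.run {σ : St Rg Ar} {s : Fin n} (h : RankAt I σ s) (I' : Instance n) {c : C}
    (hc : [Ar.X, .XM, .Y, .P, .PM, .SD, .SDM].all (fun a => !c.writesA a) = true) :
    RankAt I (c.run I' σ) s := by
  simp only [List.all_cons, List.all_nil, Bool.and_true, Bool.and_eq_true,
    Bool.not_eq_true'] at hc
  obtain ⟨h1, h2, h3, h4, h5, h6, h7⟩ := hc
  exact ⟨by rw [run_arr I' h1, h.X], by rw [run_arr I' h2, h.XM], by rw [run_arr I' h3, h.Y],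
    by rw [run_arr I' h4, h.P], by rw [run_arr I' h5, h.PM], by rw [run_arr I' h6, h.SD],
    by rw [run_arr I' h7, h.SDM]⟩

theorem RankAt.set {σ : St Rg Ar} {s : Fin n} (h : RankAt I σ s) (ri : Rg) (x : ℕ) :
    RankAt I (σ.set ri x) s := ⟨h.X, h.XM, h.Y, h.P, h.PM, h.SD, h.SDM⟩

theorem allZero_run {σ : St Rg Ar} (c : C) {l : List Ar}
    (hc : l.all (fun a => !c.writesA a) = true) (h : ∀ a ∈ l, ∀ i, σ.arr a i = 0) :
    ∀ a ∈ l, ∀ i, (c.run I σ).arr a i = 0 := fun a ha i => by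
  rw [List.all_eq_true] at hc
  rw [run_arr I (by simpa using hc a ha), h a ha]

/-- The result of the program. -/
theorem run_main {σ : St Rg Ar} (h0 : ∀ a i, σ.arr a i = 0) :
    I.CorrectOutput ((main.run I σ).reg .found) ((main.run I σ).arr .OUT) := by
  unfold main
  rw [run_seq, run_seq, run_seq, run_seq]
  have a1 := run_ranks I σ
  have z1 := allZero_run I ranks (l := [.RC, .RCM, .FT, .FTM, .OT, .OTM, .ON, .OL, .OR, .PT, .PTM,
    .PL, .PR]) rfl fun a _ => h0 a
  generalize ranks.run I σ = σ₁ at *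
  have b1 := run_prep I (D := I.disc) (m := false) (σ := σ₁) ⟨fun s => (a1 s).X, fun s => (a1 s).Y,
    fun s => (a1 s).P, fun s => (a1 s).SD⟩ (z1 .RC (by simp))
  have a2 := fun s => (a1 s).run I (c := prep false) rfl
  have z2 := allZero_run I (prep false) (l := [.RCM, .FT, .FTM, .OT, .OTM, .ON, .OL, .OR, .PT, .PTM,
    .PL, .PR]) rfl fun a ha => z1 a (List.mem_cons_of_mem _ ha)
  generalize (prep false).run I σ₁ = σ₂ at *
  have b2 := run_prep I (D := I.disc.mirror) (m := true) (σ := σ₂) ⟨fun s => (a2 s).XM,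
    fun s => (a2 s).Y, fun s => (a2 s).PM, fun s => (a2 s).SDM⟩ (z2 .RCM (by simp))
  replace b1 := b1.run I (c := prep true) rfl
  have a3 := fun s => (a2 s).run I (c := prep true) rfl
  have z3 := allZero_run I (prep true) (l := [.FT, .FTM, .OT, .OTM, .ON, .OL, .OR, .PT, .PTM,
    .PL, .PR]) rfl fun a ha => z2 a (List.mem_cons_of_mem _ ha)
  generalize (prep true).run I σ₂ = σ₃ at *
  have hs := run_search I b1 b2
  replace b1 := b1.run I (c := search) rfl
  replace b2 := b2.run I (c := search) rfl
  have a4 := fun s => (a3 s).run I (c := search) rfl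
  have z4 := allZero_run I search rfl z3
  generalize search.run I σ₃ = σ₄ at *
  rcases hs with ⟨g1, g2, g3, g4, g5⟩ | ⟨g1, g2⟩
  swap
  · rw [run_when_neg I (by simp [Ex.ev, g1])]
    -- A planar solution would provide a cut point with two admissible paths, and the search has
    -- excluded all of them.
    refine ⟨fun ⟨m, hm⟩ => ?_, fun _ => g1⟩
    obtain ⟨xt, y₀, h1, h2, h3⟩ := ((I.isPlanarSolution_iff m).1 hm).exists_full
    exact absurd h3 (g2 xt h1 y₀ h2)
  rw [run_when_pos I (by simp [Ex.ev, g1]), run_seq, run_seq, run_seq, run_seq, run_set, run_set]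
  have e1 : Ex.ev I σ₄ (Rg.xs : E) = σ₄.reg .xs := rfl
  rw [e1]
  generalize hxt : σ₄.reg .xs = xt at *
  generalize hy₀ : σ₄.reg .ys = y₀ at *
  obtain ⟨e, he, hm⟩ := run_trace I (D := I.disc) (m := false) (σ := σ₄.set .u xt)
    (b1.congr rfl rfl rfl) (by simp) g2 (y₀ := y₀) (by simp [hy₀]) g3 g4 (z4 .FT (by simp))
  have b3 : Tables I.disc false ((trace false).run I (σ₄.set .u xt)) :=
    Tables.run I (σ := σ₄.set .u xt) (b1.congr rfl rfl rfl) rfl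
  have b4 : Tables I.disc.mirror true ((trace false).run I (σ₄.set .u xt)) :=
    Tables.run I (σ := σ₄.set .u xt) (b2.congr rfl rfl rfl) rfl
  have r1 : ((trace false).run I (σ₄.set .u xt)).reg .xs = xt := by
    rw [run_reg I rfl]; simp [hxt]
  have r2 : ((trace false).run I (σ₄.set .u xt)).reg .ys = y₀ := by
    rw [run_reg I rfl]; simp [hy₀]
  have r3 : ((trace false).run I (σ₄.set .u xt)).reg .found = 1 := by
    rw [run_reg I rfl]; simp [g1]
  have a5 := fun s => (RankAt.set I (a4 s) .u xt).run I (c := trace false) rfl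
  have z5 := allZero_run I (trace false) (σ := σ₄.set .u xt) (l := [.FTM, .OT, .OTM, .ON, .OL, .OR,
    .PT, .PTM, .PL, .PR]) rfl fun a ha => z4 a (List.mem_cons_of_mem _ ha)
  generalize (trace false).run I (σ₄.set .u xt) = σ₅ at *
  have e2 : Ex.ev I σ₅ (twoN - Rg.xs : E) = 2 * n - xt := by
    rw [ev_sub, ev_twoN, Ex.ev, r1]
  rw [e2]
  obtain ⟨e', he', hm'⟩ := run_trace I (D := I.disc.mirror) (m := true)
    (σ := σ₅.set .u (2 * n - xt)) (b4.congr rfl rfl rfl) (by simp) (by omega) (y₀ := y₀)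
    (by simp [r2]) g3 g5 (z5 .FTM (by simp))
  have r4 : ((trace true).run I (σ₅.set .u (2 * n - xt))).reg .xs = xt := by
    rw [run_reg I rfl]; simp [r1]
  have r5 : ((trace true).run I (σ₅.set .u (2 * n - xt))).reg .found = 1 := by
    rw [run_reg I rfl]; simp [r3]
  have b5 : Tables I.disc false ((trace true).run I (σ₅.set .u (2 * n - xt))) :=
    Tables.run I (σ := σ₅.set .u (2 * n - xt)) (b3.congr rfl rfl rfl) rfl
  have k1 : ((trace true).run I (σ₅.set .u (2 * n - xt))).arr .FT = σ₅.arr .FT := run_arr I rfl _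
  have a6 := fun s => (RankAt.set I (a5 s) .u (2 * n - xt)).run I (c := trace true) rfl
  have z6 := allZero_run I (trace true) (σ := σ₅.set .u (2 * n - xt)) (l := [.OT, .OTM, .ON, .OL,
    .OR, .PT, .PTM, .PL, .PR]) rfl fun a ha => z5 a (List.mem_cons_of_mem _ ha)
  generalize (trace true).run I (σ₅.set .u (2 * n - xt)) = σ₆ at *
  obtain ⟨m, h1, h2⟩ := run_labeling I a6 z6 (b5.lc (2 * n) (by omega)) r4 g2 he he'
    (fun s => by
      rw [k1]
      refine (hm _).trans ⟨fun ⟨s', h1, h2⟩ => I.disc.injY h1 ▸ h2, fun h => ⟨s, rfl, h⟩⟩)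
    (fun s => (hm' _).trans ⟨fun ⟨s', h1, h2⟩ => I.disc.injY h1 ▸ h2, fun h => ⟨s, rfl, h⟩⟩)
  have h3 := (I.isPlanarSolution_iff m).2 h1
  refine ⟨fun _ => ⟨?_, m, h3, h2⟩, fun hn => absurd ⟨m, h3⟩ hn⟩
  rw [run_reg I rfl, r5]

end Code

end BoundaryLabeling

/-! ### Time and space bounds -/

namespace BoundaryLabeling

namespace Code

/-- The program for the machine. -/
noncomputable def prog : Program :=
  ⟨Fintype.card Rg, Fintype.card Ar, main.comp, regIx Rg .found, regIx Ar .OUT⟩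

/-- The time bound. -/
noncomputable def time (n : ℕ) : ℕ := main.size * (2 * n + 3) ^ 4

/-- The space bound. -/
def space (n : ℕ) : ℕ :=
  Fintype.card Rg + Fintype.card Ar * (4 * n + 8) + (n + 1) + (4 * n + 2)

theorem prog_solves : prog.SolvesThreeSided 10 time space := by
  intro n I
  obtain ⟨-, t, ht, hexec⟩ := Pr.exec I main main_wf ⟨fun _ => 0, fun _ _ => 0⟩
    ⟨fun _ => by change 0 < _; omega, fun _ _ => by change 0 < _; omega⟩
  rw [main_depth] at ht
  refine ⟨4 * n + 8, t, _, by omega, hexec, ht, ?_, ?_⟩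
  · change _ + _ + _ + _ ≤ _
    rw [words_length, reals_length]
    exact le_rfl
  · have := run_main I (σ := ⟨fun _ => 0, fun _ _ => 0⟩) fun _ _ => rfl
    simpa [prog, St.enc] using this

theorem isBigO_linear (a b : ℕ) :
    Asymptotics.IsBigO Filter.atTop (fun n : ℕ => ((a * n + b : ℕ) : ℝ)) (fun n : ℕ => (n : ℝ)) := by
  refine Asymptotics.IsBigO.of_bound (a + b : ℝ) ?_
  filter_upwards [Filter.eventually_ge_atTop 1] with n hn
  rw [Real.norm_natCast, Real.norm_natCast]
  have : a * n + b ≤ (a + b) * n := by nlinarith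
  exact_mod_cast this

theorem isBigO_time :
    Asymptotics.IsBigO Filter.atTop (fun n => (time n : ℝ)) (fun n : ℕ => (n : ℝ) ^ 4) := by
  have h := ((isBigO_linear 2 3).pow 4).const_mul_left (main.size : ℝ)
  refine h.congr_left fun n => ?_
  simp [time]

theorem isBigO_space :
    Asymptotics.IsBigO Filter.atTop (fun n => (space n : ℝ)) (fun n : ℕ => (n : ℝ)) := by
  refine (isBigO_linear (Fintype.card Ar * 4 + 5) (Fintype.card Rg + Fintype.card Ar * 8 + 3)).congr_left
    fun n => ?_
  rw [space]
  push_cast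
  ring

end Code

end BoundaryLabeling

theorem mainTheorem9 :
    ∃ (p : BoundaryLabeling.Program) (c : ℕ) (T S : ℕ → ℕ),
      Asymptotics.IsBigO Filter.atTop (fun n => (T n : ℝ)) (fun n : ℕ => (n : ℝ) ^ 4) ∧
      Asymptotics.IsBigO Filter.atTop (fun n => (S n : ℝ)) (fun n : ℕ => (n : ℝ)) ∧
      p.SolvesThreeSided c T S := by
  exact ⟨BoundaryLabeling.Code.prog, 10, BoundaryLabeling.Code.time, BoundaryLabeling.Code.space,
    BoundaryLabeling.Code.isBigO_time, BoundaryLabeling.Code.isBigO_space,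
    BoundaryLabeling.Code.prog_solves⟩
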